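/- Let $\Sigma=\mathbb{C}/\Lambda$ be a flat two-torus with Cartesian coordinates $z=x+iy$, let $S^2\subset\mathbb{R}^3$ be the unit sphere, and let $n\ge 2$. Let $\mathsf{M}_n$ be the set of degree $n$ holomorphic maps $\phi:\Sigma\to S^2$, that is, smooth maps with $\phi_y=\phi\times\phi_x$ and $\frac{1}{4\pi}\int_\Sigma\phi\cdot(\phi_x\times\phi_y)=n$. For $\phi\in\mathsf{M}_n$ let $\ker J_\phi$ be the kernel of the Jacobi operator $$J_\phi V=-V_{xx}-V_{yy}-(|\phi_x|^2+|\phi_y|^2)V-2(\phi_x\cdot V_x+\phi_y\cdot V_y)\phi$$ acting on smooth tangent sections, i.e. smooth $V:\Sigma\to\mathbb{R}^3$ with $\phi\cdot V=0$ pointwise. Let $\psi:U\times\Sigma\to S^2$ be a smooth local parametrization of $\mathsf{M}_n$: $U\subset\mathbb{R}^{4n}$ is open, $\psi$ is smooth and, for each $q\in U$, $\psi(q)=\psi(q,\cdot)\in\mathsf{M}_n$ and the derivatives $\partial\psi/\partial q^\mu$, $\mu=1,\ldots,4n$, at $q$ span $\ker J_{\psi(q)}$. Let $H^k$ be the Sobolev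 space of maps $Y:\Sigma\to\mathbb{R}^3$ whose weak partial derivatives up to order $k$ are square integrable, with norm $\|Y\|_k^2=\sum_{|\alpha|\le k}\int_\Sigma|D_\alpha Y|^2$, where $\alpha$ runs over words in the letters $x,y$ and $|\alpha|$ is the length of $\alpha$. For $q\in U$, with $\psi=\psi(q)$, define on $H^1$ the quadratic form $$Q_1(Y)=\int_\Sigma\left\{|Y_x|^2+|Y_y|^2-(|\psi_x|^2+|\psi_y|^2)|Y|^2-4(\psi_x\cdot Y_x+\psi_y\cdot Y_y)\,\psi\cdot Y\right\}.$$ Theorem (near coercivity of $Q_1$). There exist constants $c(q),\widetilde c(q)>0$, depending continuously on $q\in U$ and independent of $\varepsilon$ and $Y$, such that for all $q\in U$ and all $\varepsilon>0$ $$Q_1(Y)\ \ge\ c(q)\|Y\|_1^2-\varepsilon^2\,\widetilde c(q)\,\|Y\|_1\|Y\|_2^2$$ for all $Y\in H^2$ that satisfy the pointwise constraint $\psi(q)\cdot Y=-\frac12\varepsilon^2|Y|^2$ almost everywhere on $\Sigma$ and are $L^2$ orthogonal to $\ker J_{\psi(q)}$. -/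

import Mathlib

/-! Maps from a flat two-torus `Σ = ℂ / Λ`, with `Λ = ℤ b₀ + ℤ b₁` for an arbitrary real basis `b` of
`ℂ`, to `ℝ³` and to the unit sphere `S² ⊂ ℝ³`. Functions on `Σ` are `Λ`-periodic functions on `ℂ`,
with Cartesian coordinates `z = x + i y`. -/

namespace TorusLump

noncomputable section

/-- Euclidean three-space. -/
abbrev R3 : Type := EuclideanSpace ℝ (Fin 3)

/-- The vector product on `ℝ³`. -/
def cross (u v : R3) : R3 := WithLp.toLp 2 (crossProduct (WithLp.ofLp u) (WithLp.ofLp v))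

/-- `f` is a function on the torus `ℂ / Λ`. -/
def Periodic {F : Type*} (b : Module.Basis (Fin 2) ℝ ℂ) (f : ℂ → F) : Prop :=
  ∀ (i : Fin 2) (z : ℂ), f (z + b i) = f z

/-- The area measure of the torus: Lebesgue measure on a fundamental parallelogram. -/
def area (b : Module.Basis (Fin 2) ℝ ℂ) : MeasureTheory.Measure ℂ :=
  MeasureTheory.volume.restrict (ZSpan.fundamentalDomain b)

/-- Classical partial derivative in `x`. -/
def dx (f : ℂ → R3) (z : ℂ) : R3 := fderiv ℝ f z (1 : ℂ)

/-- Classical partial derivative in `y`. -/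
def dy (f : ℂ → R3) (z : ℂ) : R3 := fderiv ℝ f z Complex.I

/-! ### Sobolev spaces on the torus -/

/-- `g ∈ L²` is the weak derivative of `f` on the torus in the constant direction `v`. -/
def IsWeakDeriv (b : Module.Basis (Fin 2) ℝ ℂ) (v : ℂ) (f g : ℂ → R3) : Prop :=
  Periodic b g ∧ MeasureTheory.MemLp g 2 (area b) ∧
    ∀ η : ℂ → ℝ, ContDiff ℝ (⊤ : ℕ∞) η → Periodic b η →
      ∫ z, (fderiv ℝ η z v) • f z ∂(area b) = -∫ z, η z • g z ∂(area b)

open Classical in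
/-- The weak derivative of `f` in the direction `v` (unique almost everywhere when it exists; zero by
convention when it does not). -/
def weakDeriv (b : Module.Basis (Fin 2) ℝ ℂ) (v : ℂ) (f : ℂ → R3) : ℂ → R3 :=
  if h : ∃ g, IsWeakDeriv b v f g then h.choose else 0

/-- Membership of `H^k`: the weak partial derivatives up to order `k` exist and are square
integrable. -/
def MemH (b : Module.Basis (Fin 2) ℝ ℂ) : ℕ → (ℂ → R3) → Prop
  | 0, f => Periodic b f ∧ MeasureTheory.MemLp f 2 (area b)
  | k + 1, f => Periodic b f ∧ MeasureTheory.MemLp f 2 (area b) ∧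
      (∃ g, IsWeakDeriv b 1 f g) ∧ (∃ g, IsWeakDeriv b Complex.I f g) ∧
      MemH b k (weakDeriv b 1 f) ∧ MemH b k (weakDeriv b Complex.I f)

/-- The squared norm of `H^k`: the sum, over all words `α` in `x, y` of length at most `k`, of
`∫ |D_α f|²`. -/
def sobNormSq (b : Module.Basis (Fin 2) ℝ ℂ) : ℕ → (ℂ → R3) → ℝ
  | 0, f => ∫ z, ‖f z‖ ^ 2 ∂(area b)
  | k + 1, f => (∫ z, ‖f z‖ ^ 2 ∂(area b)) +
      sobNormSq b k (weakDeriv b 1 f) + sobNormSq b k (weakDeriv b Complex.I f)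

/-- The norm `‖f‖_k` of `H^k`. -/
def sobNorm (b : Module.Basis (Fin 2) ℝ ℂ) (k : ℕ) (f : ℂ → R3) : ℝ := Real.sqrt (sobNormSq b k f)

/-! ### Holomorphic maps to the sphere -/

/-- The space `M_n` of degree `n` holomorphic maps from the torus to `S²`. The complex structure of `S²`
at `p` is `V ↦ p × V` on the tangent plane, so the Cauchy-Riemann equation is `φ_y = φ × φ_x`, and the
degree is the integral of the pull-back of the area form divided by `4π`. -/
def moduliSpace (b : Module.Basis (Fin 2) ℝ ℂ) (n : ℕ) : Set (ℂ → R3) :=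
  {φ | Periodic b φ ∧ ContDiff ℝ (⊤ : ℕ∞) φ ∧ (∀ z, ‖φ z‖ = 1) ∧
    (∀ z, dy φ z = cross (φ z) (dx φ z)) ∧
    (1 / (4 * Real.pi)) * ∫ z, inner ℝ (φ z) (cross (dx φ z) (dy φ z)) ∂(area b) = (n : ℝ)}

/-- The Jacobi operator
`J_φ V = -V_xx - V_yy - (|φ_x|² + |φ_y|²) V - 2 (φ_x · V_x + φ_y · V_y) φ`. -/
def jacobi (φ V : ℂ → R3) (z : ℂ) : R3 :=
  -dx (dx V) z - dy (dy V) z - (‖dx φ z‖ ^ 2 + ‖dy φ z‖ ^ 2) • V z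
    - (2 * (inner ℝ (dx φ z) (dx V z) + inner ℝ (dy φ z) (dy V z))) • φ z

/-- The kernel of `J_φ` on smooth tangent sections, that is, on smooth sections of `φ⁻¹TS²`. -/
def kerJacobi (b : Module.Basis (Fin 2) ℝ ℂ) (φ : ℂ → R3) : Set (ℂ → R3) :=
  {V | Periodic b V ∧ ContDiff ℝ (⊤ : ℕ∞) V ∧ (∀ z, inner ℝ (φ z) (V z) = 0) ∧
    ∀ z, jacobi φ V z = 0}

/-- The coordinate derivative `ψ_μ = ∂ψ/∂q^μ` at `q`, a function on the torus. -/
def paramDeriv {m : ℕ} (ψ : EuclideanSpace ℝ (Fin m) → ℂ → R3) (q : EuclideanSpace ℝ (Fin m))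
    (μ : Fin m) (z : ℂ) : R3 :=
  fderiv ℝ (fun p => ψ p z) q (EuclideanSpace.single μ (1 : ℝ))

/-- A smooth local parametrization `ψ : U × Σ → S²` of `M_n`, with `U ⊂ ℝ^{4n}` open: each `ψ(q, ·)` lies
in `M_n` and the coordinate derivatives `ψ_μ(q, ·)` span the kernel of the Jacobi operator. -/
structure IsLocalParam (b : Module.Basis (Fin 2) ℝ ℂ) (n : ℕ)
    (U : Set (EuclideanSpace ℝ (Fin (4 * n)))) (ψ : EuclideanSpace ℝ (Fin (4 * n)) → ℂ → R3) :
    Prop where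
  isOpen : IsOpen U
  smooth : ContDiffOn ℝ (⊤ : ℕ∞)
    (fun p : EuclideanSpace ℝ (Fin (4 * n)) × ℂ => ψ p.1 p.2) (U ×ˢ Set.univ)
  mem_moduliSpace : ∀ q ∈ U, ψ q ∈ moduliSpace b n
  span_eq : ∀ q ∈ U,
    (Submodule.span ℝ (Set.range (paramDeriv ψ q)) : Set (ℂ → R3)) = kerJacobi b (ψ q)

/-! ### The quadratic form and the constraints -/

/-- The quadratic form `Q₁` on `H¹`, for a fixed map `φ`:
`∫ |Y_x|² + |Y_y|² - (|φ_x|² + |φ_y|²) |Y|² - 4 (φ_x · Y_x + φ_y · Y_y) (φ · Y)`. -/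
def Q1 (b : Module.Basis (Fin 2) ℝ ℂ) (φ Y : ℂ → R3) : ℝ :=
  ∫ z, (‖weakDeriv b 1 Y z‖ ^ 2 + ‖weakDeriv b Complex.I Y z‖ ^ 2
    - (‖dx φ z‖ ^ 2 + ‖dy φ z‖ ^ 2) * ‖Y z‖ ^ 2
    - 4 * (inner ℝ (dx φ z) (weakDeriv b 1 Y z) + inner ℝ (dy φ z) (weakDeriv b Complex.I Y z))
      * inner ℝ (φ z) (Y z)) ∂(area b)

/-- The pointwise constraint `φ · Y = -(1/2) ε² |Y|²` (for almost every point, `Y` being an element of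
a Sobolev space). -/
def PointwiseConstraint (b : Module.Basis (Fin 2) ℝ ℂ) (ε : ℝ) (φ Y : ℂ → R3) : Prop :=
  ∀ᵐ z ∂(area b), inner ℝ (φ z) (Y z) = -(1 / 2) * ε ^ 2 * ‖Y z‖ ^ 2

/-- `Y` is `L²` orthogonal to the kernel of `J_φ`. -/
def OrthKerJacobi (b : Module.Basis (Fin 2) ℝ ℂ) (φ Y : ℂ → R3) : Prop :=
  ∀ V ∈ kerJacobi b φ, ∫ z, inner ℝ (Y z) (V z) ∂(area b) = 0

end

end TorusLump

/-!
On tangent fields `Q₁` is the quadratic form of the Jacobi operator, but it is negative on some fields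
with a large normal component, such as `φ` itself. Write `N = φ · Y` and `e = |φ_x|² + |φ_y|²`.
The proof compares `Q₁` with the form `F(Y) = Q₁(Y) + ∫ (4 e + 1) N²`, whose integrand is `formDensity`.

*Positivity.* Since `φ` is holomorphic, the integrand of `F` is a sum of squares, among them `N²` and
the square of the linearised Cauchy-Riemann operator applied to `Y`, plus two divergences
(`formDensity_eq`). Hence `F(Y) ≥ ∫ N² ≥ 0` (`HasWeakGradient.integral_inner_sq_le`). The divergences
integrate to zero for fields with enough weak derivatives, by Parseval's identity for Fourier series on
the torus.

*Kernel.* The form therefore satisfies the Cauchy-Schwarz inequality, so that a limit of fields on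
which `F` tends to zero is a weak solution of a linear elliptic system, with vanishing normal component.
Such a solution is smooth, by the decay of its Fourier coefficients (`exists_smooth_of_weak_laplace`),
and it is a Jacobi field (`exists_kerJacobi_of_weak`).

*Coercivity.* If `F(Y) ≥ c ‖Y‖₁²` failed for every `c > 0` on fields orthogonal to the Jacobi fields,
for parameters close to `q₀`, then there would be fields of unit `H¹` norm, orthogonal to the Jacobi
fields for parameters `q_m → q₀`, on which the forms tend to zero. By Rellich's theorem they converge in
`L²` to a Jacobi field of `ψ(q₀)`, which is orthogonal to all `∂ψ/∂q^μ`, so is zero, and this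
contradicts Gårding's inequality (`exists_local_coercive`). Since the parameter
varies along the sequence, the constant is uniform near `q₀`.

*The constraint.* If `N = -ε² |Y|² / 2`, then `N² ≤ ε² |Y|² sup |Y| / 2`, as `|N| ≤ |Y|`. With the
embedding of `H²` in the bounded functions this bounds the correction `∫ (4 e + 1) N²` by a multiple of
`ε² ‖Y‖₁ ‖Y‖₂²` (`integral_weighted_inner_sq_le`).

The pairs of admissible constants form a convex set for each `q`, so that a partition of unity turns the
locally uniform constants into continuous functions of `q`.
-/

namespace TorusLump

noncomputable section

open MeasureTheory Filter Topology

/-! ### Fourier series on the torus -/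

section FourierAnalysis

variable (b : Module.Basis (Fin 2) ℝ ℂ)

instance : IsFiniteMeasure (area b) :=
  ⟨by
    rw [area, Measure.restrict_apply_univ]
    exact (ZSpan.fundamentalDomain_isBounded b).measure_lt_top⟩

theorem area_univ_ne_zero : area b Set.univ ≠ 0 := by
  rw [area, Measure.restrict_apply_univ]
  exact ZSpan.measure_fundamentalDomain_ne_zero b

/-- The phase `2π ∑ⱼ kⱼ xⱼ` of the `k`-th character, where `xⱼ` are the coordinates in the
basis `b` of the lattice. -/
def phase (k : Fin 2 → ℤ) : ℂ →L[ℝ] ℝ :=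
  (∑ j, (2 * Real.pi * (k j : ℝ)) • b.coord j : ℂ →ₗ[ℝ] ℝ).toContinuousLinearMap

theorem phase_apply (k : Fin 2 → ℤ) (z : ℂ) :
    phase b k z = ∑ j, 2 * Real.pi * (k j : ℝ) * b.repr z j := by
  simp [phase, Module.Basis.coord_apply]

/-- The `k`-th character of the torus. -/
def chr (k : Fin 2 → ℤ) (z : ℂ) : ℂ := Complex.exp (phase b k z * Complex.I)

/-- The `k`-th Fourier coefficient, not normalised by the area. -/
def fcoeff (k : Fin 2 → ℤ) (f : ℂ → ℂ) : ℂ := ∫ z, chr b (-k) z * f z ∂(area b)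

/-- The projection of the plane to the standard torus. -/
def toTorus (z : ℂ) : UnitAddTorus (Fin 2) := fun i => (b.repr z i : UnitAddCircle)

/-- The section of `toTorus` with values in the fundamental parallelogram. -/
def ofTorus (t : UnitAddTorus (Fin 2)) : ℂ :=
  ∑ i, (AddCircle.measurableEquivIco 1 0 (t i) : ℝ) • b i

-- Mathlib's Fourier theory on `UnitAddTorus` is stated for this normalisation of the measure.
local instance : MeasureSpace UnitAddCircle := ⟨AddCircle.haarAddCircle⟩

local instance : IsProbabilityMeasure (volume : Measure UnitAddCircle) :=
  inferInstanceAs (IsProbabilityMeasure AddCircle.haarAddCircle)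

theorem measurable_ofTorus : Measurable (ofTorus b) := by
  unfold ofTorus
  refine Finset.measurable_sum _ fun i _ => ?_
  refine Measurable.smul_const ?_ _
  exact measurable_subtype_coe.comp
    ((AddCircle.measurableEquivIco 1 0).measurable.comp (measurable_pi_apply i))

theorem ofTorus_toTorus {z : ℂ} (hz : z ∈ ZSpan.fundamentalDomain b) :
    ofTorus b (toTorus b z) = z := by
  unfold ofTorus toTorus
  conv_rhs => rw [← b.sum_repr z]
  refine Finset.sum_congr rfl fun i _ => ?_
  congr 1
  change ((AddCircle.equivIco (1 : ℝ) 0 ((b.repr z i : ℝ) : AddCircle (1 : ℝ))) : ℝ) = _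
  have h := (ZSpan.mem_fundamentalDomain b).1 hz i
  rw [AddCircle.equivIco_coe_eq]
  simpa using h

theorem mFourier_toTorus (k : Fin 2 → ℤ) (z : ℂ) :
    UnitAddTorus.mFourier k (toTorus b z) = chr b k z := by
  simp only [UnitAddTorus.mFourier, ContinuousMap.coe_mk, toTorus, chr, phase_apply]
  simp_rw [fourier_coe_apply]
  rw [← Complex.exp_sum]
  congr 1
  push_cast
  rw [Finset.sum_mul]
  refine Finset.sum_congr rfl fun i _ => ?_
  ring

/-- The projection to the standard torus preserves the measure up to a constant. -/
theorem exists_measurePreserving_toTorus : ∃ κ : NNReal, κ ≠ 0 ∧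
    MeasurePreserving (toTorus b) (κ • area b) (volume : Measure (UnitAddTorus (Fin 2))) := by
  set L : (Fin 2 → ℝ) ≃L[ℝ] ℂ := b.equivFun.symm.toContinuousLinearEquiv
  set box : Set (Fin 2 → ℝ) := Set.univ.pi fun _ => Set.Ico (0 : ℝ) 1 with hbox
  have hq : MeasurePreserving (fun (x : Fin 2 → ℝ) i => (x i : UnitAddCircle))
      (volume.restrict box) (volume : Measure (UnitAddTorus (Fin 2))) := by
    have h1 : ∀ _ : Fin 2, MeasurePreserving (QuotientAddGroup.mk : ℝ → UnitAddCircle)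
        (volume.restrict (Set.Ico (0 : ℝ) 1)) (AddCircle.haarAddCircle) := by
      intro i
      have := UnitAddCircle.measurePreserving_mk 0
      rw [zero_add, ← Measure.restrict_congr_set Ico_ae_eq_Ioc] at this
      convert! this
      rw [AddCircle.volume_eq_smul_haarAddCircle]
      simp
    have h2 := measurePreserving_pi _ _ h1
    convert! h2 using 1
    rw [hbox, volume_pi, Measure.restrict_pi_pi]
  have hvol := Measure.isAddLeftInvariant_eq_smul
    ((volume : Measure (Fin 2 → ℝ)).map L) (volume : Measure ℂ)
  set κ := ((volume : Measure (Fin 2 → ℝ)).map L).addHaarScalarFactor (volume : Measure ℂ)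
  have hrepr : ∀ x i, b.repr (L x) i = x i := fun x i =>
    congrFun (b.equivFun.apply_symm_apply x) i
  have hLpre : L ⁻¹' (ZSpan.fundamentalDomain b) = box := by
    ext x
    simp [hbox, ZSpan.mem_fundamentalDomain, hrepr]
  have hmap : (volume.restrict box).map L = κ • area b := by
    rw [area, ← Measure.restrict_smul, ← hvol,
      Measure.restrict_map L.continuous.measurable (ZSpan.fundamentalDomain_measurableSet b), hLpre]
  have hcomp : toTorus b ∘ L = fun (x : Fin 2 → ℝ) i => (x i : UnitAddCircle) := by
    funext x
    funext i
    simp [toTorus, hrepr]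
  have hmeas : Measurable (toTorus b) := by
    refine measurable_pi_lambda _ fun i => ?_
    refine AddCircle.measurable_mk'.comp ?_
    exact (b.coord i).toContinuousLinearMap.continuous.measurable
  refine ⟨κ, ?_, hmeas, ?_⟩
  · intro h0
    have h3 := hq.map_eq
    rw [← hcomp, ← Measure.map_map hmeas L.continuous.measurable, hmap, h0] at h3
    have := congrArg (fun m => m Set.univ) h3
    simp at this
  · rw [← hmap, Measure.map_map hmeas L.continuous.measurable, hcomp, hq.map_eq]

/-- Parseval's identity. The constant `K` only depends on the area of the torus. -/
theorem parseval_exists : ∃ K : ℝ, 0 < K ∧ ∀ f : ℂ → ℂ, MemLp f 2 (area b) →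
    HasSum (fun k => ‖fcoeff b k f‖ ^ 2) (K * ∫ z, ‖f z‖ ^ 2 ∂(area b)) := by
  obtain ⟨κ, hκ, hπ⟩ := exists_measurePreserving_toTorus b
  have hκ' : (0 : ℝ) < κ := by positivity
  have hid : ∀ᵐ z ∂(κ • area b), ofTorus b (toTorus b z) = z := by
    refine Measure.ae_smul_measure ?_ _
    filter_upwards [ae_restrict_mem (ZSpan.fundamentalDomain_measurableSet b)] with z hz
    exact ofTorus_toTorus b hz
  have hS : MeasurePreserving (ofTorus b) (volume : Measure (UnitAddTorus (Fin 2)))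
      (κ • area b) := by
    refine ⟨measurable_ofTorus b, ?_⟩
    rw [← hπ.map_eq, Measure.map_map (measurable_ofTorus b) hπ.measurable]
    conv_rhs => rw [← Measure.map_id (μ := κ • area b)]
    exact Measure.map_congr hid
  refine ⟨(κ : ℝ)⁻¹, inv_pos.2 hκ', fun f hf => ?_⟩
  have hfκ : MemLp f 2 (κ • area b) := hf.smul_measure (by simp)
  have hg : MemLp (f ∘ ofTorus b) 2 (volume : Measure (UnitAddTorus (Fin 2))) :=
    hfκ.comp_measurePreserving hS
  have key : ∀ h : UnitAddTorus (Fin 2) → ℂ, AEStronglyMeasurable h volume →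
      ∫ t, h t = κ * ∫ z, h (toTorus b z) ∂(area b) := by
    intro h hh
    rw [← hπ.map_eq, integral_map hπ.measurable.aemeasurable (by rwa [hπ.map_eq]),
      integral_smul_nnreal_measure]
    simp [NNReal.smul_def]
  have hid' : ∀ᵐ z ∂(area b), ofTorus b (toTorus b z) = z := by
    filter_upwards [ae_restrict_mem (ZSpan.fundamentalDomain_measurableSet b)] with z hz
    exact ofTorus_toTorus b hz
  have h1 := UnitAddTorus.hasSum_sq_mFourierCoeff hg.toLp
  have hcoef : ∀ k, UnitAddTorus.mFourierCoeff (hg.toLp) k = κ * fcoeff b k f := by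
    intro k
    rw [UnitAddTorus.mFourierCoeff, fcoeff]
    have : ∫ t, UnitAddTorus.mFourier (-k) t • (hg.toLp) t
        = ∫ t, UnitAddTorus.mFourier (-k) t • (f ∘ ofTorus b) t := by
      refine integral_congr_ae ?_
      filter_upwards [hg.coeFn_toLp] with t ht
      rw [ht]
    rw [this, key]
    · congr 1
      refine integral_congr_ae ?_
      filter_upwards [hid'] with z hz
      simp [mFourier_toTorus, hz]
    · exact (UnitAddTorus.mFourier (-k)).continuous.aestronglyMeasurable.smul hg.1
  have hnorm : ∫ t, ‖(hg.toLp) t‖ ^ 2 = κ * ∫ z, ‖f z‖ ^ 2 ∂(area b) := by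
    have e1 : ∫ t, ‖(hg.toLp) t‖ ^ 2 = ∫ t, ‖(f ∘ ofTorus b) t‖ ^ 2 := by
      refine integral_congr_ae ?_
      filter_upwards [hg.coeFn_toLp] with t ht
      rw [ht]
    have e2 := key (fun t => ((‖(f ∘ ofTorus b) t‖ ^ 2 : ℝ) : ℂ))
      (Complex.continuous_ofReal.comp_aestronglyMeasurable (hg.1.norm.pow 2))
    rw [integral_complex_ofReal] at e2
    rw [e1]
    have e3 : ∫ z, ((‖(f ∘ ofTorus b) (toTorus b z)‖ ^ 2 : ℝ) : ℂ) ∂(area b)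
        = ((∫ z, ‖f z‖ ^ 2 ∂(area b) : ℝ) : ℂ) := by
      rw [← integral_complex_ofReal]
      refine integral_congr_ae ?_
      filter_upwards [hid'] with z hz
      simp [hz]
    rw [e3] at e2
    exact_mod_cast e2
  rw [hnorm] at h1
  have h2 := h1.mul_left ((κ : ℝ)⁻¹ ^ 2)
  convert! h2 using 1
  · funext k
    rw [hcoef, norm_mul, mul_pow]
    simp only [Complex.norm_real, Real.norm_eq_abs, NNReal.abs_eq]
    field_simp
  · field_simp

end FourierAnalysis

/-! ### Smooth functions on the torus -/

section SmoothPeriodic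

variable {b : Module.Basis (Fin 2) ℝ ℂ} {E F : Type*}

theorem Periodic.add_lattice {f : ℂ → E} (hf : Periodic b f) {g : ℂ}
    (hg : g ∈ Submodule.span ℤ (Set.range b)) : ∀ z, f (g + z) = f z := by
  induction hg using Submodule.span_induction with
  | mem x hx =>
    obtain ⟨i, rfl⟩ := hx
    intro z
    rw [add_comm, hf i z]
  | zero => simp
  | add x y _ _ hx hy =>
    intro z
    rw [add_assoc, hx, hy]
  | smul a x _ hx =>
    have hn : ∀ (n : ℕ) (z : ℂ), f (n • x + z) = f z := by
      intro n
      induction n with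
      | zero => simp
      | succ n ih =>
        intro z
        rw [succ_nsmul, add_assoc, ih, hx]
    intro z
    obtain ⟨n, rfl | rfl⟩ := Int.eq_nat_or_neg a
    · simpa using hn n z
    · have := hn n (-(n • x) + z)
      rw [add_neg_cancel_left] at this
      rw [this, neg_smul, natCast_zsmul]

theorem Periodic.apply_fract {f : ℂ → E} (hf : Periodic b f) (z : ℂ) :
    f (ZSpan.fract b z) = f z := by
  rw [ZSpan.fract_apply, sub_eq_neg_add]
  exact hf.add_lattice (neg_mem (ZSpan.floor b z).2) z

instance : Countable (Submodule.span ℤ (Set.range b)).toAddSubgroup :=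
  inferInstanceAs (Countable (Submodule.span ℤ (Set.range b)))

variable (b) in
/-- A compact set containing a fundamental parallelogram. -/
def cell : Set ℂ := closure (ZSpan.fundamentalDomain b)

variable (b) in
theorem isCompact_cell : IsCompact (cell b) :=
  (ZSpan.fundamentalDomain_isBounded b).isCompact_closure

theorem Periodic.forall_of_cell {f : ℂ → E} (hf : Periodic b f) {P : E → Prop}
    (h : ∀ z ∈ cell b, P (f z)) (z : ℂ) : P (f z) := by
  rw [← hf.apply_fract z]
  exact h _ (subset_closure (ZSpan.fract_mem_fundamentalDomain b z))

/-- A periodic property which holds almost everywhere on the torus holds almost everywhere on the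
plane. -/
theorem Periodic.ae_volume {p : ℂ → Prop} (hp : Periodic b p) (h : ∀ᵐ z ∂(area b), p z) :
    ∀ᵐ z, p z := by
  refine (ZSpan.isAddFundamentalDomain' b (volume : Measure ℂ)).measure_zero_of_invariant
    {z | ¬ p z} ?_ ?_
  · intro g
    ext z
    have := hp.add_lattice (neg_mem g.2) z
    simp only [Set.mem_vadd_set_iff_neg_vadd_mem, Set.mem_ofPred_eq, AddSubgroup.vadd_def, vadd_eq_add,
      NegMemClass.coe_neg]
    rw [this]
  · rw [area, ae_iff, Measure.restrict_apply₀'] at h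
    · exact h
    · exact (ZSpan.fundamentalDomain_measurableSet b).nullMeasurableSet

theorem Periodic.eq_of_ae [TopologicalSpace E] [T2Space E] {f g : ℂ → E} (hf : Periodic b f)
    (hg : Periodic b g) (hfc : Continuous f) (hgc : Continuous g)
    (h : ∀ᵐ z ∂(area b), f z = g z) (z : ℂ) : f z = g z := by
  have h1 : ∀ᵐ z, f z = g z := by
    refine Periodic.ae_volume (b := b) (fun i z => ?_) h
    rw [hf i z, hg i z]
  exact congrFun (Measure.eq_of_ae_eq h1 hfc hgc) z

theorem Periodic.exists_bound [NormedAddCommGroup E] {f : ℂ → E} (hf : Periodic b f) (hc : Continuous f) :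
    ∃ C, 0 ≤ C ∧ ∀ z, ‖f z‖ ≤ C := by
  obtain ⟨C, hC⟩ := (isCompact_cell b).exists_bound_of_continuousOn hc.continuousOn
  refine ⟨max C 0, le_max_right _ _, fun z => ?_⟩
  exact hf.forall_of_cell (P := fun x => ‖x‖ ≤ max C 0) (fun z hz => (hC z hz).trans
    (le_max_left _ _)) z

variable [NormedAddCommGroup E] [NormedSpace ℝ E] [NormedAddCommGroup F] [NormedSpace ℝ F]

/-- Smooth functions on the torus. -/
structure SmoothPeriodic (b : Module.Basis (Fin 2) ℝ ℂ) (f : ℂ → E) : Prop where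
  periodic : Periodic b f
  contDiff : ContDiff ℝ (⊤ : ℕ∞) f

namespace SmoothPeriodic

variable {f : ℂ → E}

theorem continuous (hf : SmoothPeriodic b f) : Continuous f := hf.contDiff.continuous

theorem differentiable (hf : SmoothPeriodic b f) : Differentiable ℝ f :=
  hf.contDiff.differentiable (by simp)

theorem const (c : E) : SmoothPeriodic b (fun _ => c) := ⟨fun _ _ => rfl, contDiff_const⟩

theorem add {g : ℂ → E} (hf : SmoothPeriodic b f) (hg : SmoothPeriodic b g) :
    SmoothPeriodic b (fun z => f z + g z) :=
  ⟨fun i z => by rw [hf.periodic i z, hg.periodic i z], hf.contDiff.add hg.contDiff⟩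

theorem neg (hf : SmoothPeriodic b f) : SmoothPeriodic b (fun z => -f z) :=
  ⟨fun i z => by rw [hf.periodic i z], hf.contDiff.neg⟩

theorem sub {g : ℂ → E} (hf : SmoothPeriodic b f) (hg : SmoothPeriodic b g) :
    SmoothPeriodic b (fun z => f z - g z) :=
  ⟨fun i z => by rw [hf.periodic i z, hg.periodic i z], hf.contDiff.sub hg.contDiff⟩

theorem sum {ι : Type*} {s : Finset ι} {f : ι → ℂ → E} (hf : ∀ i ∈ s, SmoothPeriodic b (f i)) :
    SmoothPeriodic b (fun z => ∑ i ∈ s, f i z) :=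
  ⟨fun i z => Finset.sum_congr rfl fun j hj => (hf j hj).periodic i z,
    ContDiff.sum fun j hj => (hf j hj).contDiff⟩

theorem smul {a : ℂ → ℝ} (ha : SmoothPeriodic b a) (hf : SmoothPeriodic b f) :
    SmoothPeriodic b (fun z => a z • f z) :=
  ⟨fun i z => by rw [hf.periodic i z, ha.periodic i z], ha.contDiff.smul hf.contDiff⟩

theorem mul {A : Type*} [NormedRing A] [NormedAlgebra ℝ A] {a c : ℂ → A}
    (ha : SmoothPeriodic b a) (hc : SmoothPeriodic b c) :
    SmoothPeriodic b (fun z => a z * c z) :=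
  ⟨fun i z => by rw [hc.periodic i z, ha.periodic i z], ha.contDiff.mul hc.contDiff⟩

theorem pow {a : ℂ → ℝ} (ha : SmoothPeriodic b a) (n : ℕ) :
    SmoothPeriodic b (fun z => a z ^ n) :=
  ⟨fun i z => by rw [ha.periodic i z], ha.contDiff.pow n⟩

theorem clm_comp (hf : SmoothPeriodic b f) (L : E →L[ℝ] F) : SmoothPeriodic b (fun z => L (f z)) :=
  ⟨fun i z => by rw [hf.periodic i z], L.contDiff.comp hf.contDiff⟩

theorem fderiv (hf : SmoothPeriodic b f) (v : ℂ) :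
    SmoothPeriodic b (fun z => fderiv ℝ f z v) := by
  refine ⟨fun i z => ?_, (hf.contDiff.fderiv_right (m := (⊤ : ℕ∞)) (by simp)).clm_apply
    contDiff_const⟩
  have h : f = fun x => f (x + b i) := funext fun x => (hf.periodic i x).symm
  conv_rhs => rw [h]
  rw [fderiv_comp_add_right]

theorem exists_bound (hf : SmoothPeriodic b f) : ∃ C, 0 ≤ C ∧ ∀ z, ‖f z‖ ≤ C :=
  hf.periodic.exists_bound hf.continuous

theorem memLp (hf : SmoothPeriodic b f) (p : ENNReal) : MemLp f p (area b) := by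
  obtain ⟨C, _, hC⟩ := hf.exists_bound
  exact MemLp.of_bound (hf.continuous.aestronglyMeasurable) C (Eventually.of_forall hC)

theorem integrable (hf : SmoothPeriodic b f) : Integrable f (area b) :=
  memLp_one_iff_integrable.1 (hf.memLp 1)

theorem mul_memLp {A : Type*} [NormedRing A] [NormedAlgebra ℝ A] {a u : ℂ → A}
    (ha : SmoothPeriodic b a) (hu : MemLp u 2 (area b)) :
    MemLp (fun z => a z * u z) 2 (area b) :=
  MemLp.mul (p := ⊤) (q := 2) hu (ha.memLp ⊤)

end SmoothPeriodic

open Pointwise in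
/-- The integral over the torus is invariant under translations. -/
theorem Periodic.integral_add_right {f : ℂ → E} (hf : Periodic b f) (w : ℂ) :
    ∫ z, f (z + w) ∂(area b) = ∫ z, f z ∂(area b) := by
  have h1 := (ZSpan.isAddFundamentalDomain' b (volume : Measure ℂ)).vadd_of_comm w
  have h2 := (measurePreserving_add_right (volume : Measure ℂ) w).setIntegral_preimage_emb
    (measurableEmbedding_addRight w) f (w +ᵥ ZSpan.fundamentalDomain b)
  have h3 : (fun z => z + w) ⁻¹' (w +ᵥ ZSpan.fundamentalDomain b) = ZSpan.fundamentalDomain b := by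
    ext z
    simp [Set.mem_vadd_set_iff_neg_vadd_mem, add_comm]
  rw [h3] at h2
  rw [area, h2]
  refine (h1.setIntegral_eq (ZSpan.isAddFundamentalDomain' b (volume : Measure ℂ)) ?_)
  intro g z
  exact hf.add_lattice g.2 z

/-- The integral over the torus of a derivative vanishes. -/
theorem SmoothPeriodic.integral_fderiv {f : ℂ → E} (hf : SmoothPeriodic b f) (v : ℂ) :
    ∫ z, _root_.fderiv ℝ f z v ∂(area b) = 0 := by
  obtain ⟨C, hC0, hC⟩ := (hf.fderiv v).exists_bound
  have h := hasDerivAt_integral_of_dominated_loc_of_deriv_le (μ := area b) (𝕜 := ℝ)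
    (F := fun t z => f (z + (t : ℝ) • v)) (F' := fun t z => _root_.fderiv ℝ f (z + (t : ℝ) • v) v)
    (x₀ := 0) (s := Set.univ) (bound := fun _ => C) univ_mem
    (Eventually.of_forall fun t =>
      (hf.continuous.comp (continuous_id.add continuous_const)).aestronglyMeasurable)
    (by simpa using hf.integrable)
    (by simpa using (hf.fderiv v).continuous.aestronglyMeasurable)
    (Eventually.of_forall fun z t _ => hC _) (integrable_const C)
    (Eventually.of_forall fun z t _ => by
      have h1 := (hf.differentiable (z + t • v)).hasFDerivAt
      have h2 : HasDerivAt (fun t : ℝ => z + t • v) v t := by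
        simpa using ((hasDerivAt_id t).smul_const v).const_add z
      exact h1.comp_hasDerivAt t h2)
  have h2 : (fun t : ℝ => ∫ z, f (z + t • v) ∂(area b)) = fun _ => ∫ z, f z ∂(area b) :=
    funext fun t => hf.periodic.integral_add_right _
  have h3 := h.2
  rw [h2] at h3
  simpa using h3.unique (hasDerivAt_const _ _)

end SmoothPeriodic

section Characters

variable (b : Module.Basis (Fin 2) ℝ ℂ)

theorem phase_basis (k : Fin 2 → ℤ) (i : Fin 2) : phase b k (b i) = 2 * Real.pi * k i := by
  rw [phase_apply, Finset.sum_eq_single i]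
  · simp
  · intro j _ hj
    simp [Finsupp.single_eq_of_ne hj]
  · simp

theorem chr_add (k l : Fin 2 → ℤ) (z : ℂ) : chr b (k + l) z = chr b k z * chr b l z := by
  simp only [chr, phase_apply]
  rw [← Complex.exp_add]
  congr 1
  push_cast
  rw [← add_mul, ← Finset.sum_add_distrib]
  congr 1
  refine Finset.sum_congr rfl fun j _ => ?_
  simp only [Pi.add_apply]
  push_cast
  ring

theorem norm_chr (k : Fin 2 → ℤ) (z : ℂ) : ‖chr b k z‖ = 1 :=
  Complex.norm_exp_ofReal_mul_I _

theorem hasFDerivAt_chr (k : Fin 2 → ℤ) (z : ℂ) :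
    HasFDerivAt (chr b k) ((phase b k).smulRight (Complex.I * chr b k z)) z := by
  have h1 : HasFDerivAt (fun z => (phase b k z : ℂ) * Complex.I)
      ((phase b k).smulRight Complex.I) z := by
    have := ((Complex.ofRealCLM.comp (phase b k)).hasFDerivAt (x := z)).mul_const Complex.I
    convert! this using 1
    ext w
    simp [mul_comm]
  have h2 := h1.cexp
  convert! h2 using 1
  ext w
  simp [chr]
  ring

theorem fderiv_chr (k : Fin 2 → ℤ) (z v : ℂ) :
    fderiv ℝ (chr b k) z v = Complex.I * phase b k v * chr b k z := by
  rw [(hasFDerivAt_chr b k z).fderiv]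
  simp
  ring

theorem smoothPeriodic_chr (k : Fin 2 → ℤ) : SmoothPeriodic b (chr b k) := by
  constructor
  · intro i z
    rw [chr, chr, map_add, phase_basis, Complex.exp_eq_exp_iff_exists_int]
    refine ⟨k i, ?_⟩
    push_cast
    ring
  · unfold chr
    exact Complex.contDiff_exp.comp
      ((Complex.ofRealCLM.contDiff.comp (phase b k).contDiff).mul contDiff_const)

end Characters

/-! ### Weak derivatives -/

section WeakDerivatives

variable {b : Module.Basis (Fin 2) ℝ ℂ} {v : ℂ}

/-- `g` is the weak derivative in the direction `v` of the scalar function `f` on the torus. -/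
structure HasWeakDeriv (b : Module.Basis (Fin 2) ℝ ℂ) (v : ℂ) (f g : ℂ → ℝ) : Prop where
  memLp : MemLp f 2 (area b)
  memLp_deriv : MemLp g 2 (area b)
  integral_eq : ∀ η : ℂ → ℝ, SmoothPeriodic b η →
    ∫ z, fderiv ℝ η z v * f z ∂(area b) = -∫ z, η z * g z ∂(area b)

/-- `f` is integrable on the torus with vanishing integral. -/
structure IntegralZero (b : Module.Basis (Fin 2) ℝ ℂ) (f : ℂ → ℝ) : Prop where
  integrable : Integrable f (area b)
  integral_eq : ∫ z, f z ∂(area b) = 0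

namespace IntegralZero

variable {f g : ℂ → ℝ}

theorem add (hf : IntegralZero b f) (hg : IntegralZero b g) :
    IntegralZero b (fun z => f z + g z) :=
  ⟨hf.1.add hg.1, by rw [integral_add hf.1 hg.1, hf.2, hg.2, add_zero]⟩

theorem sub (hf : IntegralZero b f) (hg : IntegralZero b g) :
    IntegralZero b (fun z => f z - g z) :=
  ⟨hf.1.sub hg.1, by rw [integral_sub hf.1 hg.1, hf.2, hg.2, sub_zero]⟩

theorem const_mul (c : ℝ) (hf : IntegralZero b f) : IntegralZero b (fun z => c * f z) :=
  ⟨hf.1.const_mul c, by rw [integral_const_mul, hf.2, mul_zero]⟩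

theorem sum {ι : Type*} {s : Finset ι} {f : ι → ℂ → ℝ} (hf : ∀ i ∈ s, IntegralZero b (f i)) :
    IntegralZero b (fun z => ∑ i ∈ s, f i z) :=
  ⟨integrable_finsetSum _ fun i hi => (hf i hi).1, by
    rw [integral_finsetSum _ fun i hi => (hf i hi).1]
    exact Finset.sum_eq_zero fun i hi => (hf i hi).2⟩

theorem congr (hf : IntegralZero b f) (h : f =ᵐ[area b] g) : IntegralZero b g :=
  ⟨hf.1.congr h, by rw [← integral_congr_ae h, hf.2]⟩

end IntegralZero

theorem memLp_mul_integrable {f g : ℂ → ℝ} (hf : MemLp f 2 (area b)) (hg : MemLp g 2 (area b)) :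
    Integrable (fun z => f z * g z) (area b) :=
  MemLp.integrable_mul (p := 2) (q := 2) hf hg

theorem memLp_ofReal {f : ℂ → ℝ} (hf : MemLp f 2 (area b)) :
    MemLp (fun z => (f z : ℂ)) 2 (area b) :=
  hf.ofReal

namespace HasWeakDeriv

variable {f g f' g' : ℂ → ℝ}

theorem add (hf : HasWeakDeriv b v f f') (hg : HasWeakDeriv b v g g') :
    HasWeakDeriv b v (fun z => f z + g z) (fun z => f' z + g' z) := by
  refine ⟨hf.1.add hg.1, hf.2.add hg.2, fun η hη => ?_⟩
  simp only [mul_add]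
  rw [integral_add, integral_add, hf.3 η hη, hg.3 η hη]
  · ring
  · exact memLp_mul_integrable (hη.memLp 2) hf.2
  · exact memLp_mul_integrable (hη.memLp 2) hg.2
  · exact memLp_mul_integrable ((hη.fderiv v).memLp 2) hf.1
  · exact memLp_mul_integrable ((hη.fderiv v).memLp 2) hg.1

theorem const_mul (c : ℝ) (hf : HasWeakDeriv b v f f') :
    HasWeakDeriv b v (fun z => c * f z) (fun z => c * f' z) := by
  refine ⟨hf.1.const_mul c, hf.2.const_mul c, fun η hη => ?_⟩
  simp only [mul_left_comm _ c]
  rw [integral_const_mul, integral_const_mul, hf.3 η hη]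
  ring

theorem congr_deriv (hf : HasWeakDeriv b v f f') (h : f' =ᵐ[area b] g') :
    HasWeakDeriv b v f g' := by
  refine ⟨hf.1, hf.2.ae_eq h, fun η hη => ?_⟩
  rw [hf.3 η hη]
  congr 1
  refine integral_congr_ae ?_
  filter_upwards [h] with z hz
  rw [hz]

/-- A smooth function is weakly differentiable. -/
theorem of_smooth (hf : SmoothPeriodic b f) : HasWeakDeriv b v f (fun z => fderiv ℝ f z v) := by
  refine ⟨hf.memLp 2, (hf.fderiv v).memLp 2, fun η hη => ?_⟩
  rw [eq_neg_iff_add_eq_zero, ← integral_add]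
  · rw [← (hη.mul hf).integral_fderiv v]
    refine integral_congr_ae (Eventually.of_forall fun z => ?_)
    have := (hη.differentiable z).hasFDerivAt.mul (hf.differentiable z).hasFDerivAt
    beta_reduce
    rw [show (fun z => η z * f z) = η * f from rfl, this.fderiv]
    simp
    ring
  · exact memLp_mul_integrable ((hη.fderiv v).memLp 2) (hf.memLp 2)
  · exact memLp_mul_integrable (hη.memLp 2) ((hf.fderiv v).memLp 2)

/-- The product rule with a smooth factor. -/
theorem smooth_mul {a : ℂ → ℝ} (ha : SmoothPeriodic b a) (hf : HasWeakDeriv b v f f') :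
    HasWeakDeriv b v (fun z => a z * f z) (fun z => fderiv ℝ a z v * f z + a z * f' z) := by
  refine ⟨ha.mul_memLp hf.1, ((ha.fderiv v).mul_memLp hf.1).add (ha.mul_memLp hf.2),
    fun η hη => ?_⟩
  have h1 := hf.3 (fun z => η z * a z) (hη.mul ha)
  have h2 : ∀ z, fderiv ℝ (fun z => η z * a z) z v * f z
      = fderiv ℝ η z v * (a z * f z) + η z * (fderiv ℝ a z v * f z) := by
    intro z
    have := (hη.differentiable z).hasFDerivAt.mul (ha.differentiable z).hasFDerivAt
    rw [show (fun z => η z * a z) = η * a from rfl, this.fderiv]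
    simp
    ring
  have i1 := memLp_mul_integrable ((hη.fderiv v).memLp 2) (ha.mul_memLp hf.1)
  have i2 := memLp_mul_integrable (hη.memLp 2) ((ha.fderiv v).mul_memLp hf.1)
  have i3 := memLp_mul_integrable (hη.memLp 2) (ha.mul_memLp hf.2)
  simp only [h2] at h1
  rw [integral_add i1 i2] at h1
  simp only [mul_add]
  rw [integral_add i2 i3]
  simp only [← mul_assoc] at h1 ⊢
  linarith

/-- Weak derivatives may be tested against complex-valued functions. -/
theorem integral_eq_complex (hf : HasWeakDeriv b v f f') {η : ℂ → ℂ} (hη : SmoothPeriodic b η) :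
    ∫ z, fderiv ℝ η z v * (f z : ℂ) ∂(area b) = -∫ z, η z * (f' z : ℂ) ∂(area b) := by
  have i1 : Integrable (fun z => fderiv ℝ η z v * (f z : ℂ)) (area b) :=
    MemLp.integrable_mul (p := 2) (q := 2) ((hη.fderiv v).memLp 2) (memLp_ofReal hf.1)
  have i2 : Integrable (fun z => η z * (f' z : ℂ)) (area b) :=
    MemLp.integrable_mul (p := 2) (q := 2) (hη.memLp 2) (memLp_ofReal hf.2)
  have key : ∀ L : ℂ →L[ℝ] ℝ, (∀ (w : ℂ) (r : ℝ), L (w * r) = L w * r) →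
      L (∫ z, fderiv ℝ η z v * (f z : ℂ) ∂(area b))
        = L (-∫ z, η z * (f' z : ℂ) ∂(area b)) := by
    intro L hL
    rw [map_neg, ← L.integral_comp_comm i1, ← L.integral_comp_comm i2]
    simp only [hL]
    rw [← hf.3 _ (hη.clm_comp L)]
    refine integral_congr_ae (Eventually.of_forall fun z => ?_)
    beta_reduce
    have := L.hasFDerivAt.comp z (hη.differentiable z).hasFDerivAt
    rw [show (fun z => L (η z)) = L ∘ η from rfl, this.fderiv]
    simp
  apply Complex.ext
  · exact key Complex.reCLM (by simp)
  · exact key Complex.imCLM (by simp)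

/-- The Fourier coefficients of a weak derivative. -/
theorem fcoeff_eq (hf : HasWeakDeriv b v f f') (k : Fin 2 → ℤ) :
    fcoeff b k (fun z => (f' z : ℂ))
      = Complex.I * phase b k v * fcoeff b k (fun z => (f z : ℂ)) := by
  have h := hf.integral_eq_complex (smoothPeriodic_chr b (-k))
  simp only [fderiv_chr] at h
  have hneg : phase b (-k) v = -phase b k v := by simp [phase_apply]
  rw [fcoeff, fcoeff, ← neg_eq_iff_eq_neg.2 h, ← integral_const_mul, ← integral_neg]
  refine integral_congr_ae (Eventually.of_forall fun z => ?_)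
  beta_reduce
  rw [hneg]
  push_cast
  ring

end HasWeakDeriv

theorem integrable_chr_mul (k : Fin 2 → ℤ) {f : ℂ → ℂ} (hf : MemLp f 2 (area b)) :
    Integrable (fun z => chr b k z * f z) (area b) :=
  MemLp.integrable_mul (p := 2) (q := 2) ((smoothPeriodic_chr b k).memLp 2) hf

theorem fcoeff_add (k : Fin 2 → ℤ) {f g : ℂ → ℂ} (hf : MemLp f 2 (area b))
    (hg : MemLp g 2 (area b)) :
    fcoeff b k (fun z => f z + g z) = fcoeff b k f + fcoeff b k g := by
  simp only [fcoeff, mul_add]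
  exact integral_add (integrable_chr_mul _ hf) (integrable_chr_mul _ hg)

theorem fcoeff_sub (k : Fin 2 → ℤ) {f g : ℂ → ℂ} (hf : MemLp f 2 (area b))
    (hg : MemLp g 2 (area b)) :
    fcoeff b k (fun z => f z - g z) = fcoeff b k f - fcoeff b k g := by
  simp only [fcoeff, mul_sub]
  exact integral_sub (integrable_chr_mul _ hf) (integrable_chr_mul _ hg)

/-- Functions with the same Fourier coefficients agree almost everywhere. -/
theorem ae_eq_of_fcoeff_eq {f g : ℂ → ℂ} (hf : MemLp f 2 (area b)) (hg : MemLp g 2 (area b))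
    (h : ∀ k, fcoeff b k f = fcoeff b k g) : f =ᵐ[area b] g := by
  obtain ⟨K, hK, hP⟩ := parseval_exists b
  have h1 := hP _ (hf.sub hg)
  have h2 : ∀ k, fcoeff b k (f - g) = 0 := fun k => by
    rw [show f - g = fun z => f z - g z from rfl, fcoeff_sub k hf hg, h k, sub_self]
  simp only [h2] at h1
  have h0 : HasSum (fun _ : Fin 2 → ℤ => ‖(0 : ℂ)‖ ^ 2) 0 := by simp
  have h3 := h1.unique h0
  have h4 : ∫ z, ‖(f - g) z‖ ^ 2 ∂(area b) = 0 := by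
    rcases mul_eq_zero.1 h3 with h | h
    · exact absurd h hK.ne'
    · exact h
  rw [integral_eq_zero_iff_of_nonneg (fun z => by positivity)] at h4
  · filter_upwards [h4] with z hz
    simpa [sub_eq_zero] using hz
  · exact (hf.sub hg).integrable_norm_pow (by simp)

theorem ae_eq_of_fcoeff_ofReal_eq {f g : ℂ → ℝ} (hf : MemLp f 2 (area b))
    (hg : MemLp g 2 (area b))
    (h : ∀ k, fcoeff b k (fun z => (f z : ℂ)) = fcoeff b k (fun z => (g z : ℂ))) :
    f =ᵐ[area b] g := by
  filter_upwards [ae_eq_of_fcoeff_eq (memLp_ofReal hf) (memLp_ofReal hg) h] with z hz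
  exact_mod_cast hz

namespace HasWeakDeriv

variable {f g f' g' : ℂ → ℝ}

/-- Weak derivatives in different directions commute. -/
theorem ae_comm {w : ℂ} {p q : ℂ → ℝ} (hf : HasWeakDeriv b v f f') (hg : HasWeakDeriv b w f g')
    (hp : HasWeakDeriv b w f' p) (hq : HasWeakDeriv b v g' q) : p =ᵐ[area b] q :=
  ae_eq_of_fcoeff_ofReal_eq hp.2 hq.2 fun k => by
    rw [hp.fcoeff_eq, hf.fcoeff_eq, hq.fcoeff_eq, hg.fcoeff_eq]
    ring

/-- Integration by parts for a single function; the general case follows by polarisation. -/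
theorem integral_mul_self (hf : HasWeakDeriv b v f f') : ∫ z, f z * f' z ∂(area b) = 0 := by
  obtain ⟨K, hK, hP⟩ := parseval_exists b
  have hp := hP _ (memLp_ofReal (hf.1.add hf.2))
  have hm := hP _ (memLp_ofReal (hf.1.sub hf.2))
  -- the coefficients `(1 ± iθ) f̂(k)` of `f ± f'` have the same absolute value
  have h1 : ∀ k, ‖fcoeff b k (fun z => (((f + f') z : ℝ) : ℂ))‖
      = ‖fcoeff b k (fun z => (((f - f') z : ℝ) : ℂ))‖ := by
    intro k
    simp only [Pi.add_apply, Pi.sub_apply, Complex.ofReal_add, Complex.ofReal_sub]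
    rw [fcoeff_add k (memLp_ofReal hf.1) (memLp_ofReal hf.2),
      fcoeff_sub k (memLp_ofReal hf.1) (memLp_ofReal hf.2), hf.fcoeff_eq]
    rw [← one_add_mul, ← one_sub_mul, norm_mul, norm_mul]
    congr 1
    rw [← Complex.norm_conj (1 - _)]
    simp
  simp only [h1] at hp
  have h2 := mul_left_cancel₀ hK.ne' (hp.unique hm)
  have i1 := hf.1.integrable_sq
  have i2 := hf.2.integrable_sq
  have i3 := memLp_mul_integrable hf.1 hf.2
  have e1 : ∀ z, ‖(((f + f') z : ℝ) : ℂ)‖ ^ 2 = (f z ^ 2 + f' z ^ 2) + 2 * (f z * f' z) := by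
    intro z
    rw [Complex.norm_real, Real.norm_eq_abs, sq_abs, Pi.add_apply]
    ring
  have e2 : ∀ z, ‖(((f - f') z : ℝ) : ℂ)‖ ^ 2 = (f z ^ 2 + f' z ^ 2) - 2 * (f z * f' z) := by
    intro z
    rw [Complex.norm_real, Real.norm_eq_abs, sq_abs, Pi.sub_apply]
    ring
  simp only [e1, e2] at h2
  have i12 : Integrable (fun z => f z ^ 2 + f' z ^ 2) (area b) := i1.add i2
  rw [integral_add i12 (i3.const_mul 2), integral_sub i12 (i3.const_mul 2),
    integral_const_mul] at h2
  linarith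

/-- Integration by parts for two weakly differentiable functions. -/
theorem integralZero_mul (hf : HasWeakDeriv b v f f') (hg : HasWeakDeriv b v g g') :
    IntegralZero b (fun z => f' z * g z + f z * g' z) := by
  have i1 := memLp_mul_integrable hf.2 hg.1
  have i2 := memLp_mul_integrable hf.1 hg.2
  refine ⟨i1.add i2, ?_⟩
  have h1 := (hf.add hg).integral_mul_self
  have h2 := hf.integral_mul_self
  have h3 := hg.integral_mul_self
  have e : ∀ z, (f z + g z) * (f' z + g' z)
      = (f z * f' z + g z * g' z) + (f' z * g z + f z * g' z) := fun z => by ring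
  simp only [e] at h1
  have i3 : Integrable (fun z => f z * f' z + g z * g' z) (area b) :=
    (memLp_mul_integrable hf.1 hf.2).add (memLp_mul_integrable hg.1 hg.2)
  have i12 : Integrable (fun z => f' z * g z + f z * g' z) (area b) := i1.add i2
  rw [integral_add i3 i12, integral_add (memLp_mul_integrable hf.1 hf.2) (memLp_mul_integrable hg.1 hg.2),
    h2, h3] at h1
  linarith

/-- Integration by parts with a smooth weight. -/
theorem integralZero_smooth_mul_mul {a : ℂ → ℝ} (ha : SmoothPeriodic b a)
    (hf : HasWeakDeriv b v f f') (hg : HasWeakDeriv b v g g') :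
    IntegralZero b (fun z => fderiv ℝ a z v * f z * g z + a z * f' z * g z
      + a z * f z * g' z) :=
  ((hf.smooth_mul ha).integralZero_mul hg).congr (Eventually.of_forall fun z => by ring)

/-- The Jacobian of two functions is a divergence. -/
theorem integralZero_jacobian {w : ℂ} {a fv fw gv gw p q : ℂ → ℝ} (ha : SmoothPeriodic b a)
    (hfv : HasWeakDeriv b v f fv) (hfw : HasWeakDeriv b w f fw)
    (hgv : HasWeakDeriv b v g gv) (hgw : HasWeakDeriv b w g gw)
    (hp : HasWeakDeriv b w gv p) (hq : HasWeakDeriv b v gw q) :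
    IntegralZero b (fun z => a z * (fv z * gw z - fw z * gv z)
      + fderiv ℝ a z v * f z * gw z - fderiv ℝ a z w * f z * gv z) := by
  refine ((integralZero_smooth_mul_mul ha hfv hq).sub
    (integralZero_smooth_mul_mul ha hfw hp)).congr ?_
  filter_upwards [hgv.ae_comm hgw hp hq] with z hz
  rw [hz]
  ring

end HasWeakDeriv

end WeakDerivatives

/-! ### Decay of Fourier coefficients -/

section FourierDecay

variable (b : Module.Basis (Fin 2) ℝ ℂ)

theorem exists_norm_phase_le : ∃ C, 0 ≤ C ∧ ∀ k, ‖phase b k‖ ≤ C * ‖k‖ := by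
  refine ⟨∑ j, 2 * Real.pi * ‖(b.coord j).toContinuousLinearMap‖, by positivity, fun k => ?_⟩
  have h : phase b k = ∑ j, (2 * Real.pi * (k j : ℝ)) • (b.coord j).toContinuousLinearMap := by
    ext v
    simp [phase_apply, Module.Basis.coord_apply]
  rw [h, Finset.sum_mul]
  refine (norm_sum_le _ _).trans (Finset.sum_le_sum fun j _ => ?_)
  rw [norm_smul, norm_mul, norm_mul, Real.norm_eq_abs, Real.norm_eq_abs,
    abs_of_pos Real.pi_pos, abs_two]
  have hk : ‖(k j : ℝ)‖ ≤ ‖k‖ := by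
    exact (Int.norm_cast_real (k j)).le.trans (norm_le_pi_norm k j)
  calc _ = 2 * Real.pi * ‖(b.coord j).toContinuousLinearMap‖ * ‖(k j : ℝ)‖ := by ring
    _ ≤ _ := by gcongr

/-- The symbol of the Laplacian is bounded below by a multiple of `‖k‖²`. -/
theorem exists_le_phase_sq : ∃ c, 0 < c ∧ ∀ k,
    c * ‖k‖ ^ 2 ≤ phase b k 1 ^ 2 + phase b k Complex.I ^ 2 := by
  set D : ℝ := 1 + ∑ j, ‖b j‖ ^ 2 with hD
  have hD0 : 0 < D := by positivity
  refine ⟨D⁻¹, inv_pos.2 hD0, fun k => ?_⟩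
  rw [inv_mul_le_iff₀ hD0]
  set P := phase b k 1 ^ 2 + phase b k Complex.I ^ 2 with hP
  have hP0 : 0 ≤ P := by positivity
  have hj : ∀ j, ‖k j‖ ^ 2 ≤ D * P := by
    intro j
    have h1 : phase b k (b j) = (b j).re * phase b k 1 + (b j).im * phase b k Complex.I := by
      conv_lhs => rw [← Complex.re_add_im (b j)]
      rw [map_add, show ((b j).re : ℂ) = (b j).re • (1 : ℂ) by simp,
        show ((b j).im : ℂ) * Complex.I = (b j).im • Complex.I by simp, map_smul, map_smul]
      simp
    rw [phase_basis] at h1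
    have h2 : ‖b j‖ ^ 2 = (b j).re ^ 2 + (b j).im ^ 2 := by
      rw [← Complex.normSq_eq_norm_sq, Complex.normSq_apply]
      ring
    have h3 : ‖b j‖ ^ 2 ≤ D := by
      have := Finset.single_le_sum (f := fun j => ‖b j‖ ^ 2) (fun i _ => by positivity)
        (Finset.mem_univ j)
      linarith
    have h4 : (2 * Real.pi * k j) ^ 2 ≤ ‖b j‖ ^ 2 * P := by
      rw [h1, h2, hP]
      nlinarith [sq_nonneg ((b j).re * phase b k Complex.I - (b j).im * phase b k 1)]
    have h5 : ‖k j‖ ^ 2 = (k j : ℝ) ^ 2 := by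
      rw [Int.norm_eq_abs, sq_abs]
    have h6 : (1 : ℝ) ≤ (2 * Real.pi) ^ 2 := by nlinarith [Real.pi_gt_three]
    rw [h5]
    calc (k j : ℝ) ^ 2 ≤ (2 * Real.pi) ^ 2 * (k j : ℝ) ^ 2 :=
          le_mul_of_one_le_left (sq_nonneg _) h6
      _ = (2 * Real.pi * k j) ^ 2 := by ring
      _ ≤ ‖b j‖ ^ 2 * P := h4
      _ ≤ D * P := by gcongr
  obtain ⟨j, hj'⟩ : ∃ j, ‖k‖ = ‖k j‖ := by
    obtain ⟨j, hj⟩ := Finite.exists_max fun j => ‖k j‖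
    exact ⟨j, le_antisymm ((pi_norm_le_iff_of_nonneg (norm_nonneg _)).2 hj) (norm_le_pi_norm k j)⟩
  rw [hj']
  exact hj j

variable {b}

/-- The family `c` is of order `(1 + ‖k‖)⁻ˢ`. -/
def Decays (s : ℕ) (c : (Fin 2 → ℤ) → ℂ) : Prop :=
  ∃ C, ∀ k, ‖c k‖ * (1 + ‖k‖) ^ s ≤ C

theorem summable_one_add_norm_pow : Summable fun k : Fin 2 → ℤ => ((1 + ‖k‖) ^ 3)⁻¹ := by
  refine Summable.of_norm_bounded_eventually
    (EisensteinSeries.summable_one_div_norm_rpow (k := 3) (by norm_num)) ?_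
  filter_upwards [(Set.finite_singleton (0 : Fin 2 → ℤ)).compl_mem_cofinite] with k hk
  have hk0 : 0 < ‖k‖ := norm_pos_iff.2 (by simpa using hk)
  rw [norm_inv, norm_pow, Real.rpow_neg hk0.le, Real.norm_of_nonneg (by positivity)]
  refine inv_anti₀ (by positivity) ?_
  rw [show (3 : ℝ) = (3 : ℕ) by norm_num, Real.rpow_natCast]
  gcongr
  linarith

theorem Decays.summable {s : ℕ} {c : (Fin 2 → ℤ) → ℂ} (h : Decays (s + 3) c) :
    Summable fun k => ‖c k‖ * (1 + ‖k‖) ^ s := by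
  obtain ⟨C, hC⟩ := h
  refine Summable.of_nonneg_of_le (fun k => by positivity) (fun k => ?_)
    (summable_one_add_norm_pow.mul_left C)
  rw [← div_eq_mul_inv, le_div_iff₀ (by positivity), mul_assoc, ← pow_add]
  exact hC k

theorem Decays.summable_norm {c : (Fin 2 → ℤ) → ℂ} (h : Decays 3 c) :
    Summable fun k => ‖c k‖ := by
  simpa using Decays.summable (s := 0) h

theorem norm_fcoeff_le (k : Fin 2 → ℤ) (f : ℂ → ℂ) :
    ‖fcoeff b k f‖ ≤ ∫ z, ‖f z‖ ∂(area b) := by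
  refine (norm_integral_le_integral_norm _).trans (le_of_eq ?_)
  simp only [norm_mul, norm_chr, one_mul]

theorem fcoeff_fderiv {a : ℂ → ℂ} (ha : SmoothPeriodic b a) (k : Fin 2 → ℤ) (v : ℂ) :
    fcoeff b k (fun z => fderiv ℝ a z v) = Complex.I * phase b k v * fcoeff b k a := by
  have h := ((smoothPeriodic_chr b (-k)).mul ha).integral_fderiv v
  have e : ∀ z, fderiv ℝ (fun z => chr b (-k) z * a z) z v
      = chr b (-k) z * fderiv ℝ a z v - Complex.I * phase b k v * (chr b (-k) z * a z) := by
    intro z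
    have := (hasFDerivAt_chr b (-k) z).mul (ha.differentiable z).hasFDerivAt
    rw [show (fun z => chr b (-k) z * a z) = chr b (-k) * a from rfl, this.fderiv]
    have hneg : phase b (-k) v = -phase b k v := by simp [phase_apply]
    simp [hneg]
    ring
  simp only [e] at h
  rw [integral_sub, integral_const_mul, sub_eq_zero] at h
  · exact h
  · exact integrable_chr_mul _ ((ha.fderiv v).memLp 2)
  · exact (integrable_chr_mul _ (ha.memLp 2)).const_mul _

/-- The Fourier coefficients of a smooth function decay rapidly. -/
theorem SmoothPeriodic.decays {a : ℂ → ℂ} (ha : SmoothPeriodic b a) (s : ℕ) :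
    Decays s (fun k => fcoeff b k a) := by
  have key : ∀ (i : Fin 2) (m : ℕ) (a : ℂ → ℂ), SmoothPeriodic b a →
      ∃ C, 0 ≤ C ∧ ∀ k : Fin 2 → ℤ, ‖k i‖ ^ m * ‖fcoeff b k a‖ ≤ C := by
    intro i m
    induction m with
    | zero =>
      intro a _
      exact ⟨∫ z, ‖a z‖ ∂(area b), integral_nonneg fun _ => norm_nonneg _, fun k => by
        simpa using norm_fcoeff_le k a⟩
    | succ m ih =>
      intro a ha
      obtain ⟨C, hC0, hC⟩ := ih _ (ha.fderiv (b i))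
      refine ⟨C, hC0, fun k => le_trans ?_ (hC k)⟩
      rw [fcoeff_fderiv ha, phase_basis, norm_mul, norm_mul, Complex.norm_I, one_mul,
        Complex.norm_real, norm_mul, norm_mul, pow_succ]
      have h1 : ‖((k i : ℤ) : ℝ)‖ = ‖k i‖ := Int.norm_cast_real _
      have h2 : (1 : ℝ) ≤ ‖(2 : ℝ)‖ * ‖Real.pi‖ := by
        rw [Real.norm_of_nonneg Real.pi_pos.le, Real.norm_two]
        linarith [Real.pi_gt_three]
      rw [h1]
      calc ‖k i‖ ^ m * ‖k i‖ * ‖fcoeff b k a‖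
          = 1 * (‖k i‖ ^ m * ‖k i‖ * ‖fcoeff b k a‖) := by ring
        _ ≤ (‖(2 : ℝ)‖ * ‖Real.pi‖) * (‖k i‖ ^ m * ‖k i‖ * ‖fcoeff b k a‖) := by gcongr
        _ = _ := by ring
  obtain ⟨C0, h00, hC0⟩ := key 0 0 a ha
  choose C hC using fun i => key i s a ha
  refine ⟨2 ^ s * (C0 + ∑ i, C i), fun k => ?_⟩
  obtain ⟨j, hj⟩ : ∃ j, ‖k‖ = ‖k j‖ := by
    obtain ⟨j, hj⟩ := Finite.exists_max fun j => ‖k j‖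
    exact ⟨j, le_antisymm ((pi_norm_le_iff_of_nonneg (norm_nonneg _)).2 hj) (norm_le_pi_norm k j)⟩
  have h1 : (1 + ‖k‖) ^ s ≤ 2 ^ s * (1 + ‖k‖ ^ s) := by
    rcases le_total ‖k‖ 1 with h | h
    · calc (1 + ‖k‖) ^ s ≤ 2 ^ s := by gcongr; linarith
        _ ≤ 2 ^ s * (1 + ‖k‖ ^ s) := le_mul_of_one_le_right (by positivity)
          (by linarith [pow_nonneg (norm_nonneg k) s])
    · calc (1 + ‖k‖) ^ s ≤ (2 * ‖k‖) ^ s := by gcongr; linarith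
        _ = 2 ^ s * ‖k‖ ^ s := mul_pow _ _ _
        _ ≤ 2 ^ s * (1 + ‖k‖ ^ s) := by gcongr; linarith
  have h2 := hC0 k
  have h3 := (hC j).2 k
  have h4 := Finset.single_le_sum (f := C) (fun i _ => (hC i).1) (Finset.mem_univ j)
  rw [pow_zero, one_mul] at h2
  calc ‖fcoeff b k a‖ * (1 + ‖k‖) ^ s ≤ ‖fcoeff b k a‖ * (2 ^ s * (1 + ‖k‖ ^ s)) := by gcongr
    _ = 2 ^ s * (‖fcoeff b k a‖ + ‖k j‖ ^ s * ‖fcoeff b k a‖) := by rw [hj]; ring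
    _ ≤ 2 ^ s * (C0 + ∑ i, C i) := by gcongr; linarith

theorem area_real_pos : 0 < (area b).real Set.univ :=
  ENNReal.toReal_pos (area_univ_ne_zero b) (measure_ne_top _ _)

theorem integral_chr (k : Fin 2 → ℤ) :
    ∫ z, chr b k z ∂(area b) = if k = 0 then (((area b).real Set.univ : ℝ) : ℂ) else 0 := by
  split_ifs with h
  · subst h
    have : ∀ z, chr b 0 z = 1 := fun z => by simp [chr, phase_apply]
    simp [this]
  · obtain ⟨i, hi⟩ := Function.ne_iff.1 h
    have h1 := (smoothPeriodic_chr b k).integral_fderiv (b i)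
    simp only [fderiv_chr] at h1
    rw [integral_const_mul, phase_basis] at h1
    rcases mul_eq_zero.1 h1 with h2 | h2
    · simp [Real.pi_ne_zero] at h2
      exact absurd h2 hi
    · exact h2

/-- An absolutely convergent Fourier series represents the function almost everywhere. -/
theorem ae_eq_tsum_fcoeff {f : ℂ → ℂ} (hf : MemLp f 2 (area b))
    (hs : Summable fun k => ‖fcoeff b k f‖) :
    f =ᵐ[area b] fun z => ∑' k, (((area b).real Set.univ : ℝ) : ℂ)⁻¹ * fcoeff b k f
      * chr b k z := by
  set A := (((area b).real Set.univ : ℝ) : ℂ) with hA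
  have hA0 : A ≠ 0 := by
    rw [hA]
    exact_mod_cast area_real_pos.ne'
  set c : (Fin 2 → ℤ) → ℂ := fun k => A⁻¹ * fcoeff b k f with hc
  have hcs : Summable fun k => ‖c k‖ := by
    simpa [hc] using hs.mul_left ‖A⁻¹‖
  have hcont : Continuous fun z => ∑' k, c k * chr b k z :=
    continuous_tsum (fun k => continuous_const.mul (smoothPeriodic_chr b k).continuous) hcs
      fun k z => by rw [norm_mul, norm_chr, mul_one]
  have hG : MemLp (fun z => ∑' k, c k * chr b k z) 2 (area b) := by
    refine MemLp.of_bound hcont.aestronglyMeasurable (∑' k, ‖c k‖) (Eventually.of_forall fun z => ?_)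
    refine tsum_of_norm_bounded hcs.hasSum fun k => ?_
    rw [norm_mul, norm_chr, mul_one]
  change f =ᵐ[area b] fun z => ∑' k, c k * chr b k z
  refine ae_eq_of_fcoeff_eq hf hG fun k => ?_
  rw [fcoeff, fcoeff]
  conv_rhs => enter [2, z]; rw [← tsum_mul_left]
  rw [← integral_tsum_of_summable_integral_norm]
  · have e : ∀ l z, chr b (-k) z * (c l * chr b l z) = c l * chr b (l - k) z := by
      intro l z
      rw [sub_eq_add_neg, chr_add]
      ring
    simp only [e, integral_const_mul, integral_chr]
    rw [tsum_eq_single k]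
    · simp only [sub_self, if_true, hc]
      rw [fcoeff, ← hA]
      field_simp
    · intro l hl
      rw [if_neg (sub_ne_zero.2 hl), mul_zero]
  · intro l
    exact integrable_chr_mul _ (((smoothPeriodic_chr b l).memLp 2).const_mul _)
  · have e : ∀ l, ∫ z, ‖chr b (-k) z * (c l * chr b l z)‖ ∂(area b)
        = (area b).real Set.univ * ‖c l‖ := by
      intro l
      simp only [norm_mul (chr b _ _), norm_mul (c l), norm_chr, one_mul, mul_one, integral_const,
        smul_eq_mul]
    simp only [e]
    exact hcs.mul_left _

/-- Multiplication by a smooth function preserves the decay of Fourier coefficients. -/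
theorem SmoothPeriodic.decays_mul {a u : ℂ → ℂ} (ha : SmoothPeriodic b a)
    (hu : MemLp u 2 (area b)) {s : ℕ} (hs : Decays s (fun k => fcoeff b k u)) :
    Decays s (fun k => fcoeff b k (fun z => a z * u z)) := by
  obtain ⟨C, hC⟩ := hs
  set A := (((area b).real Set.univ : ℝ) : ℂ) with hA
  have has := (ha.decays (s + 3)).summable
  have has0 := (ha.decays 3).summable_norm
  have hui : Integrable u (area b) := hu.integrable (by norm_num)
  have hconv : ∀ k, HasSum (fun l => A⁻¹ * fcoeff b l a * fcoeff b (k - l) u)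
      (fcoeff b k (fun z => a z * u z)) := by
    intro k
    have h1 : fcoeff b k (fun z => a z * u z)
        = ∫ z, ∑' l, A⁻¹ * fcoeff b l a * (chr b (-(k - l)) z * u z) ∂(area b) := by
      rw [fcoeff]
      refine integral_congr_ae ?_
      filter_upwards [ae_eq_tsum_fcoeff (ha.memLp 2) has0] with z hz
      rw [hz, ← tsum_mul_right, ← tsum_mul_left]
      refine tsum_congr fun l => ?_
      rw [show -(k - l) = -k + l by ring, chr_add]
      ring
    rw [h1]
    have h2 := hasSum_integral_of_summable_integral_norm (μ := area b)
      (F := fun l z => A⁻¹ * fcoeff b l a * (chr b (-(k - l)) z * u z))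
      (fun l => (integrable_chr_mul _ hu).const_mul _) (by
        simp only [norm_mul, norm_chr, one_mul, integral_const_mul]
        exact (has0.mul_left _).mul_right _)
    simpa only [integral_const_mul, fcoeff] using h2
  refine ⟨∑' l, ‖A⁻¹‖ * (‖fcoeff b l a‖ * (1 + ‖l‖) ^ s) * C, fun k => ?_⟩
  have hsum : Summable fun l => ‖A⁻¹‖ * (‖fcoeff b l a‖ * (1 + ‖l‖) ^ s) * C :=
    (has.mul_left _).mul_right _
  have hbd : ∀ l, ‖A⁻¹ * fcoeff b l a * fcoeff b (k - l) u‖ * (1 + ‖k‖) ^ s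
      ≤ ‖A⁻¹‖ * (‖fcoeff b l a‖ * (1 + ‖l‖) ^ s) * C := by
    intro l
    have h1 : (1 + ‖k‖) ^ s ≤ (1 + ‖l‖) ^ s * (1 + ‖k - l‖) ^ s := by
      rw [← mul_pow]
      gcongr
      have : ‖k‖ ≤ ‖l‖ + ‖k - l‖ := by simpa using norm_add_le l (k - l)
      nlinarith [norm_nonneg l, norm_nonneg (k - l)]
    rw [norm_mul, norm_mul]
    calc _ ≤ ‖A⁻¹‖ * ‖fcoeff b l a‖ * ‖fcoeff b (k - l) u‖
          * ((1 + ‖l‖) ^ s * (1 + ‖k - l‖) ^ s) := by gcongr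
      _ = ‖A⁻¹‖ * (‖fcoeff b l a‖ * (1 + ‖l‖) ^ s)
          * (‖fcoeff b (k - l) u‖ * (1 + ‖k - l‖) ^ s) := by ring
      _ ≤ _ := by
        gcongr
        exact hC _
  have h3 := (hconv k).mul_right ((((1 + ‖k‖) ^ s : ℝ)) : ℂ)
  have hpos : (0 : ℝ) ≤ (1 + ‖k‖) ^ s := by positivity
  have h4 := tsum_of_norm_bounded (f := fun l => A⁻¹ * fcoeff b l a * fcoeff b (k - l) u
    * ((((1 + ‖k‖) ^ s : ℝ)) : ℂ)) hsum.hasSum (fun l => by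
      rw [norm_mul _ ((((1 + ‖k‖) ^ s : ℝ)) : ℂ), Complex.norm_of_nonneg hpos]
      exact hbd l)
  rw [h3.tsum_eq, norm_mul, Complex.norm_of_nonneg hpos] at h4
  exact h4

theorem norm_iteratedFDeriv_chr_le (k : Fin 2 → ℤ) (n : ℕ) (z : ℂ) :
    ‖iteratedFDeriv ℝ n (chr b k) z‖ ≤ ‖phase b k‖ ^ n := by
  induction n with
  | zero => simp [norm_chr]
  | succ n ih =>
    set L : ℂ →L[ℝ] (ℂ →L[ℝ] ℂ) :=
      (ContinuousLinearMap.smulRightL ℝ ℂ ℂ (phase b k)).comp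
        (ContinuousLinearMap.mul ℝ ℂ Complex.I) with hL
    have h1 : fderiv ℝ (chr b k) = L ∘ chr b k := by
      funext w
      rw [(hasFDerivAt_chr b k w).fderiv]
      rfl
    have hLn : ‖L‖ ≤ ‖phase b k‖ := by
      refine ContinuousLinearMap.opNorm_le_bound _ (norm_nonneg _) fun w => ?_
      have : L w = (phase b k).smulRight (Complex.I * w) := rfl
      rw [this, ContinuousLinearMap.norm_smulRight_apply, norm_mul, Complex.norm_I, one_mul]
    rw [← norm_iteratedFDeriv_fderiv, h1]
    refine (L.norm_iteratedFDeriv_comp_left (smoothPeriodic_chr b k).contDiff.contDiffAt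
      (mod_cast le_top)).trans ?_
    rw [pow_succ, mul_comm (_ ^ n)]
    gcongr

/-- A square integrable function with rapidly decreasing Fourier coefficients is smooth. -/
theorem exists_smooth_of_decays {f : ℂ → ℝ} (hf : MemLp f 2 (area b))
    (h : ∀ s, Decays s (fun k => fcoeff b k (fun z => (f z : ℂ)))) :
    ∃ g : ℂ → ℝ, SmoothPeriodic b g ∧ f =ᵐ[area b] g := by
  set c : (Fin 2 → ℤ) → ℂ := fun k => (((area b).real Set.univ : ℝ) : ℂ)⁻¹
    * fcoeff b k (fun z => (f z : ℂ)) with hc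
  obtain ⟨D, hD0, hD⟩ := exists_norm_phase_le b
  have hG : SmoothPeriodic b fun z => ∑' k, c k * chr b k z := by
    constructor
    · intro i z
      simp only [(smoothPeriodic_chr b _).periodic i z]
    · refine contDiff_tsum (v := fun n k => ‖c k‖ * (D * ‖k‖) ^ n)
        (fun k => contDiff_const.mul (smoothPeriodic_chr b k).contDiff) ?_ ?_
      · intro n _
        refine Summable.of_nonneg_of_le (fun k => by positivity) (fun k => ?_)
          (((h (n + 3)).summable.mul_left
            (‖(((area b).real Set.univ : ℝ) : ℂ)⁻¹‖)).mul_left (D ^ n))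
        simp only [hc, norm_mul, mul_pow]
        calc _ = D ^ n * (‖(((area b).real Set.univ : ℝ) : ℂ)⁻¹‖
            * (‖fcoeff b k (fun z => (f z : ℂ))‖ * ‖k‖ ^ n)) := by ring
          _ ≤ _ := by
            gcongr
            linarith
      · intro n k z hn
        have h1 := (ContinuousLinearMap.mul ℝ ℂ (c k)).norm_iteratedFDeriv_comp_left
          ((smoothPeriodic_chr b k).contDiff.contDiffAt (x := z)) (n := n) (mod_cast hn)
        refine h1.trans ?_
        have h2 : ‖ContinuousLinearMap.mul ℝ ℂ (c k)‖ ≤ ‖c k‖ :=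
          ContinuousLinearMap.opNorm_mul_apply_le ℝ ℂ (c k)
        have h3 := norm_iteratedFDeriv_chr_le (b := b) k n z
        have h4 : ‖phase b k‖ ^ n ≤ (D * ‖k‖) ^ n := by
          gcongr
          exact hD k
        gcongr
        exact h3.trans h4
  refine ⟨_, hG.clm_comp Complex.reCLM, ?_⟩
  filter_upwards [ae_eq_tsum_fcoeff (memLp_ofReal hf) (h 3).summable_norm] with z hz
  rw [← hz]
  simp

end FourierDecay

/-! ### Elliptic regularity -/

section EllipticRegularity

variable {b : Module.Basis (Fin 2) ℝ ℂ} {ι : Type*} [Fintype ι]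

theorem fderiv_clm_comp {η : ℂ → ℂ} (hη : SmoothPeriodic b η) (L : ℂ →L[ℝ] ℝ) (v : ℂ) :
    (fun z => fderiv ℝ (fun w => L (η w)) z v) = fun z => L (fderiv ℝ η z v) := by
  funext z
  have := L.hasFDerivAt.comp z (hη.differentiable z).hasFDerivAt
  rw [show (fun z => L (η z)) = L ∘ η from rfl, this.fderiv]
  simp

theorem SmoothPeriodic.ofReal {a : ℂ → ℝ} (ha : SmoothPeriodic b a) :
    SmoothPeriodic b (fun z => (a z : ℂ)) := ha.clm_comp Complex.ofRealCLM

/-- Elliptic regularity: a square integrable distributional solution of a system of the form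
`Δ gᵢ = ∑ⱼ (lower order terms in gⱼ)` with smooth coefficients is smooth. On the side of the Fourier
coefficients, the equation gains one order of decay. -/
theorem exists_smooth_of_weak_laplace {g : ι → ℂ → ℝ} (hg : ∀ i, MemLp (g i) 2 (area b))
    {A B C : ι → ι → ℂ → ℝ} (hA : ∀ i j, SmoothPeriodic b (A i j))
    (hB : ∀ i j, SmoothPeriodic b (B i j)) (hC : ∀ i j, SmoothPeriodic b (C i j))
    (h : ∀ i (η : ℂ → ℝ), SmoothPeriodic b η →
      ∫ z, ((fderiv ℝ (fun w => fderiv ℝ η w 1) z 1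
          + fderiv ℝ (fun w => fderiv ℝ η w Complex.I) z Complex.I) * g i z
        - ∑ j, (A i j z * η z + B i j z * fderiv ℝ η z 1 + C i j z * fderiv ℝ η z Complex.I)
            * g j z) ∂(area b) = 0) (i : ι) :
    ∃ G : ℂ → ℝ, SmoothPeriodic b G ∧ g i =ᵐ[area b] G := by
  have hgc : ∀ i, MemLp (fun z => (g i z : ℂ)) 2 (area b) := fun i => memLp_ofReal (hg i)
  have hcomplex : ∀ i (η : ℂ → ℂ), SmoothPeriodic b η →
      ∫ z, ((fderiv ℝ (fun w => fderiv ℝ η w 1) z 1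
          + fderiv ℝ (fun w => fderiv ℝ η w Complex.I) z Complex.I) * (g i z : ℂ)
        - ∑ j, ((A i j z : ℂ) * η z + (B i j z : ℂ) * fderiv ℝ η z 1
          + (C i j z : ℂ) * fderiv ℝ η z Complex.I) * (g j z : ℂ)) ∂(area b) = 0 := by
    intro i η hη
    have hint : Integrable (fun z => ((fderiv ℝ (fun w => fderiv ℝ η w 1) z 1
          + fderiv ℝ (fun w => fderiv ℝ η w Complex.I) z Complex.I) * (g i z : ℂ)
        - ∑ j, ((A i j z : ℂ) * η z + (B i j z : ℂ) * fderiv ℝ η z 1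
          + (C i j z : ℂ) * fderiv ℝ η z Complex.I) * (g j z : ℂ))) (area b) := by
      refine Integrable.sub ?_ (integrable_finsetSum _ fun j _ => ?_)
      · exact MemLp.integrable_mul (p := 2) (q := 2)
          ((((hη.fderiv 1).fderiv 1).add ((hη.fderiv Complex.I).fderiv Complex.I)).memLp 2) (hgc i)
      · exact MemLp.integrable_mul (p := 2) (q := 2)
          (((((hA i j).ofReal.mul hη).add ((hB i j).ofReal.mul (hη.fderiv 1))).add
            ((hC i j).ofReal.mul (hη.fderiv Complex.I))).memLp 2) (hgc j)
    have key : ∀ L : ℂ →L[ℝ] ℝ, (∀ (w : ℂ) (r : ℝ), L (w * r) = L w * r) →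
        L (∫ z, ((fderiv ℝ (fun w => fderiv ℝ η w 1) z 1
          + fderiv ℝ (fun w => fderiv ℝ η w Complex.I) z Complex.I) * (g i z : ℂ)
        - ∑ j, ((A i j z : ℂ) * η z + (B i j z : ℂ) * fderiv ℝ η z 1
          + (C i j z : ℂ) * fderiv ℝ η z Complex.I) * (g j z : ℂ)) ∂(area b)) = 0 := by
      intro L hL
      have hL' : ∀ (w : ℂ) (r : ℝ), L (r * w) = r * L w := fun w r => by
        rw [mul_comm, hL, mul_comm]
      rw [← L.integral_comp_comm hint, ← h i _ (hη.clm_comp L)]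
      simp only [map_sub, map_sum, map_add, hL, hL', fderiv_clm_comp hη]
      congr 1
      funext z
      rw [congrFun (fderiv_clm_comp (hη.fderiv 1) L 1) z,
        congrFun (fderiv_clm_comp (hη.fderiv Complex.I) L Complex.I) z,
        congrFun (fderiv_clm_comp hη L 1) z, congrFun (fderiv_clm_comp hη L Complex.I) z]
    apply Complex.ext
    · exact key Complex.reCLM (by simp)
    · exact key Complex.imCLM (by simp)
  set R : ι → (Fin 2 → ℤ) → ℂ := fun i k => ∑ j,
    (fcoeff b k (fun z => (A i j z : ℂ) * (g j z : ℂ))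
      - Complex.I * phase b k 1 * fcoeff b k (fun z => (B i j z : ℂ) * (g j z : ℂ))
      - Complex.I * phase b k Complex.I * fcoeff b k (fun z => (C i j z : ℂ) * (g j z : ℂ)))
    with hR
  have hAg : ∀ {a : ι → ι → ℂ → ℝ}, (∀ i j, SmoothPeriodic b (a i j)) → ∀ i j,
      MemLp (fun z => (a i j z : ℂ) * (g j z : ℂ)) 2 (area b) :=
    fun ha i j => (ha i j).ofReal.mul_memLp (hgc j)
  have heq : ∀ i k, -((phase b k 1 ^ 2 + phase b k Complex.I ^ 2 : ℝ) : ℂ)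
      * fcoeff b k (fun z => (g i z : ℂ)) = R i k := by
    intro i k
    have h1 := hcomplex i _ (smoothPeriodic_chr b (-k))
    have hneg : ∀ v, phase b (-k) v = -phase b k v := by simp [phase_apply]
    have hd : ∀ v z, fderiv ℝ (fun w => fderiv ℝ (chr b (-k)) w v) z v
        = -((phase b k v ^ 2 : ℝ) : ℂ) * chr b (-k) z := by
      intro v z
      simp only [fderiv_chr]
      rw [((hasFDerivAt_chr b (-k) z).const_mul _).fderiv]
      simp only [smul_apply, ContinuousLinearMap.smulRight_apply, hneg,
        smul_eq_mul, Complex.real_smul]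
      push_cast
      linear_combination (phase b k v : ℂ) ^ 2 * chr b (-k) z * Complex.I_sq
    simp only [hd] at h1
    simp only [fderiv_chr, hneg] at h1
    have e : ∀ z, (-((phase b k 1 ^ 2 : ℝ) : ℂ) * chr b (-k) z
          + -((phase b k Complex.I ^ 2 : ℝ) : ℂ) * chr b (-k) z) * (g i z : ℂ)
        - ∑ j, ((A i j z : ℂ) * chr b (-k) z
          + (B i j z : ℂ) * (Complex.I * ((-phase b k 1 : ℝ) : ℂ) * chr b (-k) z)
          + (C i j z : ℂ) * (Complex.I * ((-phase b k Complex.I : ℝ) : ℂ) * chr b (-k) z))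
            * (g j z : ℂ)
        = -((phase b k 1 ^ 2 + phase b k Complex.I ^ 2 : ℝ) : ℂ) * (chr b (-k) z * (g i z : ℂ))
        - ∑ j, (chr b (-k) z * ((A i j z : ℂ) * (g j z : ℂ))
          - Complex.I * phase b k 1 * (chr b (-k) z * ((B i j z : ℂ) * (g j z : ℂ)))
          - Complex.I * phase b k Complex.I * (chr b (-k) z * ((C i j z : ℂ) * (g j z : ℂ)))) := by
      intro z
      congr 1
      · push_cast
        ring
      · refine Finset.sum_congr rfl fun j _ => ?_
        push_cast
        ring
    simp only [e] at h1
    have iA := fun j => integrable_chr_mul (-k) (hAg hA i j)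
    have iB := fun j => (integrable_chr_mul (-k) (hAg hB i j)).const_mul
      (Complex.I * phase b k 1)
    have iC := fun j => (integrable_chr_mul (-k) (hAg hC i j)).const_mul
      (Complex.I * phase b k Complex.I)
    have iABC := fun j => ((iA j).sub (iB j)).sub (iC j)
    simp only [Pi.sub_def] at iABC
    have iAB := fun j => (iA j).sub (iB j)
    simp only [Pi.sub_def] at iAB
    rw [integral_sub ((integrable_chr_mul _ (hgc i)).const_mul _)
      (integrable_finsetSum _ fun j _ => iABC j),
      integral_finsetSum _ fun j _ => iABC j, integral_const_mul, sub_eq_zero] at h1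
    rw [hR]
    simp only [fcoeff]
    rw [h1]
    refine Finset.sum_congr rfl fun j _ => ?_
    rw [integral_sub (iAB j) (iC j), integral_sub (iA j) (iB j), integral_const_mul,
      integral_const_mul]
  obtain ⟨D, hD0, hD⟩ := exists_norm_phase_le b
  obtain ⟨c, hc0, hc⟩ := exists_le_phase_sq b
  have hdecay : ∀ s i, Decays s (fun k => fcoeff b k (fun z => (g i z : ℂ))) := by
    intro s
    induction s with
    | zero =>
      intro i
      exact ⟨_, fun k => by simpa using norm_fcoeff_le k (fun z => (g i z : ℂ))⟩
    | succ s ih =>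
      intro i
      have hRd : ∃ M, 0 ≤ M ∧ ∀ k, ‖R i k‖ * (1 + ‖k‖) ^ s ≤ M * (1 + ‖k‖) := by
        choose MA hMA using fun j => (hA i j).ofReal.decays_mul (hgc j) (ih j)
        choose MB hMB using fun j => (hB i j).ofReal.decays_mul (hgc j) (ih j)
        choose MC hMC using fun j => (hC i j).ofReal.decays_mul (hgc j) (ih j)
        have hM0 : ∀ {c : (Fin 2 → ℤ) → ℂ} {M : ℝ}, (∀ k, ‖c k‖ * (1 + ‖k‖) ^ s ≤ M) → 0 ≤ M :=
          fun h => le_trans (by positivity) (h 0)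
        have hp : ∀ (k : Fin 2 → ℤ) (v : ℂ), ‖v‖ = 1 → ‖(phase b k v : ℂ)‖ ≤ D * (1 + ‖k‖) := by
          intro k v hv
          rw [Complex.norm_real]
          refine ((phase b k).le_opNorm v).trans ?_
          rw [hv, mul_one]
          refine (hD k).trans ?_
          gcongr
          linarith
        refine ⟨∑ j, (MA j + D * MB j + D * MC j), Finset.sum_nonneg fun j _ => ?_, fun k => ?_⟩
        · have := hM0 (hMA j)
          have := hM0 (hMB j)
          have := hM0 (hMC j)
          positivity
        · rw [hR, Finset.sum_mul]
          refine (mul_le_mul_of_nonneg_right (norm_sum_le _ _) (by positivity)).trans ?_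
          rw [Finset.sum_mul]
          refine Finset.sum_le_sum fun j _ => ?_
          have e1 := hMA j k
          have e2 := hMB j k
          have e3 := hMC j k
          have p1 := hp k 1 (by simp)
          have p2 := hp k Complex.I (by simp)
          have hk1 : (1 : ℝ) ≤ 1 + ‖k‖ := by linarith [norm_nonneg k]
          have t : ∀ x y w : ℂ, ‖x - y - w‖ ≤ ‖x‖ + ‖y‖ + ‖w‖ := fun x y w =>
            (norm_sub_le _ _).trans (by gcongr; exact norm_sub_le _ _)
          refine (mul_le_mul_of_nonneg_right (t _ _ _) (by positivity)).trans ?_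
          rw [norm_mul, norm_mul, norm_mul, norm_mul, Complex.norm_I, one_mul, one_mul, add_mul,
            add_mul, mul_assoc, mul_assoc, add_mul, add_mul]
          refine add_le_add (add_le_add ?_ ?_) ?_
          · exact e1.trans (le_mul_of_one_le_right (hM0 (hMA j)) hk1)
          · calc _ ≤ (D * (1 + ‖k‖)) * MB j := by gcongr
              _ = _ := by ring
          · calc _ ≤ (D * (1 + ‖k‖)) * MC j := by gcongr
              _ = _ := by ring
      obtain ⟨M, hM0, hM⟩ := hRd
      obtain ⟨C0, hC0⟩ := ih i
      refine ⟨max C0 (4 * c⁻¹ * M), fun k => ?_⟩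
      by_cases hk : k = 0
      · subst hk
        refine le_trans ?_ (le_max_left _ _)
        simpa using hC0 0
      · refine le_trans ?_ (le_max_right _ _)
        have hk1 : 1 ≤ ‖k‖ := by
          obtain ⟨j, hj⟩ := Function.ne_iff.1 hk
          refine le_trans ?_ (norm_le_pi_norm k j)
          rw [Int.norm_eq_abs]
          exact_mod_cast Int.one_le_abs hj
        have h1 := hM k
        rw [← heq, norm_mul, norm_neg, Complex.norm_of_nonneg (by positivity)] at h1
        have h2 : (1 + ‖k‖) ^ 2 ≤ 4 * c⁻¹ * (phase b k 1 ^ 2 + phase b k Complex.I ^ 2) := by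
          calc (1 + ‖k‖) ^ 2 ≤ 4 * ‖k‖ ^ 2 := by nlinarith
            _ = 4 * c⁻¹ * (c * ‖k‖ ^ 2) := by field_simp
            _ ≤ _ := by
              gcongr
              exact hc k
        have hpos : 0 < 1 + ‖k‖ := by positivity
        refine le_of_mul_le_mul_right ?_ hpos
        set a := ‖fcoeff b k (fun z => (g i z : ℂ))‖
        calc a * (1 + ‖k‖) ^ (s + 1) * (1 + ‖k‖) = (a * (1 + ‖k‖) ^ s) * (1 + ‖k‖) ^ 2 := by ring
          _ ≤ (a * (1 + ‖k‖) ^ s)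
              * (4 * c⁻¹ * (phase b k 1 ^ 2 + phase b k Complex.I ^ 2)) := by gcongr
          _ = 4 * c⁻¹ * ((phase b k 1 ^ 2 + phase b k Complex.I ^ 2) * a * (1 + ‖k‖) ^ s) := by ring
          _ ≤ 4 * c⁻¹ * (M * (1 + ‖k‖)) := by gcongr
          _ = 4 * c⁻¹ * M * (1 + ‖k‖) := by ring
  exact exists_smooth_of_decays (hg i) fun s => hdecay s i

end EllipticRegularity

/-! ### Compactness and Sobolev embedding -/

section SobolevEmbeddings

variable {b : Module.Basis (Fin 2) ℝ ℂ}

theorem parseval_real : ∃ K : ℝ, 0 < K ∧ ∀ f : ℂ → ℝ, MemLp f 2 (area b) →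
    HasSum (fun k => ‖fcoeff b k (fun z => (f z : ℂ))‖ ^ 2) (K * ∫ z, f z ^ 2 ∂(area b)) := by
  obtain ⟨K, hK, h⟩ := parseval_exists b
  refine ⟨K, hK, fun f hf => ?_⟩
  simpa using h _ (memLp_ofReal hf)

/-- Rellich's compactness theorem: along an ultrafilter, functions bounded in `H¹` converge in
`L²`. -/
theorem exists_tendsto_of_bounded_weakDeriv {ι : Type*} (l : Ultrafilter ι)
    {f fx fy : ι → ℂ → ℝ} (hx : ∀ j, HasWeakDeriv b 1 (f j) (fx j))
    (hy : ∀ j, HasWeakDeriv b Complex.I (f j) (fy j)) {C : ℝ}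
    (hC : ∀ j, ∫ z, f j z ^ 2 ∂(area b) + ∫ z, fx j z ^ 2 ∂(area b)
      + ∫ z, fy j z ^ 2 ∂(area b) ≤ C) :
    ∃ g : ℂ → ℝ, MemLp g 2 (area b) ∧
      Tendsto (fun j => ∫ z, (f j z - g z) ^ 2 ∂(area b)) l (𝓝 0) := by
  obtain ⟨K, hK, hP⟩ := parseval_real (b := b)
  obtain ⟨c, hc0, hc⟩ := exists_le_phase_sq b
  set a : ι → (Fin 2 → ℤ) → ℂ := fun j k => fcoeff b k (fun z => (f j z : ℂ)) with ha
  have hsq : ∀ g : ℂ → ℝ, 0 ≤ ∫ z, g z ^ 2 ∂(area b) := fun g =>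
    integral_nonneg fun z => sq_nonneg _
  have hb : ∀ j k, ‖a j k‖ ^ 2 ≤ K * C := by
    intro j k
    have h1 := hP _ (hx j).1
    have h2 := le_hasSum h1 k fun _ _ => by positivity
    refine h2.trans ?_
    gcongr
    linarith [hC j, hsq (fx j), hsq (fy j)]
  have hw : ∀ j (S : Finset (Fin 2 → ℤ)), ∑ k ∈ S, ‖k‖ ^ 2 * ‖a j k‖ ^ 2 ≤ c⁻¹ * (K * C) := by
    intro j S
    have h1 := (hP _ (hx j).2).add (hP _ (hy j).2)
    have h2 := sum_le_hasSum S (fun _ _ => by positivity) h1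
    rw [inv_mul_eq_div, le_div_iff₀ hc0]
    calc _ = ∑ k ∈ S, (c * ‖k‖ ^ 2) * ‖a j k‖ ^ 2 := by
          rw [Finset.sum_mul]
          exact Finset.sum_congr rfl fun k _ => by ring
      _ ≤ ∑ k ∈ S, (‖fcoeff b k (fun z => (fx j z : ℂ))‖ ^ 2
          + ‖fcoeff b k (fun z => (fy j z : ℂ))‖ ^ 2) := by
          refine Finset.sum_le_sum fun k _ => ?_
          rw [(hx j).fcoeff_eq, (hy j).fcoeff_eq]
          simp only [norm_mul, Complex.norm_I, one_mul, Complex.norm_real, mul_pow,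
            Real.norm_eq_abs, sq_abs]
          rw [← add_mul]
          gcongr
          exact hc k
      _ ≤ _ := h2
      _ ≤ _ := by
        rw [← mul_add]
        gcongr
        linarith [hC j, hsq (f j)]
  have hlim : ∀ k, ∃ v, Tendsto (fun j => a j k) l (𝓝 v) := by
    intro k
    have h1 : ∀ j, a j k ∈ Metric.closedBall (0 : ℂ) (Real.sqrt (K * C)) := fun j => by
      rw [mem_closedBall_zero_iff]
      exact Real.le_sqrt_of_sq_le (hb j k)
    obtain ⟨v, _, hv⟩ := (isCompact_closedBall (0 : ℂ) (Real.sqrt (K * C))).ultrafilter_le_nhds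
      (l.map fun j => a j k) (by
        rw [le_principal_iff, Ultrafilter.coe_map]
        exact Filter.mem_map.2 (Filter.univ_mem' h1))
    exact ⟨v, hv⟩
  choose v hv using hlim
  have hfm : ∀ j, MemLp (f j) 2 (area b) := fun j => (hx j).1
  set F : ι → Lp ℝ 2 (area b) := fun j => (hfm j).toLp with hF
  have hnorm : ∀ (g : ℂ → ℝ) (hg : MemLp g 2 (area b)),
      ‖hg.toLp‖ ^ 2 = ∫ z, g z ^ 2 ∂(area b) := by
    intro g hg
    rw [← real_inner_self_eq_norm_sq, L2.inner_def]
    refine integral_congr_ae ?_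
    filter_upwards [hg.coeFn_toLp] with z hz
    rw [hz]
    simp [sq]
  have hcauchy : Cauchy (map F l) := by
    rw [Metric.cauchy_iff]
    refine ⟨inferInstance, fun ε hε => ?_⟩
    obtain ⟨R, hR0, hR⟩ : ∃ R : ℝ, 0 < R ∧ (R ^ 2)⁻¹ * (4 * (c⁻¹ * (K * C))) < K * ε ^ 2 / 2 := by
      have : Tendsto (fun R : ℝ => (R ^ 2)⁻¹ * (4 * (c⁻¹ * (K * C)))) atTop (𝓝 0) := by
        have := (tendsto_inv_atTop_zero.comp (tendsto_pow_atTop (α := ℝ) two_ne_zero)).mul_const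
          (4 * (c⁻¹ * (K * C)))
        simpa using this
      exact ((eventually_gt_atTop 0).and (this.eventually_lt_const (by positivity))).exists
    have hfin : (Metric.closedBall (0 : Fin 2 → ℤ) R).Finite :=
      (isCompact_closedBall _ _).finite_of_discrete
    set s := hfin.toFinset with hs
    obtain ⟨δ, hδ0, hδ⟩ : ∃ δ : ℝ, 0 < δ ∧ s.card * (2 * δ) ^ 2 < K * ε ^ 2 / 2 := by
      have : Tendsto (fun δ : ℝ => s.card * (2 * δ) ^ 2) (𝓝[>] 0) (𝓝 0) := by
        have h : Continuous fun δ : ℝ => s.card * (2 * δ) ^ 2 := by fun_prop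
        simpa using (h.tendsto 0).mono_left nhdsWithin_le_nhds
      exact ((eventually_mem_nhdsWithin (a := (0 : ℝ)) (s := Set.Ioi 0)).and
        (this.eventually_lt_const (by positivity))).exists
    have hev : ∀ᶠ j in (l : Filter ι), ∀ k ∈ s, ‖a j k - v k‖ < δ := by
      rw [eventually_all_finset]
      intro k _
      simpa [dist_eq_norm] using (hv k).eventually (Metric.ball_mem_nhds _ hδ0)
    refine ⟨F '' {j | ∀ k ∈ s, ‖a j k - v k‖ < δ}, image_mem_map hev, ?_⟩
    rintro _ ⟨i, hi, rfl⟩ _ ⟨j, hj, rfl⟩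
    have h1 : ‖F i - F j‖ ^ 2 = ∫ z, (f i - f j) z ^ 2 ∂(area b) := by
      rw [hF]
      simp only
      rw [← MemLp.toLp_sub, hnorm]
    have hsum := hP _ ((hfm i).sub (hfm j))
    have hcoef : ∀ k, fcoeff b k (fun z => (((f i - f j) z : ℝ) : ℂ)) = a i k - a j k := by
      intro k
      rw [ha]
      simp only
      rw [← fcoeff_sub k (memLp_ofReal (hfm i)) (memLp_ofReal (hfm j))]
      simp
    simp only [hcoef] at hsum
    rw [← h1] at hsum
    have hle : K * ‖F i - F j‖ ^ 2 ≤ s.card * (2 * δ) ^ 2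
        + (R ^ 2)⁻¹ * (4 * (c⁻¹ * (K * C))) := by
      refine hasSum_le_of_sum_le hsum fun S => ?_
      have hpt : ∀ k, ‖a i k - a j k‖ ^ 2 ≤ (if k ∈ s then (2 * δ) ^ 2 else 0)
          + (R ^ 2)⁻¹ * (2 * (‖k‖ ^ 2 * ‖a i k‖ ^ 2) + 2 * (‖k‖ ^ 2 * ‖a j k‖ ^ 2)) := by
        intro k
        split_ifs with hk
        · have h3 : ‖a i k - a j k‖ ≤ 2 * δ := by
            have e : a i k - a j k = (a i k - v k) - (a j k - v k) := by ring
            rw [e]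
            refine (norm_sub_le _ _).trans ?_
            linarith [hi k hk, hj k hk]
          have h4 : ‖a i k - a j k‖ ^ 2 ≤ (2 * δ) ^ 2 := by gcongr
          have : 0 ≤ (R ^ 2)⁻¹ * (2 * (‖k‖ ^ 2 * ‖a i k‖ ^ 2) + 2 * (‖k‖ ^ 2 * ‖a j k‖ ^ 2)) := by
            positivity
          linarith
        · have hk' : R < ‖k‖ := by
            simpa [hs] using hk
          have h3 : ‖a i k - a j k‖ ^ 2 ≤ 2 * ‖a i k‖ ^ 2 + 2 * ‖a j k‖ ^ 2 := by
            have := norm_sub_le (a i k) (a j k)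
            nlinarith [sq_nonneg (‖a i k‖ - ‖a j k‖), norm_nonneg (a i k - a j k)]
          rw [zero_add, inv_mul_eq_div, le_div_iff₀ (by positivity)]
          calc ‖a i k - a j k‖ ^ 2 * R ^ 2
              ≤ (2 * ‖a i k‖ ^ 2 + 2 * ‖a j k‖ ^ 2) * ‖k‖ ^ 2 := by gcongr
            _ = _ := by ring
      calc ∑ k ∈ S, ‖a i k - a j k‖ ^ 2
          ≤ ∑ k ∈ S, ((if k ∈ s then (2 * δ) ^ 2 else 0)
            + (R ^ 2)⁻¹ * (2 * (‖k‖ ^ 2 * ‖a i k‖ ^ 2) + 2 * (‖k‖ ^ 2 * ‖a j k‖ ^ 2))) :=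
            Finset.sum_le_sum fun k _ => hpt k
        _ = ∑ k ∈ S, (if k ∈ s then (2 * δ) ^ 2 else 0)
            + (R ^ 2)⁻¹ * (2 * ∑ k ∈ S, ‖k‖ ^ 2 * ‖a i k‖ ^ 2
              + 2 * ∑ k ∈ S, ‖k‖ ^ 2 * ‖a j k‖ ^ 2) := by
            rw [Finset.sum_add_distrib, ← Finset.mul_sum, Finset.sum_add_distrib,
              ← Finset.mul_sum, ← Finset.mul_sum]
        _ ≤ _ := by
          refine add_le_add ?_ ?_
          · rw [← Finset.sum_filter, Finset.sum_const, nsmul_eq_mul]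
            gcongr
            intro k hk
            exact (Finset.mem_filter.1 hk).2
          · gcongr
            linarith [hw i S, hw j S]
    have h5 : K * ‖F i - F j‖ ^ 2 < K * ε ^ 2 := by linarith
    have h6 : ‖F i - F j‖ ^ 2 < ε ^ 2 := lt_of_mul_lt_mul_left h5 hK.le
    rw [dist_eq_norm]
    exact lt_of_pow_lt_pow_left₀ 2 hε.le h6
  obtain ⟨G, hG⟩ := CompleteSpace.complete hcauchy
  refine ⟨G, Lp.memLp G, ?_⟩
  have hG' : Tendsto F l (𝓝 G) := hG
  have h7 : Tendsto (fun j => ‖F j - G‖ ^ 2) l (𝓝 0) := by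
    have := (tendsto_iff_norm_sub_tendsto_zero.1 hG').pow 2
    simpa using this
  refine h7.congr fun j => ?_
  have h8 : F j - G = ((hfm j).sub (Lp.memLp G)).toLp := by
    rw [MemLp.toLp_sub (hfm j) (Lp.memLp G), Lp.toLp_coeFn]
  rw [h8, hnorm]
  rfl

variable (b) in
/-- The Sobolev embedding of `H²` in the bounded functions. -/
theorem exists_sq_le_of_weakDeriv : ∃ M : ℝ, 0 < M ∧ ∀ f fx fy fxx fyy : ℂ → ℝ,
    HasWeakDeriv b 1 f fx → HasWeakDeriv b Complex.I f fy →
    HasWeakDeriv b 1 fx fxx → HasWeakDeriv b Complex.I fy fyy →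
    ∀ᵐ z ∂(area b), f z ^ 2 ≤ M * (∫ z, f z ^ 2 ∂(area b) + ∫ z, fxx z ^ 2 ∂(area b)
      + ∫ z, fyy z ^ 2 ∂(area b)) := by
  obtain ⟨K, hK, hP⟩ := parseval_real (b := b)
  obtain ⟨c, hc0, hc⟩ := exists_le_phase_sq b
  set A := (area b).real Set.univ with hA
  have hA0 : 0 < A := area_real_pos
  set W := ∑' k : Fin 2 → ℤ, ((1 + ‖k‖) ^ 3)⁻¹ with hW
  have hW0 : 0 ≤ W := tsum_nonneg fun k => by positivity
  refine ⟨A⁻¹ ^ 2 * (W * ((12 + 12 * c⁻¹ ^ 2) * K)) + 1, by positivity, ?_⟩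
  intro f fx fy fxx fyy hx hy hxx hyy
  set N := ∫ z, f z ^ 2 ∂(area b) + ∫ z, fxx z ^ 2 ∂(area b) + ∫ z, fyy z ^ 2 ∂(area b) with hN
  have hsq : ∀ g : ℂ → ℝ, 0 ≤ ∫ z, g z ^ 2 ∂(area b) := fun g =>
    integral_nonneg fun z => sq_nonneg _
  have hN0 : 0 ≤ N := by
    have := hsq f
    have := hsq fxx
    have := hsq fyy
    positivity
  set a : (Fin 2 → ℤ) → ℂ := fun k => fcoeff b k (fun z => (f z : ℂ)) with ha
  set p : (Fin 2 → ℤ) → ℂ := fun k => fcoeff b k (fun z => (fxx z : ℂ)) with hp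
  set q : (Fin 2 → ℤ) → ℂ := fun k => fcoeff b k (fun z => (fyy z : ℂ)) with hq
  have hpt : ∀ k, (1 + ‖k‖) ^ 2 * ‖a k‖ ≤ 2 * ‖a k‖ + 2 * c⁻¹ * (‖p k‖ + ‖q k‖) := by
    intro k
    have e : p k + q k = -((phase b k 1 ^ 2 + phase b k Complex.I ^ 2 : ℝ) : ℂ) * a k := by
      rw [hp, hq, ha]
      simp only
      rw [hxx.fcoeff_eq, hyy.fcoeff_eq, hx.fcoeff_eq, hy.fcoeff_eq]
      push_cast
      linear_combination ((phase b k 1 : ℂ) ^ 2 + (phase b k Complex.I : ℂ) ^ 2)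
        * fcoeff b k (fun z => (f z : ℂ)) * Complex.I_sq
    have e2 : ‖p k + q k‖ = (phase b k 1 ^ 2 + phase b k Complex.I ^ 2) * ‖a k‖ := by
      rw [e, norm_mul, norm_neg, Complex.norm_of_nonneg (by positivity)]
    have h1 : ‖k‖ ^ 2 ≤ c⁻¹ * (phase b k 1 ^ 2 + phase b k Complex.I ^ 2) := by
      rw [inv_mul_eq_div, le_div_iff₀ hc0, mul_comm]
      exact hc k
    calc (1 + ‖k‖) ^ 2 * ‖a k‖ ≤ (2 + 2 * ‖k‖ ^ 2) * ‖a k‖ := by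
          gcongr
          nlinarith [sq_nonneg (1 - ‖k‖)]
      _ ≤ (2 + 2 * (c⁻¹ * (phase b k 1 ^ 2 + phase b k Complex.I ^ 2))) * ‖a k‖ := by gcongr
      _ = 2 * ‖a k‖ + 2 * c⁻¹ * ‖p k + q k‖ := by rw [e2]; ring
      _ ≤ _ := by
        gcongr
        exact norm_add_le _ _
  have hS : ∀ S : Finset (Fin 2 → ℤ), ∑ k ∈ S, ‖a k‖
      ≤ Real.sqrt (W * ((12 + 12 * c⁻¹ ^ 2) * K * N)) := by
    intro S
    refine Real.le_sqrt_of_sq_le ?_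
    have h1 := Finset.sum_mul_sq_le_sq_mul_sq S (fun k : Fin 2 → ℤ => ((1 + ‖k‖) ^ 2)⁻¹)
      (fun k => (1 + ‖k‖) ^ 2 * ‖a k‖)
    have h2 : ∀ k : Fin 2 → ℤ, ((1 + ‖k‖) ^ 2)⁻¹ * ((1 + ‖k‖) ^ 2 * ‖a k‖) = ‖a k‖ := by
      intro k
      have : (1 + ‖k‖) ≠ 0 := by positivity
      field_simp
    simp only [h2] at h1
    refine h1.trans (mul_le_mul ?_ ?_ (Finset.sum_nonneg fun k _ => sq_nonneg _) hW0)
    · refine le_trans (Finset.sum_le_sum fun k _ => ?_)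
        (summable_one_add_norm_pow.sum_le_tsum S fun k _ => by positivity)
      rw [inv_pow, ← pow_mul]
      refine inv_anti₀ (by positivity) (pow_le_pow_right₀ ?_ (by norm_num))
      linarith [norm_nonneg k]
    · calc ∑ k ∈ S, ((1 + ‖k‖) ^ 2 * ‖a k‖) ^ 2
          ≤ ∑ k ∈ S, (12 + 12 * c⁻¹ ^ 2) * (‖a k‖ ^ 2 + ‖p k‖ ^ 2 + ‖q k‖ ^ 2) := by
            refine Finset.sum_le_sum fun k _ => ?_
            calc ((1 + ‖k‖) ^ 2 * ‖a k‖) ^ 2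
                ≤ (2 * ‖a k‖ + 2 * c⁻¹ * (‖p k‖ + ‖q k‖)) ^ 2 := by
                  gcongr
                  exact hpt k
              _ ≤ 12 * (‖a k‖ ^ 2 + c⁻¹ ^ 2 * ‖p k‖ ^ 2 + c⁻¹ ^ 2 * ‖q k‖ ^ 2) := by
                  nlinarith [sq_nonneg (‖a k‖ - c⁻¹ * ‖p k‖), sq_nonneg (‖a k‖ - c⁻¹ * ‖q k‖),
                    sq_nonneg (c⁻¹ * ‖p k‖ - c⁻¹ * ‖q k‖)]
              _ ≤ _ := by
                have h0 : 0 ≤ c⁻¹ ^ 2 * ‖a k‖ ^ 2 := by positivity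
                nlinarith [sq_nonneg ‖p k‖, sq_nonneg ‖q k‖]
        _ ≤ _ := by
          rw [← Finset.mul_sum, mul_assoc]
          gcongr
          have h3 := ((hP _ hx.1).add (hP _ hxx.2)).add (hP _ hyy.2)
          have h4 := sum_le_hasSum S (fun _ _ => by positivity) h3
          refine h4.trans (le_of_eq ?_)
          rw [hN]
          ring
  have hsm : Summable fun k => ‖a k‖ := summable_of_sum_le (fun k => norm_nonneg _) hS
  have hts := Real.tsum_le_of_sum_le (fun k => norm_nonneg _) hS
  filter_upwards [ae_eq_tsum_fcoeff (memLp_ofReal hx.1) hsm] with z hz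
  have h5 : |f z| ≤ A⁻¹ * Real.sqrt (W * ((12 + 12 * c⁻¹ ^ 2) * K * N)) := by
    have h6 := tsum_of_norm_bounded (f := fun k => ((A : ℝ) : ℂ)⁻¹ * a k * chr b k z)
      (hsm.mul_left A⁻¹).hasSum (fun k => by
        rw [norm_mul, norm_mul, norm_chr, mul_one, norm_inv, Complex.norm_of_nonneg hA0.le])
    rw [← hz, Complex.norm_real, tsum_mul_left] at h6
    exact h6.trans (by gcongr)
  calc f z ^ 2 = |f z| ^ 2 := (sq_abs _).symm
    _ ≤ (A⁻¹ * Real.sqrt (W * ((12 + 12 * c⁻¹ ^ 2) * K * N))) ^ 2 := by gcongr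
    _ = A⁻¹ ^ 2 * (W * ((12 + 12 * c⁻¹ ^ 2) * K)) * N := by
      rw [mul_pow, Real.sq_sqrt (by positivity)]
      ring
    _ ≤ _ := by
      gcongr
      linarith

end SobolevEmbeddings

/-! ### The pointwise identity for the form density -/

section VectorAlgebra

theorem inner_eq_sum (u v : R3) : inner ℝ u v = u 0 * v 0 + u 1 * v 1 + u 2 * v 2 := by
  simp [PiLp.inner_apply, Fin.sum_univ_three, mul_comm]

theorem norm_sq_eq_sum (u : R3) : ‖u‖ ^ 2 = u 0 ^ 2 + u 1 ^ 2 + u 2 ^ 2 := by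
  rw [EuclideanSpace.norm_sq_eq]
  simp [Fin.sum_univ_three]

theorem cross_zero (u v : R3) : cross u v 0 = u 1 * v 2 - u 2 * v 1 := by
  simp [cross, crossProduct]

theorem cross_one (u v : R3) : cross u v 1 = u 2 * v 0 - u 0 * v 2 := by
  simp [cross, crossProduct]

theorem cross_two (u v : R3) : cross u v 2 = u 0 * v 1 - u 1 * v 0 := by
  simp [cross, crossProduct]

/-- The integrand of the quadratic form `Q₁ + ∫ (4 |∇φ|² + 1) (φ · Y)²`, where `p`, `a`, `c` stand
for `φ`, `φ_x`, `φ_y` and `Y`, `X`, `W` for `Y`, `Y_x`, `Y_y`. With the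
weight `4 |∇φ|²` the density is a sum of squares up to divergences, and the extra `1` leaves room for a
term `(φ · Y)²`. -/
def formDensity (p a c Y X W : R3) : ℝ :=
  ‖X‖ ^ 2 + ‖W‖ ^ 2 - (‖a‖ ^ 2 + ‖c‖ ^ 2) * ‖Y‖ ^ 2
    - 4 * (inner ℝ a X + inner ℝ c W) * inner ℝ p Y
    + (4 * (‖a‖ ^ 2 + ‖c‖ ^ 2) + 1) * inner ℝ p Y ^ 2

/-- The expression whose integral vanishes because it is the divergence
`∂_x (φ · (Y × Y_y)) + ∂_y (φ · (Y_x × Y))`. -/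
def jacobianTerm (p a c Y X W : R3) : ℝ :=
  2 * inner ℝ p (cross X W) + inner ℝ a (cross Y W) + inner ℝ c (cross X Y)

/-- The expression whose integral vanishes because, for a harmonic map `φ`, it is the divergence
`∇ · ((φ · Y) ∇φ · Y)`. -/
def divergenceTerm (p a c Y X W : R3) : ℝ :=
  inner ℝ p Y * (inner ℝ a X + inner ℝ c W) + inner ℝ p X * inner ℝ a Y
    + inner ℝ p W * inner ℝ c Y + inner ℝ a Y ^ 2 + inner ℝ c Y ^ 2
    - (‖a‖ ^ 2 + ‖c‖ ^ 2) * inner ℝ p Y ^ 2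

/-- Completing the square: up to divergences, the form density is a sum of squares. The vector `A` is
the linearised Cauchy-Riemann operator applied to the tangential part of `Y`. -/
theorem formDensity_eq {p a c : R3} (hp : ‖p‖ = 1) (hpa : inner ℝ p a = 0) (hc : c = cross p a)
    (Y X W : R3) :
    formDensity p a c Y X W =
      ‖W - cross p X - cross Y a + inner ℝ p Y • c - (inner ℝ c Y + inner ℝ p W) • p‖ ^ 2
        + (inner ℝ a Y + inner ℝ p X) ^ 2 + (inner ℝ c Y + inner ℝ p W) ^ 2 + inner ℝ p Y ^ 2
        + jacobianTerm p a c Y X W - 3 * divergenceTerm p a c Y X W := by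
  have hp2 : p 0 ^ 2 + p 1 ^ 2 + p 2 ^ 2 = 1 := by rw [← norm_sq_eq_sum, hp, one_pow]
  have hpa' : p 0 * a 0 + p 1 * a 1 + p 2 * a 2 = 0 := by rw [← inner_eq_sum, hpa]
  have hc0 : c 0 = p 1 * a 2 - p 2 * a 1 := by rw [hc, cross_zero]
  have hc1 : c 1 = p 2 * a 0 - p 0 * a 2 := by rw [hc, cross_one]
  have hc2 : c 2 = p 0 * a 1 - p 1 * a 0 := by rw [hc, cross_two]
  simp only [formDensity, jacobianTerm, divergenceTerm, norm_sq_eq_sum, inner_eq_sum,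
    PiLp.add_apply, PiLp.sub_apply, PiLp.smul_apply, smul_eq_mul, cross_zero, cross_one, cross_two]
  generalize Y 0 = y0, Y 1 = y1, Y 2 = y2, X 0 = x0, X 1 = x1, X 2 = x2, W 0 = w0, W 1 = w1,
    W 2 = w2, a 0 = a0, a 1 = a1, a 2 = a2, c 0 = c0, c 1 = c1, c 2 = c2, p 0 = p0, p 1 = p1,
    p 2 = p2 at *
  clear hc hpa hp
  set N := p0 * y0 + p1 * y1 + p2 * y2 with hN
  set u := a0 * y0 + a1 * y1 + a2 * y2 with hu
  set w := c0 * y0 + c1 * y1 + c2 * y2 with hw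
  set s := p0 * x0 + p1 * x1 + p2 * x2 with hs
  set r := p0 * w0 + p1 * w1 + p2 * w2 with hr
  set α := a0 ^ 2 + a1 ^ 2 + a2 ^ 2 with hα
  have hcc : c0 ^ 2 + c1 ^ 2 + c2 ^ 2 = α := by
    rw [hc0, hc1, hc2, hα]
    linear_combination (a0 ^ 2 + a1 ^ 2 + a2 ^ 2) * hp2
      - (p0 * a0 + p1 * a1 + p2 * a2) * hpa'
  have hpc : p0 * c0 + p1 * c1 + p2 * c2 = 0 := by
    rw [hc0, hc1, hc2]
    ring
  -- `a = c × p`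
  have ha0 : a0 = c1 * p2 - c2 * p1 := by
    rw [hc1, hc2]
    linear_combination (-a0) * hp2 + p0 * hpa'
  have ha1 : a1 = c2 * p0 - c0 * p2 := by
    rw [hc2, hc0]
    linear_combination (-a1) * hp2 + p1 * hpa'
  have ha2 : a2 = c0 * p1 - c1 * p0 := by
    rw [hc0, hc1]
    linear_combination (-a2) * hp2 + p2 * hpa'
  have e1 : (p1 * x2 - p2 * x1) ^ 2 + (p2 * x0 - p0 * x2) ^ 2 + (p0 * x1 - p1 * x0) ^ 2
      = x0 ^ 2 + x1 ^ 2 + x2 ^ 2 - s ^ 2 := by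
    rw [hs]
    linear_combination (x0 ^ 2 + x1 ^ 2 + x2 ^ 2) * hp2
  have e2 : (y1 * a2 - y2 * a1) ^ 2 + (y2 * a0 - y0 * a2) ^ 2 + (y0 * a1 - y1 * a0) ^ 2
      = (y0 ^ 2 + y1 ^ 2 + y2 ^ 2) * α - u ^ 2 := by
    rw [hα, hu]
    ring
  have e3 : (p1 * x2 - p2 * x1) * (y1 * a2 - y2 * a1) + (p2 * x0 - p0 * x2) * (y2 * a0 - y0 * a2)
      + (p0 * x1 - p1 * x0) * (y0 * a1 - y1 * a0) = N * (a0 * x0 + a1 * x1 + a2 * x2) := by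
    rw [hN]
    linear_combination (-(x0 * y0 + x1 * y1 + x2 * y2)) * hpa'
  have e4 : (p1 * x2 - p2 * x1) * c0 + (p2 * x0 - p0 * x2) * c1 + (p0 * x1 - p1 * x0) * c2
      = a0 * x0 + a1 * x1 + a2 * x2 := by
    rw [ha0, ha1, ha2]
    ring
  have e5 : (y1 * a2 - y2 * a1) * c0 + (y2 * a0 - y0 * a2) * c1 + (y0 * a1 - y1 * a0) * c2
      = N * α := by
    rw [hc0, hc1, hc2, hN, hα]
    linear_combination (-(a0 * y0 + a1 * y1 + a2 * y2)) * hpa'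
  have e6 : (y1 * a2 - y2 * a1) * p0 + (y2 * a0 - y0 * a2) * p1 + (y0 * a1 - y1 * a0) * p2
      = -w := by
    rw [hw, hc0, hc1, hc2]
    ring
  have e7 : a0 * (y1 * w2 - y2 * w1) + a1 * (y2 * w0 - y0 * w2) + a2 * (y0 * w1 - y1 * w0)
      = r * w - N * (c0 * w0 + c1 * w1 + c2 * w2) := by
    rw [ha0, ha1, ha2, hr, hw, hN]
    ring
  have e8 : c0 * (x1 * y2 - x2 * y1) + c1 * (x2 * y0 - x0 * y2) + c2 * (x0 * y1 - x1 * y0)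
      = s * u - N * (a0 * x0 + a1 * x1 + a2 * x2) := by
    rw [hc0, hc1, hc2, hs, hu, hN]
    ring
  have e9 : α * (y0 ^ 2 + y1 ^ 2 + y2 ^ 2) = α * N ^ 2 + u ^ 2 + w ^ 2 := by
    have e9' : (p1 * y2 - p2 * y1) ^ 2 + (p2 * y0 - p0 * y2) ^ 2 + (p0 * y1 - p1 * y0) ^ 2
        = y0 ^ 2 + y1 ^ 2 + y2 ^ 2 - N ^ 2 := by
      rw [hN]
      linear_combination (y0 ^ 2 + y1 ^ 2 + y2 ^ 2) * hp2
    have e10 : w = -(a0 * (p1 * y2 - p2 * y1) + a1 * (p2 * y0 - p0 * y2)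
        + a2 * (p0 * y1 - p1 * y0)) := by
      rw [hw, hc0, hc1, hc2]
      ring
    have e11 : α * ((p1 * y2 - p2 * y1) ^ 2 + (p2 * y0 - p0 * y2) ^ 2 + (p0 * y1 - p1 * y0) ^ 2)
        = w ^ 2 + u ^ 2 := by
      rw [e10, hα, hu]
      linear_combination (-(2 * (a0 * y0 + a1 * y1 + a2 * y2) * (p0 * y0 + p1 * y1 + p2 * y2))
        + (y0 ^ 2 + y1 ^ 2 + y2 ^ 2) * (p0 * a0 + p1 * a1 + p2 * a2)) * hpa'
        + (a0 * y0 + a1 * y1 + a2 * y2) ^ 2 * hp2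
    linear_combination e11 - α * e9'
  rw [hcc]
  clear_value N u w s r α
  linear_combination -e1 - e2 - N ^ 2 * hcc - (w + r) ^ 2 * hp2 - 2 * e3 + 2 * N * e4 + 2 * N * e5
    - 2 * (w + r) * e6 + 2 * N * (w + r) * hpc - 3 * e7 - e8 - 3 * e9 - 2 * (w + r) * hr

end VectorAlgebra

/-! ### Holomorphic maps and positivity of the form -/

section HolomorphicMaps

variable {b : Module.Basis (Fin 2) ℝ ℂ} {n : ℕ} {φ : ℂ → R3}

theorem SmoothPeriodic.comp {f : ℂ → R3} (hf : SmoothPeriodic b f) (i : Fin 3) :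
    SmoothPeriodic b (fun z => f z i) :=
  hf.clm_comp (EuclideanSpace.proj i : R3 →L[ℝ] ℝ)

theorem fderiv_comp_apply {f : ℂ → R3} (hf : Differentiable ℝ f) (i : Fin 3) (z v : ℂ) :
    fderiv ℝ (fun z => f z i) z v = fderiv ℝ f z v i := by
  have := (EuclideanSpace.proj i : R3 →L[ℝ] ℝ).hasFDerivAt.comp z (hf z).hasFDerivAt
  rw [show (fun z => f z i) = (EuclideanSpace.proj i : R3 →L[ℝ] ℝ) ∘ f from rfl, this.fderiv]
  rfl

theorem SmoothPeriodic.dx {f : ℂ → R3} (hf : SmoothPeriodic b f) : SmoothPeriodic b (dx f) :=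
  hf.fderiv 1

theorem SmoothPeriodic.dy {f : ℂ → R3} (hf : SmoothPeriodic b f) : SmoothPeriodic b (dy f) :=
  hf.fderiv Complex.I

theorem SmoothPeriodic.inner {f g : ℂ → R3} (hf : SmoothPeriodic b f) (hg : SmoothPeriodic b g) :
    SmoothPeriodic b (fun z => inner ℝ (f z) (g z)) :=
  ⟨fun i z => by rw [hf.periodic i z, hg.periodic i z], hf.contDiff.inner ℝ hg.contDiff⟩

theorem SmoothPeriodic.norm_sq {f : ℂ → R3} (hf : SmoothPeriodic b f) :
    SmoothPeriodic b (fun z => ‖f z‖ ^ 2) :=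
  ⟨fun i z => by rw [hf.periodic i z], hf.contDiff.norm_sq ℝ⟩

theorem fderiv_cross {f g : ℂ → R3} (hf : SmoothPeriodic b f) (hg : SmoothPeriodic b g) (z v : ℂ)
    {h : ℂ → R3} (hh : SmoothPeriodic b h) (hfg : ∀ z, h z = cross (f z) (g z)) :
    fderiv ℝ h z v = cross (fderiv ℝ f z v) (g z) + cross (f z) (fderiv ℝ g z v) := by
  have key : ∀ i j, fderiv ℝ (fun z => f z i * g z j) z v
      = fderiv ℝ f z v i * g z j + f z i * fderiv ℝ g z v j := by
    intro i j
    have := ((hf.comp i).differentiable z).hasFDerivAt.mul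
      ((hg.comp j).differentiable z).hasFDerivAt
    rw [show (fun z => f z i * g z j) = (fun z => f z i) * (fun z => g z j) from rfl, this.fderiv]
    simp only [add_apply, smul_apply, smul_eq_mul,
      fderiv_comp_apply hf.differentiable, fderiv_comp_apply hg.differentiable]
    ring
  have key2 : ∀ i j k l, fderiv ℝ (fun z => f z i * g z j - f z k * g z l) z v
      = (fderiv ℝ f z v i * g z j + f z i * fderiv ℝ g z v j)
        - (fderiv ℝ f z v k * g z l + f z k * fderiv ℝ g z v l) := by
    intro i j k l
    rw [← key, ← key, fderiv_fun_sub (((hf.comp i).mul (hg.comp j)).differentiable z)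
      (((hf.comp k).mul (hg.comp l)).differentiable z)]
    rfl
  ext i
  rw [← fderiv_comp_apply hh.differentiable]
  simp only [hfg]
  fin_cases i
  · simp only [Fin.zero_eta, cross_zero, key2, PiLp.add_apply]
    ring
  · simp only [Fin.mk_one, cross_one, key2, PiLp.add_apply]
    ring
  · simp only [Fin.reduceFinMk, cross_two, key2, PiLp.add_apply]
    ring

/-- Holomorphic maps from the torus to the sphere, of any degree. -/
structure IsHolomorphicMap (b : Module.Basis (Fin 2) ℝ ℂ) (φ : ℂ → R3) : Prop where
  smooth : SmoothPeriodic b φ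
  norm_eq : ∀ z, ‖φ z‖ = 1
  dy_eq : ∀ z, dy φ z = cross (φ z) (dx φ z)

theorem isHolomorphicMap_of_mem (h : φ ∈ moduliSpace b n) : IsHolomorphicMap b φ :=
  ⟨⟨h.1, h.2.1⟩, h.2.2.1, h.2.2.2.1⟩

namespace IsHolomorphicMap

theorem inner_fderiv (h : IsHolomorphicMap b φ) (z v : ℂ) :
    inner ℝ (φ z) (fderiv ℝ φ z v) = 0 := by
  have h1 := (h.smooth.differentiable z).hasFDerivAt.norm_sq
  have h2 : (fun z => ‖φ z‖ ^ 2) = fun _ => (1 : ℝ) := funext fun z => by rw [h.norm_eq, one_pow]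
  rw [h2] at h1
  have h3 := congrArg (fun L => L v) (h1.unique (hasFDerivAt_const (1 : ℝ) z))
  simpa using h3

theorem inner_dx (h : IsHolomorphicMap b φ) (z : ℂ) : inner ℝ (φ z) (dx φ z) = 0 :=
  h.inner_fderiv z 1

/-- Holomorphic maps are harmonic. -/
theorem laplace_eq (h : IsHolomorphicMap b φ) (z : ℂ) :
    dx (dx φ) z + dy (dy φ) z = -((‖dx φ z‖ ^ 2 + ‖dy φ z‖ ^ 2) • φ z) := by
  have hpa := h.inner_dx z
  have hdx : ∀ z, dx φ z = cross (dy φ z) (φ z) := by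
    intro z
    have hp2 : φ z 0 ^ 2 + φ z 1 ^ 2 + φ z 2 ^ 2 = 1 := by
      rw [← norm_sq_eq_sum, h.norm_eq, one_pow]
    have hpa := h.inner_dx z
    rw [inner_eq_sum] at hpa
    rw [h.dy_eq]
    ext i
    fin_cases i
    · simp only [Fin.zero_eta, cross_zero, cross_one, cross_two]
      linear_combination (-dx φ z 0) * hp2 + φ z 0 * hpa
    · simp only [Fin.mk_one, cross_zero, cross_one, cross_two]
      linear_combination (-dx φ z 1) * hp2 + φ z 1 * hpa
    · simp only [Fin.reduceFinMk, cross_zero, cross_one, cross_two]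
      linear_combination (-dx φ z 2) * hp2 + φ z 2 * hpa
  have hyy : dy (dy φ) z = cross (dy φ z) (dx φ z) + cross (φ z) (dy (dx φ) z) :=
    fderiv_cross h.smooth h.smooth.dx z Complex.I h.smooth.dy h.dy_eq
  have hxx : dx (dx φ) z = cross (dx (dy φ) z) (φ z) + cross (dy φ z) (dx φ z) :=
    fderiv_cross h.smooth.dy h.smooth z 1 h.smooth.dx hdx
  have hsymm : dx (dy φ) z = dy (dx φ) z := by
    have h1 : IsSymmSndFDerivAt ℝ φ z :=
      h.smooth.contDiff.contDiffAt.isSymmSndFDerivAt (by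
        simp only [minSmoothness_of_isRCLikeNormedField]
        exact WithTop.coe_le_coe.2 (le_top : (2 : ℕ∞) ≤ ⊤))
    have h2 : ∀ v w, fderiv ℝ (fun z => fderiv ℝ φ z v) z w = fderiv ℝ (fderiv ℝ φ) z w v := by
      intro v w
      have h3 : DifferentiableAt ℝ (fderiv ℝ φ) z :=
        ((h.smooth.contDiff.fderiv_right (m := (⊤ : ℕ∞)) (by simp)).differentiable (by simp)) z
      rw [fderiv_clm_apply h3 (differentiableAt_const v)]
      simp
    exact (h2 Complex.I 1).trans ((h1.eq 1 Complex.I).trans (h2 1 Complex.I).symm)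
  have hp2 : φ z 0 ^ 2 + φ z 1 ^ 2 + φ z 2 ^ 2 = 1 := by
    rw [← norm_sq_eq_sum, h.norm_eq, one_pow]
  have hc := h.dy_eq z
  rw [hxx, hyy, hsymm]
  rw [inner_eq_sum] at hpa
  have hc0 : dy φ z 0 = φ z 1 * dx φ z 2 - φ z 2 * dx φ z 1 := by rw [hc, cross_zero]
  have hc1 : dy φ z 1 = φ z 2 * dx φ z 0 - φ z 0 * dx φ z 2 := by rw [hc, cross_one]
  have hc2 : dy φ z 2 = φ z 0 * dx φ z 1 - φ z 1 * dx φ z 0 := by rw [hc, cross_two]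
  have hcc : dy φ z 0 ^ 2 + dy φ z 1 ^ 2 + dy φ z 2 ^ 2
      = dx φ z 0 ^ 2 + dx φ z 1 ^ 2 + dx φ z 2 ^ 2 := by
    rw [hc0, hc1, hc2]
    linear_combination (dx φ z 0 ^ 2 + dx φ z 1 ^ 2 + dx φ z 2 ^ 2) * hp2
      - (φ z 0 * dx φ z 0 + φ z 1 * dx φ z 1 + φ z 2 * dx φ z 2) * hpa
  ext i
  fin_cases i
  · simp only [Fin.zero_eta, PiLp.add_apply, PiLp.neg_apply, PiLp.smul_apply, smul_eq_mul,
      cross_zero, norm_sq_eq_sum]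
    rw [hcc, hc1, hc2]
    linear_combination (2 * dx φ z 0) * hpa
  · simp only [Fin.mk_one, PiLp.add_apply, PiLp.neg_apply, PiLp.smul_apply, smul_eq_mul,
      cross_one, norm_sq_eq_sum]
    rw [hcc, hc0, hc2]
    linear_combination (2 * dx φ z 1) * hpa
  · simp only [Fin.reduceFinMk, PiLp.add_apply, PiLp.neg_apply, PiLp.smul_apply, smul_eq_mul,
      cross_two, norm_sq_eq_sum]
    rw [hcc, hc0, hc1]
    linear_combination (2 * dx φ z 2) * hpa

end IsHolomorphicMap

end HolomorphicMaps

section Positivity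

variable {b : Module.Basis (Fin 2) ℝ ℂ} {φ Y X W Y' X' W' : ℂ → R3}

/-- `X` and `W` are the weak derivatives of `Y` in `x` and `y`, and the mixed second weak derivatives
exist. The latter make the Jacobian of two components of `Y` a divergence in the weak sense. -/
structure HasWeakGradient (b : Module.Basis (Fin 2) ℝ ℂ) (Y X W : ℂ → R3) : Prop where
  wdx : ∀ i, HasWeakDeriv b 1 (fun z => Y z i) (fun z => X z i)
  wdy : ∀ i, HasWeakDeriv b Complex.I (fun z => Y z i) (fun z => W z i)
  wdxy : ∀ i, ∃ p, HasWeakDeriv b Complex.I (fun z => X z i) p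
  wdyx : ∀ i, ∃ q, HasWeakDeriv b 1 (fun z => W z i) q

namespace HasWeakGradient

theorem add (h : HasWeakGradient b Y X W) (h' : HasWeakGradient b Y' X' W') :
    HasWeakGradient b (fun z => Y z + Y' z) (fun z => X z + X' z) (fun z => W z + W' z) where
  wdx i := (h.wdx i).add (h'.wdx i)
  wdy i := (h.wdy i).add (h'.wdy i)
  wdxy i := by
    obtain ⟨p, hp⟩ := h.wdxy i
    obtain ⟨p', hp'⟩ := h'.wdxy i
    exact ⟨_, hp.add hp'⟩
  wdyx i := by
    obtain ⟨p, hp⟩ := h.wdyx i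
    obtain ⟨p', hp'⟩ := h'.wdyx i
    exact ⟨_, hp.add hp'⟩

theorem const_smul (t : ℝ) (h : HasWeakGradient b Y X W) :
    HasWeakGradient b (fun z => t • Y z) (fun z => t • X z) (fun z => t • W z) where
  wdx i := (h.wdx i).const_mul t
  wdy i := (h.wdy i).const_mul t
  wdxy i := by
    obtain ⟨p, hp⟩ := h.wdxy i
    exact ⟨_, hp.const_mul t⟩
  wdyx i := by
    obtain ⟨p, hp⟩ := h.wdyx i
    exact ⟨_, hp.const_mul t⟩

theorem of_smooth {η : ℂ → R3} (h : SmoothPeriodic b η) :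
    HasWeakGradient b η (dx η) (dy η) where
  wdx i := (HasWeakDeriv.of_smooth (h.comp i)).congr_deriv
    (Eventually.of_forall fun z => fderiv_comp_apply h.differentiable i z 1)
  wdy i := (HasWeakDeriv.of_smooth (h.comp i)).congr_deriv
    (Eventually.of_forall fun z => fderiv_comp_apply h.differentiable i z Complex.I)
  wdxy i := ⟨_, HasWeakDeriv.of_smooth (h.dx.comp i)⟩
  wdyx i := ⟨_, HasWeakDeriv.of_smooth (h.dy.comp i)⟩

theorem memLp_inner {f g : ℂ → R3} (hf : SmoothPeriodic b f)
    (hg : ∀ i, MemLp (fun z => g z i) 2 (area b)) :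
    MemLp (fun z => inner ℝ (f z) (g z)) 2 (area b) := by
  simp only [inner_eq_sum]
  exact (((hf.comp 0).mul_memLp (hg 0)).add ((hf.comp 1).mul_memLp (hg 1))).add
    ((hf.comp 2).mul_memLp (hg 2))

theorem integrable_norm_sq {g : ℂ → R3} (hg : ∀ i, MemLp (fun z => g z i) 2 (area b)) :
    Integrable (fun z => ‖g z‖ ^ 2) (area b) := by
  simp only [norm_sq_eq_sum]
  exact ((hg 0).integrable_sq.add (hg 1).integrable_sq).add (hg 2).integrable_sq

theorem integralZero_jacobianTerm (hφ : SmoothPeriodic b φ) (h : HasWeakGradient b Y X W) :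
    IntegralZero b (fun z => jacobianTerm (φ z) (dx φ z) (dy φ z) (Y z) (X z) (W z)) := by
  have key : ∀ i j k, IntegralZero b (fun z => φ z i * (X z j * W z k - W z j * X z k)
      + dx φ z i * Y z j * W z k - dy φ z i * Y z j * X z k) := by
    intro i j k
    obtain ⟨p, hp⟩ := h.wdxy k
    obtain ⟨q, hq⟩ := h.wdyx k
    refine (HasWeakDeriv.integralZero_jacobian (hφ.comp i) (h.wdx j) (h.wdy j) (h.wdx k) (h.wdy k)
      hp hq).congr (Eventually.of_forall fun z => ?_)
    simp only [fderiv_comp_apply hφ.differentiable]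
    rfl
  refine (((((key 0 1 2).sub (key 0 2 1)).add ((key 1 2 0).sub (key 1 0 2))).add
    ((key 2 0 1).sub (key 2 1 0)))).congr (Eventually.of_forall fun z => ?_)
  simp only [jacobianTerm, inner_eq_sum, cross_zero, cross_one, cross_two]
  ring

theorem integralZero_divergenceTerm (hφ : IsHolomorphicMap b φ) (h : HasWeakGradient b Y X W) :
    IntegralZero b (fun z => divergenceTerm (φ z) (dx φ z) (dy φ z) (Y z) (X z) (W z)) := by
  have key : ∀ (v : ℂ) (Z : ℂ → R3), (∀ i, HasWeakDeriv b v (fun z => Y z i) (fun z => Z z i)) →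
      IntegralZero b (fun z => ∑ i, ∑ j,
        ((fderiv ℝ φ z v i * fderiv ℝ φ z v j
          + φ z i * fderiv ℝ (fun w => fderiv ℝ φ w v) z v j) * Y z j * Y z i
          + φ z i * fderiv ℝ φ z v j * Z z j * Y z i
          + φ z i * fderiv ℝ φ z v j * Y z j * Z z i)) := by
    intro v Z hZ
    refine IntegralZero.sum fun i _ => IntegralZero.sum fun j _ => ?_
    have hs := (hφ.smooth.comp i).mul ((hφ.smooth.fderiv v).comp j)
    refine (HasWeakDeriv.integralZero_smooth_mul_mul hs (hZ j) (hZ i)).congr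
      (Eventually.of_forall fun z => ?_)
    have := ((hφ.smooth.comp i).differentiable z).hasFDerivAt.mul
      (((hφ.smooth.fderiv v).comp j).differentiable z).hasFDerivAt
    beta_reduce
    rw [show (fun z => φ z i * fderiv ℝ φ z v j)
      = (fun z => φ z i) * (fun z => fderiv ℝ φ z v j) from rfl, this.fderiv]
    simp only [add_apply, smul_apply, smul_eq_mul,
      fderiv_comp_apply hφ.smooth.differentiable,
      fderiv_comp_apply (hφ.smooth.fderiv v).differentiable]
    ring
  refine ((key 1 X h.wdx).add (key Complex.I W h.wdy)).congr (Eventually.of_forall fun z => ?_)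
  have hl := hφ.laplace_eq z
  have hl' : ∀ i, dy (dy φ) z i
      = -((‖dx φ z‖ ^ 2 + ‖dy φ z‖ ^ 2) * φ z i)
        - dx (dx φ) z i := by
    intro i
    have := congrArg (fun u : R3 => u i) hl
    simp only [PiLp.add_apply, PiLp.neg_apply, PiLp.smul_apply, smul_eq_mul] at this
    linarith
  have e1 : ∀ j, fderiv ℝ (fun w => fderiv ℝ φ w 1) z 1 j = dx (dx φ) z j :=
    fun _ => rfl
  have e2 : ∀ j, fderiv ℝ (fun w => fderiv ℝ φ w Complex.I) z Complex.I j
      = dy (dy φ) z j := fun _ => rfl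
  have e3 : ∀ j, fderiv ℝ φ z 1 j = dx φ z j := fun _ => rfl
  have e4 : ∀ j, fderiv ℝ φ z Complex.I j = dy φ z j := fun _ => rfl
  simp only [e1, e2, e3, e4, hl', divergenceTerm, inner_eq_sum, Fin.sum_univ_three]
  ring

theorem integrable_formDensity (hφ : SmoothPeriodic b φ) (h : HasWeakGradient b Y X W) :
    Integrable (fun z => formDensity (φ z) (dx φ z) (dy φ z) (Y z) (X z) (W z))
      (area b) := by
  have hY : ∀ i, MemLp (fun z => Y z i) 2 (area b) := fun i => (h.wdx i).1
  have hX : ∀ i, MemLp (fun z => X z i) 2 (area b) := fun i => (h.wdx i).2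
  have hW : ∀ i, MemLp (fun z => W z i) 2 (area b) := fun i => (h.wdy i).2
  have he := hφ.dx.norm_sq.add hφ.dy.norm_sq
  have hN := memLp_inner hφ hY
  unfold formDensity
  refine ((((integrable_norm_sq hX).add (integrable_norm_sq hW)).sub ?_).sub ?_).add ?_
  · simp only [norm_sq_eq_sum (Y _), mul_add]
    have t : ∀ i, Integrable (fun z => (‖dx φ z‖ ^ 2 + ‖dy φ z‖ ^ 2)
        * Y z i ^ 2) (area b) := by
      intro i
      refine (memLp_mul_integrable (he.mul_memLp (hY i)) (hY i)).congr
        (Eventually.of_forall fun z => ?_)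
      beta_reduce
      ring
    exact ((t 0).add (t 1)).add (t 2)
  · refine ((memLp_mul_integrable ((memLp_inner hφ.dx hX).add (memLp_inner hφ.dy hW)) hN).const_mul
      4).congr (Eventually.of_forall fun z => ?_)
    simp only [Pi.add_apply]
    ring
  · refine (memLp_mul_integrable ((((SmoothPeriodic.const (4 : ℝ)).mul he).add
      (SmoothPeriodic.const 1)).mul_memLp hN) hN).congr (Eventually.of_forall fun z => ?_)
    beta_reduce
    ring

/-- Positivity of the second variation: the form is bounded below by `∫ (φ · Y)²`. -/
theorem integral_inner_sq_le (hφ : IsHolomorphicMap b φ) (h : HasWeakGradient b Y X W) :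
    ∫ z, inner ℝ (φ z) (Y z) ^ 2 ∂(area b) ≤
      ∫ z, formDensity (φ z) (dx φ z) (dy φ z) (Y z) (X z) (W z)
        ∂(area b) := by
  have hY : ∀ i, MemLp (fun z => Y z i) 2 (area b) := fun i => (h.wdx i).1
  have hJ := integralZero_jacobianTerm hφ.smooth h
  have hD := (integralZero_divergenceTerm hφ h).const_mul 3
  have hJD := hJ.sub hD
  have hF := integrable_formDensity hφ.smooth h
  have h1 : ∫ z, formDensity (φ z) (dx φ z) (dy φ z) (Y z) (X z) (W z)
        ∂(area b)
      = ∫ z, (formDensity (φ z) (dx φ z) (dy φ z) (Y z) (X z) (W z)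
        - (jacobianTerm (φ z) (dx φ z) (dy φ z) (Y z) (X z) (W z)
        - 3 * divergenceTerm (φ z) (dx φ z) (dy φ z) (Y z) (X z) (W z)))
          ∂(area b) := by
    rw [integral_sub hF hJD.1, hJD.2, sub_zero]
  rw [h1]
  refine integral_mono (memLp_inner hφ.smooth hY).integrable_sq (hF.sub hJD.1) fun z => ?_
  beta_reduce
  rw [formDensity_eq (hφ.norm_eq z) (hφ.inner_dx z) (hφ.dy_eq z)]
  linarith [sq_nonneg ‖W z - cross (φ z) (X z) - cross (Y z) (dx φ z)
    + inner ℝ (φ z) (Y z) • dy φ z - (inner ℝ (dy φ z) (Y z)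
    + inner ℝ (φ z) (W z)) • φ z‖, sq_nonneg (inner ℝ (dx φ z) (Y z)
    + inner ℝ (φ z) (X z)), sq_nonneg (inner ℝ (dy φ z) (Y z)
    + inner ℝ (φ z) (W z))]

end HasWeakGradient

end Positivity

/-! ### Smooth families and convergence in `L²` -/

section SmoothFamilies

variable {b : Module.Basis (Fin 2) ℝ ℂ} {E F G : Type*}
  [NormedAddCommGroup E] [NormedSpace ℝ E] [NormedAddCommGroup F] [NormedSpace ℝ F]
  [NormedAddCommGroup G] [NormedSpace ℝ G] {U : Set E}

/-- A smooth family, parametrised by `U`, of smooth functions on the torus. -/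
structure SmoothFamily (b : Module.Basis (Fin 2) ℝ ℂ) (U : Set E) (h : E → ℂ → F) : Prop where
  contDiffOn : ContDiffOn ℝ (⊤ : ℕ∞) (fun p : E × ℂ => h p.1 p.2) (U ×ˢ Set.univ)
  periodic : ∀ q ∈ U, Periodic b (h q)

namespace SmoothFamily

variable {h : E → ℂ → F}

theorem smoothPeriodic (hh : SmoothFamily b U h) {q : E} (hq : q ∈ U) :
    SmoothPeriodic b (h q) := by
  refine ⟨hh.periodic q hq, ?_⟩
  rw [← contDiffOn_univ]
  exact hh.contDiffOn.comp (contDiff_prodMk_right q).contDiffOn fun z _ => ⟨hq, Set.mem_univ z⟩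

theorem const {f : ℂ → F} (hf : SmoothPeriodic b f) : SmoothFamily b U (fun _ => f) :=
  ⟨(hf.contDiff.comp contDiff_snd).contDiffOn, fun _ _ => hf.periodic⟩

theorem add {k : E → ℂ → F} (hh : SmoothFamily b U h) (hk : SmoothFamily b U k) :
    SmoothFamily b U (fun q z => h q z + k q z) :=
  ⟨hh.contDiffOn.add hk.contDiffOn, fun q hq i z => by
    rw [hh.periodic q hq i z, hk.periodic q hq i z]⟩

theorem sub {k : E → ℂ → F} (hh : SmoothFamily b U h) (hk : SmoothFamily b U k) :
    SmoothFamily b U (fun q z => h q z - k q z) :=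
  ⟨hh.contDiffOn.sub hk.contDiffOn, fun q hq i z => by
    rw [hh.periodic q hq i z, hk.periodic q hq i z]⟩

theorem neg (hh : SmoothFamily b U h) : SmoothFamily b U (fun q z => -h q z) :=
  ⟨hh.contDiffOn.neg, fun q hq i z => by rw [hh.periodic q hq i z]⟩

theorem smul {a : E → ℂ → ℝ} (ha : SmoothFamily b U a) (hh : SmoothFamily b U h) :
    SmoothFamily b U (fun q z => a q z • h q z) :=
  ⟨ha.contDiffOn.smul hh.contDiffOn, fun q hq i z => by
    rw [hh.periodic q hq i z, ha.periodic q hq i z]⟩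

theorem mul {a c : E → ℂ → ℝ} (ha : SmoothFamily b U a) (hc : SmoothFamily b U c) :
    SmoothFamily b U (fun q z => a q z * c q z) :=
  ha.smul hc

theorem inner {f g : E → ℂ → R3} (hf : SmoothFamily b U f) (hg : SmoothFamily b U g) :
    SmoothFamily b U (fun q z => inner ℝ (f q z) (g q z)) :=
  ⟨hf.contDiffOn.inner ℝ hg.contDiffOn, fun q hq i z => by
    rw [hf.periodic q hq i z, hg.periodic q hq i z]⟩

theorem norm_sq {f : E → ℂ → R3} (hf : SmoothFamily b U f) :
    SmoothFamily b U (fun q z => ‖f q z‖ ^ 2) := by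
  simpa only [real_inner_self_eq_norm_sq] using hf.inner hf

theorem comp {f : E → ℂ → R3} (hf : SmoothFamily b U f) (i : Fin 3) :
    SmoothFamily b U (fun q z => f q z i) :=
  ⟨(EuclideanSpace.proj i : R3 →L[ℝ] ℝ).contDiff.comp_contDiffOn hf.contDiffOn, fun q hq j z => by
    rw [hf.periodic q hq j z]⟩

theorem differentiableAt (hU : IsOpen U) (hh : SmoothFamily b U h) {q : E} (hq : q ∈ U) (z : ℂ) :
    DifferentiableAt ℝ (fun p : E × ℂ => h p.1 p.2) (q, z) :=
  (hh.contDiffOn.contDiffAt ((hU.prod isOpen_univ).mem_nhds ⟨hq, Set.mem_univ z⟩)).differentiableAt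
    (by simp)

theorem contDiffOn_fderiv (hU : IsOpen U) (hh : SmoothFamily b U h) (v : E × ℂ) :
    ContDiffOn ℝ (⊤ : ℕ∞) (fun p : E × ℂ => fderiv ℝ (fun p : E × ℂ => h p.1 p.2) p v)
      (U ×ˢ Set.univ) :=
  (hh.contDiffOn.fderiv_of_isOpen (hU.prod isOpen_univ) (by simp)).clm_apply contDiffOn_const

theorem fderiv_right (hU : IsOpen U) (hh : SmoothFamily b U h) (v : ℂ) :
    SmoothFamily b U (fun q z => fderiv ℝ (h q) z v) := by
  refine ⟨(hh.contDiffOn_fderiv hU (0, v)).congr ?_,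
    fun q hq => ((hh.smoothPeriodic hq).fderiv v).periodic⟩
  rintro ⟨q, z⟩ ⟨hq, _⟩
  have h1 := (hh.differentiableAt hU hq z).hasFDerivAt.comp z (hasFDerivAt_prodMk_right q z)
  have h2 : (fun p : E × ℂ => h p.1 p.2) ∘ (fun z => (q, z)) = h q := rfl
  rw [h2] at h1
  simp only
  rw [h1.fderiv]
  simp

theorem fderiv_left (hU : IsOpen U) (hh : SmoothFamily b U h) (w : E) :
    SmoothFamily b U (fun q z => fderiv ℝ (fun p => h p z) q w) := by
  refine ⟨(hh.contDiffOn_fderiv hU (w, 0)).congr ?_, fun q hq i z => ?_⟩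
  · rintro ⟨q, z⟩ ⟨hq, _⟩
    have h1 := HasFDerivAt.comp q (f := fun q => (q, z)) (hh.differentiableAt hU hq z).hasFDerivAt
      (hasFDerivAt_prodMk_left q z)
    have h2 : (fun p : E × ℂ => h p.1 p.2) ∘ (fun q => (q, z)) = fun p => h p z := rfl
    rw [h2] at h1
    simp only
    rw [h1.fderiv]
    simp
  · have : (fun p => h p (z + b i)) =ᶠ[𝓝 q] fun p => h p z := by
      filter_upwards [hU.mem_nhds hq] with p hp
      exact hh.periodic p hp i z
    rw [this.fderiv_eq]

/-- A smooth family is continuous in the parameter, uniformly on the torus. -/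
theorem eventually_norm_sub_lt (hU : IsOpen U) (hh : SmoothFamily b U h) {q₀ : E} (hq₀ : q₀ ∈ U)
    {ε : ℝ} (hε : 0 < ε) : ∀ᶠ q in 𝓝 q₀, ∀ z, ‖h q z - h q₀ z‖ < ε := by
  have h1 : ∀ᶠ q in 𝓝 q₀, ∀ z ∈ cell b, ‖h q z - h q₀ z‖ < ε := by
    refine (isCompact_cell b).eventually_forall_of_forall_eventually fun z _ => ?_
    have hc : ContinuousAt (fun p : E × ℂ => h p.1 p.2) (q₀, z) :=
      (hh.differentiableAt hU hq₀ z).continuousAt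
    have hc2 : ContinuousAt (fun p : E × ℂ => h q₀ p.2) (q₀, z) :=
      ((hh.smoothPeriodic hq₀).continuous.comp continuous_snd).continuousAt
    have h3 := (hc.sub hc2).norm
    refine h3.eventually_lt_const ?_
    simpa using hε
  filter_upwards [h1, hU.mem_nhds hq₀] with q hq hqU z
  exact Periodic.forall_of_cell (b := b) (f := fun z => h q z - h q₀ z)
    (P := fun x => ‖x‖ < ε) (fun i z => by
      beta_reduce
      rw [hh.periodic q hqU i z, hh.periodic q₀ hq₀ i z]) hq z

theorem eventually_bound (hU : IsOpen U) (hh : SmoothFamily b U h) {q₀ : E} (hq₀ : q₀ ∈ U) :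
    ∃ C, 0 ≤ C ∧ ∀ᶠ q in 𝓝 q₀, ∀ z, ‖h q z‖ ≤ C := by
  obtain ⟨C, hC0, hC⟩ := (hh.smoothPeriodic hq₀).exists_bound
  refine ⟨C + 1, by positivity, ?_⟩
  filter_upwards [hh.eventually_norm_sub_lt hU hq₀ one_pos] with q hq z
  have := norm_add_le (h q z - h q₀ z) (h q₀ z)
  rw [sub_add_cancel] at this
  linarith [hq z, hC z]

end SmoothFamily

/-- Convergence in `L²` of scalar functions on the torus. -/
structure L2Tendsto {ι : Type*} (b : Module.Basis (Fin 2) ℝ ℂ) (l : Filter ι) (f : ι → ℂ → ℝ)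
    (g : ℂ → ℝ) : Prop where
  memLp : ∀ j, MemLp (f j) 2 (area b)
  memLp_lim : MemLp g 2 (area b)
  tendsto : Tendsto (fun j => ∫ z, (f j z - g z) ^ 2 ∂(area b)) l (𝓝 0)

theorem inner_toLp {f g : ℂ → ℝ} (hf : MemLp f 2 (area b)) (hg : MemLp g 2 (area b)) :
    inner ℝ hf.toLp hg.toLp = ∫ z, f z * g z ∂(area b) := by
  rw [L2.inner_def]
  refine integral_congr_ae ?_
  filter_upwards [hf.coeFn_toLp, hg.coeFn_toLp] with z h1 h2
  rw [h1, h2]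
  simp [mul_comm]

namespace L2Tendsto

variable {ι : Type*} {l : Filter ι} {f f' : ι → ℂ → ℝ} {g g' : ℂ → ℝ}

theorem tendsto_toLp (h : L2Tendsto b l f g) :
    Tendsto (fun j => (h.memLp j).toLp) l (𝓝 h.memLp_lim.toLp) := by
  rw [tendsto_iff_norm_sub_tendsto_zero]
  have h1 : ∀ j, ‖(h.memLp j).toLp - h.memLp_lim.toLp‖
      = Real.sqrt (∫ z, (f j z - g z) ^ 2 ∂(area b)) := by
    intro j
    rw [← MemLp.toLp_sub, norm_eq_sqrt_real_inner, inner_toLp]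
    simp only [Pi.sub_apply, sq]
  simp only [h1]
  have h2 := (Real.continuous_sqrt.tendsto 0).comp h.tendsto
  rw [Real.sqrt_zero] at h2
  exact h2

theorem tendsto_integral_mul (h : L2Tendsto b l f g) (h' : L2Tendsto b l f' g') :
    Tendsto (fun j => ∫ z, f j z * f' j z ∂(area b)) l (𝓝 (∫ z, g z * g' z ∂(area b))) := by
  have := h.tendsto_toLp.inner (𝕜 := ℝ) h'.tendsto_toLp
  simpa only [inner_toLp] using this

theorem const (hg : MemLp g 2 (area b)) : L2Tendsto b l (fun _ => g) g :=
  ⟨fun _ => hg, hg, by simpa using tendsto_const_nhds⟩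

theorem of_uniform (hf : ∀ j, SmoothPeriodic b (f j)) (hg : SmoothPeriodic b g)
    (h : ∀ ε > 0, ∀ᶠ j in l, ∀ z, ‖f j z - g z‖ < ε) : L2Tendsto b l f g := by
  refine ⟨fun j => (hf j).memLp 2, hg.memLp 2, ?_⟩
  rw [Metric.tendsto_nhds]
  intro ε hε
  have hA : 0 < (area b).real Set.univ := area_real_pos
  set δ := Real.sqrt (ε / (2 * (area b).real Set.univ)) with hδ
  have hδ0 : 0 < δ := Real.sqrt_pos.2 (by positivity)
  filter_upwards [h δ hδ0] with j hj
  have h1 : ∫ z, (f j z - g z) ^ 2 ∂(area b) ≤ ∫ _, δ ^ 2 ∂(area b) := by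
    refine integral_mono (((hf j).sub hg).pow 2).integrable (integrable_const _) fun z => ?_
    have := hj z
    rw [Real.norm_eq_abs] at this
    beta_reduce
    rw [← sq_abs]
    gcongr
  rw [integral_const, smul_eq_mul, hδ, Real.sq_sqrt (by positivity)] at h1
  have h2 : (area b).real Set.univ * (ε / (2 * (area b).real Set.univ)) = ε / 2 := by
    field_simp
  rw [h2] at h1
  rw [Real.dist_eq, sub_zero, abs_of_nonneg (integral_nonneg fun z => sq_nonneg _)]
  linarith

theorem of_family {E : Type*} [NormedAddCommGroup E] [NormedSpace ℝ E] {U : Set E} (hU : IsOpen U)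
    {h : E → ℂ → ℝ} (hh : SmoothFamily b U h) {q : ι → E} (hq : ∀ j, q j ∈ U) {q₀ : E}
    (hq₀ : q₀ ∈ U) (hlim : Tendsto q l (𝓝 q₀)) : L2Tendsto b l (fun j => h (q j)) (h q₀) :=
  of_uniform (fun j => hh.smoothPeriodic (hq j)) (hh.smoothPeriodic hq₀) fun _ hε =>
    hlim.eventually (hh.eventually_norm_sub_lt hU hq₀ hε)

theorem tendsto_integral_inner {V V' : ι → ℂ → R3} {S S' : ℂ → R3}
    (h : ∀ i, L2Tendsto b l (fun j z => V j z i) (fun z => S z i))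
    (h' : ∀ i, L2Tendsto b l (fun j z => V' j z i) (fun z => S' z i)) :
    Tendsto (fun j => ∫ z, inner ℝ (V j z) (V' j z) ∂(area b)) l
      (𝓝 (∫ z, inner ℝ (S z) (S' z) ∂(area b))) := by
  have e : ∀ {A B : ℂ → R3}, (∀ i, MemLp (fun z => A z i) 2 (area b)) →
      (∀ i, MemLp (fun z => B z i) 2 (area b)) → ∫ z, inner ℝ (A z) (B z) ∂(area b)
      = ∫ z, A z 0 * B z 0 ∂(area b) + ∫ z, A z 1 * B z 1 ∂(area b)
        + ∫ z, A z 2 * B z 2 ∂(area b) := by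
    intro A B hA hB
    have i0 := fun i => memLp_mul_integrable (hA i) (hB i)
    have i01 : Integrable (fun z => A z 0 * B z 0 + A z 1 * B z 1) (area b) := (i0 0).add (i0 1)
    simp only [inner_eq_sum]
    rw [integral_add i01 (i0 2), integral_add (i0 0) (i0 1)]
  rw [e (fun i => (h i).memLp_lim) fun i => (h' i).memLp_lim]
  simp only [fun j => e (fun i => (h i).memLp j) fun i => (h' i).memLp j]
  exact (((h 0).tendsto_integral_mul (h' 0)).add ((h 1).tendsto_integral_mul (h' 1))).add
    ((h 2).tendsto_integral_mul (h' 2))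

end L2Tendsto

end SmoothFamilies

/-! ### The bilinear form and its differential operator -/

section BilinearForm

variable {b : Module.Basis (Fin 2) ℝ ℂ} {φ Y X W Z P Q : ℂ → R3}

/-- The polarisation of `formDensity`. -/
def bilinDensity (p a c Y X W Z P Q : R3) : ℝ :=
  inner ℝ X P + inner ℝ W Q - (‖a‖ ^ 2 + ‖c‖ ^ 2) * inner ℝ Y Z
    - 2 * (inner ℝ a X + inner ℝ c W) * inner ℝ p Z
    - 2 * (inner ℝ a P + inner ℝ c Q) * inner ℝ p Y
    + (4 * (‖a‖ ^ 2 + ‖c‖ ^ 2) + 1) * inner ℝ p Y * inner ℝ p Z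

theorem formDensity_add_smul (p a c Y X W Z P Q : R3) (t : ℝ) :
    formDensity p a c (Y + t • Z) (X + t • P) (W + t • Q) =
      formDensity p a c Z P Q * t ^ 2 + 2 * t * bilinDensity p a c Y X W Z P Q
        + formDensity p a c Y X W := by
  have e : ∀ u v : R3, ‖u + t • v‖ ^ 2 = ‖u‖ ^ 2 + 2 * t * inner ℝ u v + t ^ 2 * ‖v‖ ^ 2 := by
    intro u v
    rw [norm_add_sq_real, inner_smul_right, norm_smul, mul_pow, Real.norm_eq_abs, sq_abs]
    ring
  simp only [formDensity, bilinDensity, e, inner_add_right, inner_smul_right]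
  ring

/-- The form associated with a map `φ` to the sphere. -/
def form (b : Module.Basis (Fin 2) ℝ ℂ) (φ Y X W : ℂ → R3) : ℝ :=
  ∫ z, formDensity (φ z) (dx φ z) (dy φ z) (Y z) (X z) (W z) ∂(area b)

/-- The bilinear form associated with a map `φ` to the sphere. -/
def bilin (b : Module.Basis (Fin 2) ℝ ℂ) (φ Y X W Z P Q : ℂ → R3) : ℝ :=
  ∫ z, bilinDensity (φ z) (dx φ z) (dy φ z) (Y z) (X z) (W z) (Z z) (P z) (Q z) ∂(area b)

theorem integrable_bilinDensity (hφ : SmoothPeriodic b φ) (h : HasWeakGradient b Y X W)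
    (h' : HasWeakGradient b Z P Q) :
    Integrable (fun z => bilinDensity (φ z) (dx φ z) (dy φ z) (Y z) (X z) (W z) (Z z) (P z) (Q z))
      (area b) := by
  have h1 := HasWeakGradient.integrable_formDensity hφ (h.add (h'.const_smul 1))
  have h2 := ((h1.sub (HasWeakGradient.integrable_formDensity hφ h)).sub
    (HasWeakGradient.integrable_formDensity hφ h')).const_mul (1 / 2)
  refine h2.congr (Eventually.of_forall fun z => ?_)
  simp only [Pi.sub_apply, formDensity_add_smul]
  ring

theorem form_nonneg (hφ : IsHolomorphicMap b φ) (h : HasWeakGradient b Y X W) :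
    0 ≤ form b φ Y X W :=
  (integral_nonneg fun _ => sq_nonneg _).trans (HasWeakGradient.integral_inner_sq_le hφ h)

theorem form_add_smul (hφ : SmoothPeriodic b φ) (h : HasWeakGradient b Y X W)
    (h' : HasWeakGradient b Z P Q) (t : ℝ) :
    form b φ (fun z => Y z + t • Z z) (fun z => X z + t • P z) (fun z => W z + t • Q z)
      = form b φ Z P Q * t ^ 2 + 2 * t * bilin b φ Y X W Z P Q + form b φ Y X W := by
  simp only [form, bilin, formDensity_add_smul]
  have i1 := (HasWeakGradient.integrable_formDensity hφ h').mul_const (t ^ 2)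
  have i2 := (integrable_bilinDensity hφ h h').const_mul (2 * t)
  have i12 := i1.add i2
  simp only [Pi.add_def] at i12
  rw [integral_add i12 (HasWeakGradient.integrable_formDensity hφ h), integral_add i1 i2,
    integral_const_mul, integral_mul_const]

theorem form_smul (t : ℝ) :
    form b φ (fun z => t • Y z) (fun z => t • X z) (fun z => t • W z)
      = t ^ 2 * form b φ Y X W := by
  rw [form, form, ← integral_const_mul]
  congr 1
  funext z
  simp only [formDensity, inner_smul_right, norm_smul, mul_pow, Real.norm_eq_abs, sq_abs]
  ring

/-- The Cauchy-Schwarz inequality for the form, a consequence of its positivity. -/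
theorem bilin_sq_le (hφ : IsHolomorphicMap b φ) (h : HasWeakGradient b Y X W)
    (h' : HasWeakGradient b Z P Q) :
    bilin b φ Y X W Z P Q ^ 2 ≤ form b φ Y X W * form b φ Z P Q := by
  have h1 : ∀ t : ℝ, 0 ≤ form b φ Z P Q * (t * t) + 2 * bilin b φ Y X W Z P Q * t
      + form b φ Y X W := by
    intro t
    have := form_nonneg hφ (h.add (h'.const_smul t))
    rw [form_add_smul hφ.smooth h h'] at this
    linarith
  have h2 := discrim_le_zero h1
  rw [discrim] at h2
  nlinarith

/-- Integration by parts against a smooth vector field. -/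
theorem integralZero_inner {v : ℂ} {S D : ℂ → R3} (hS : SmoothPeriodic b S)
    (hY : ∀ i, HasWeakDeriv b v (fun z => Y z i) (fun z => D z i)) :
    IntegralZero b (fun z => inner ℝ (D z) (S z) + inner ℝ (Y z) (fderiv ℝ S z v)) := by
  have key := fun i => (hY i).integralZero_mul (HasWeakDeriv.of_smooth (v := v) (hS.comp i))
  refine (((key 0).add (key 1)).add (key 2)).congr (Eventually.of_forall fun z => ?_)
  simp only [fderiv_comp_apply hS.differentiable, inner_eq_sum]
  ring

/-- The field which is paired with the derivative of `Y` in the direction `v` in the bilinear form of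
`Y` and `η`. -/
def flux (φ η : ℂ → R3) (v z : ℂ) : R3 :=
  fderiv ℝ η z v - (2 * inner ℝ (φ z) (η z)) • fderiv ℝ φ z v

/-- The operator of the form, applied to a smooth field `η`. -/
def formOp (φ η : ℂ → R3) (z : ℂ) : R3 :=
  -(fderiv ℝ (flux φ η 1) z 1 + fderiv ℝ (flux φ η Complex.I) z Complex.I)
    - (‖dx φ z‖ ^ 2 + ‖dy φ z‖ ^ 2) • η z
    - (2 * (inner ℝ (dx φ z) (dx η z) + inner ℝ (dy φ z) (dy η z))) • φ z
    + ((4 * (‖dx φ z‖ ^ 2 + ‖dy φ z‖ ^ 2) + 1) * inner ℝ (φ z) (η z)) • φ z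

theorem smoothPeriodic_flux {η : ℂ → R3} (hφ : SmoothPeriodic b φ) (hη : SmoothPeriodic b η)
    (v : ℂ) : SmoothPeriodic b (flux φ η v) :=
  (hη.fderiv v).sub (((SmoothPeriodic.const (2 : ℝ)).mul (hφ.inner hη)).smul (hφ.fderiv v))

theorem bilin_eq_integral_formOp {η : ℂ → R3} (hφ : SmoothPeriodic b φ) (hη : SmoothPeriodic b η)
    (h : HasWeakGradient b Y X W) :
    bilin b φ Y X W η (dx η) (dy η) = ∫ z, inner ℝ (Y z) (formOp φ η z) ∂(area b) := by
  have h1 := integralZero_inner (smoothPeriodic_flux hφ hη 1) h.wdx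
  have h2 := integralZero_inner (smoothPeriodic_flux hφ hη Complex.I) h.wdy
  have h3 := h1.add h2
  have h4 : ∀ z, inner ℝ (Y z) (formOp φ η z)
      = bilinDensity (φ z) (dx φ z) (dy φ z) (Y z) (X z) (W z) (η z) (dx η z) (dy η z)
        - (inner ℝ (X z) (flux φ η 1 z) + inner ℝ (Y z) (fderiv ℝ (flux φ η 1) z 1)
          + (inner ℝ (W z) (flux φ η Complex.I z)
            + inner ℝ (Y z) (fderiv ℝ (flux φ η Complex.I) z Complex.I))) := by
    intro z
    simp only [formOp, bilinDensity, inner_add_right, inner_sub_right, inner_neg_right,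
      inner_smul_right]
    have e1 : inner ℝ (X z) (flux φ η 1 z)
        = inner ℝ (X z) (dx η z) - 2 * inner ℝ (φ z) (η z) * inner ℝ (dx φ z) (X z) := by
      rw [flux, inner_sub_right, inner_smul_right, real_inner_comm (fderiv ℝ φ z 1)]
      rfl
    have e2 : inner ℝ (W z) (flux φ η Complex.I z)
        = inner ℝ (W z) (dy η z) - 2 * inner ℝ (φ z) (η z) * inner ℝ (dy φ z) (W z) := by
      rw [flux, inner_sub_right, inner_smul_right, real_inner_comm (fderiv ℝ φ z Complex.I)]
      rfl
    rw [e1, e2, real_inner_comm (φ z) (Y z)]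
    ring
  simp only [h4]
  rw [integral_sub (integrable_bilinDensity hφ h (HasWeakGradient.of_smooth hη)) h3.1, h3.2,
    sub_zero, bilin]

theorem fderiv_flux {η : ℂ → R3} (hφ : SmoothPeriodic b φ) (hη : SmoothPeriodic b η) (v z : ℂ) :
    fderiv ℝ (flux φ η v) z v = fderiv ℝ (fun w => fderiv ℝ η w v) z v
      - (2 * (inner ℝ (fderiv ℝ φ z v) (η z) + inner ℝ (φ z) (fderiv ℝ η z v))) • fderiv ℝ φ z v
      - (2 * inner ℝ (φ z) (η z)) • fderiv ℝ (fun w => fderiv ℝ φ w v) z v := by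
  have h1 := ((hφ.differentiable z).hasFDerivAt.inner ℝ (hη.differentiable z).hasFDerivAt).const_mul 2
  have h2 := h1.smul ((hφ.fderiv v).differentiable z).hasFDerivAt
  have h3 := ((hη.fderiv v).differentiable z).hasFDerivAt.sub h2
  have h4 : HasFDerivAt (flux φ η v) _ z := h3
  rw [h4.fderiv]
  simp only [sub_apply, add_apply, smul_apply, ContinuousLinearMap.smulRight_apply,
    ContinuousLinearMap.comp_apply, ContinuousLinearMap.prod_apply, fderivInnerCLM_apply,
    smul_eq_mul]
  module

end BilinearForm

/-! ### Weak solutions are Jacobi fields -/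

section WeakSolutions

variable {b : Module.Basis (Fin 2) ℝ ℂ} {φ : ℂ → R3}

theorem sq_apply_le_norm_sq (u : R3) (i : Fin 3) : u i ^ 2 ≤ ‖u‖ ^ 2 := by
  rw [← sq_abs, ← Real.norm_eq_abs]
  exact pow_le_pow_left₀ (norm_nonneg _) (PiLp.norm_apply_le u i) 2

theorem SmoothPeriodic.eq_zero_of_integral_sq {f : ℂ → ℝ} (hf : SmoothPeriodic b f)
    (h : ∫ z, f z ^ 2 ∂(area b) = 0) (z : ℂ) : f z = 0 := by
  rw [integral_eq_zero_iff_of_nonneg (fun z => sq_nonneg _) (hf.pow 2).integrable] at h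
  refine hf.periodic.eq_of_ae (g := fun _ => 0) (fun _ _ => rfl) hf.continuous continuous_const ?_ z
  filter_upwards [h] with z hz
  simpa using hz

/-- The form operator on a field with a constant direction: tested against such fields, the weak
equation takes the shape required by `exists_smooth_of_weak_laplace`. -/
theorem inner_formOp_single (hφ : SmoothPeriodic b φ) {ζ : ℂ → ℝ} (hζ : SmoothPeriodic b ζ)
    (i : Fin 3) (y : R3) (z : ℂ) :
    inner ℝ y (formOp φ (fun w => ζ w • EuclideanSpace.single i (1 : ℝ)) z) =
      -((fderiv ℝ (fun w => fderiv ℝ ζ w 1) z 1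
          + fderiv ℝ (fun w => fderiv ℝ ζ w Complex.I) z Complex.I) * y i
        - ∑ j, (((2 * dx φ z i * dx φ z j + 2 * dy φ z i * dy φ z j
              + 2 * φ z i * (dx (dx φ) z j + dy (dy φ) z j)
              - (if i = j then ‖dx φ z‖ ^ 2 + ‖dy φ z‖ ^ 2 else 0)
              + (4 * (‖dx φ z‖ ^ 2 + ‖dy φ z‖ ^ 2) + 1) * (φ z i * φ z j)) * ζ z
            + (2 * φ z i * dx φ z j - 2 * dx φ z i * φ z j) * fderiv ℝ ζ z 1
            + (2 * φ z i * dy φ z j - 2 * dy φ z i * φ z j) * fderiv ℝ ζ z Complex.I)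
          * y j)) := by
  set e : R3 := EuclideanSpace.single i (1 : ℝ) with he
  have hη : SmoothPeriodic b (fun w => ζ w • e) := hζ.smul (SmoothPeriodic.const e)
  have hd : ∀ v w, fderiv ℝ (fun w => ζ w • e) w v = fderiv ℝ ζ w v • e := by
    intro v w
    rw [((hζ.differentiable w).hasFDerivAt.smul_const e).fderiv]
    simp
  have hdd : ∀ v w, fderiv ℝ (fun w => fderiv ℝ (fun w => ζ w • e) w v) w v
      = fderiv ℝ (fun w => fderiv ℝ ζ w v) w v • e := by
    intro v w
    simp only [hd]
    rw [(((hζ.fderiv v).differentiable w).hasFDerivAt.smul_const e).fderiv]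
    simp
  have hin : ∀ u : R3, inner ℝ u e = u i := by
    intro u
    rw [he, EuclideanSpace.inner_single_right]
    simp
  have e1 : ∀ j, dx (dx φ) z j = fderiv ℝ (fun w => fderiv ℝ φ w 1) z 1 j := fun _ => rfl
  have e2 : ∀ j, dy (dy φ) z j = fderiv ℝ (fun w => fderiv ℝ φ w Complex.I) z Complex.I j :=
    fun _ => rfl
  simp only [formOp, fderiv_flux hφ hη, hdd, e1, e2]
  simp only [hd, dx, dy, inner_add_right, inner_sub_right,
    inner_neg_right, inner_smul_right, hin, Fin.sum_univ_three]
  have hite : ∀ (r s : ℝ), (if i = 0 then r else 0) * y 0 * s + (if i = 1 then r else 0) * y 1 * s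
      + (if i = 2 then r else 0) * y 2 * s = r * y i * s := by
    intro r s
    fin_cases i <;> simp
  rw [inner_eq_sum y (fderiv ℝ φ z 1), inner_eq_sum y (fderiv ℝ φ z Complex.I),
    inner_eq_sum y (φ z), inner_eq_sum y (fderiv ℝ (fun w => fderiv ℝ φ w 1) z 1),
    inner_eq_sum y (fderiv ℝ (fun w => fderiv ℝ φ w Complex.I) z Complex.I)]
  have h1 := hite (‖fderiv ℝ φ z 1‖ ^ 2 + ‖fderiv ℝ φ z Complex.I‖ ^ 2) (ζ z)
  linear_combination h1

/-- A square integrable weak solution of the equation of the form, with vanishing normal component,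
is a Jacobi field. -/
theorem exists_kerJacobi_of_weak (hφ : IsHolomorphicMap b φ) {Y : ℂ → R3}
    (hY : ∀ i, MemLp (fun z => Y z i) 2 (area b))
    (hweak : ∀ η : ℂ → R3, SmoothPeriodic b η → ∫ z, inner ℝ (Y z) (formOp φ η z) ∂(area b) = 0)
    (hnormal : ∀ ζ : ℂ → ℝ, SmoothPeriodic b ζ →
      ∫ z, inner ℝ (Y z) (ζ z • φ z) ∂(area b) = 0) :
    ∃ V ∈ kerJacobi b φ, Y =ᵐ[area b] V := by
  have hs := hφ.smooth
  have he : SmoothPeriodic b (fun z => ‖dx φ z‖ ^ 2 + ‖dy φ z‖ ^ 2) :=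
    hs.dx.norm_sq.add hs.dy.norm_sq
  have hreg : ∀ i, ∃ G : ℂ → ℝ, SmoothPeriodic b G ∧ (fun z => Y z i) =ᵐ[area b] G := by
    have c2 : SmoothPeriodic b (fun _ => (2 : ℝ)) := SmoothPeriodic.const 2
    refine exists_smooth_of_weak_laplace (g := fun i z => Y z i) hY
      (A := fun i j z => 2 * dx φ z i * dx φ z j + 2 * dy φ z i * dy φ z j
              + 2 * φ z i * (dx (dx φ) z j + dy (dy φ) z j)
              - (if i = j then ‖dx φ z‖ ^ 2 + ‖dy φ z‖ ^ 2 else 0)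
              + (4 * (‖dx φ z‖ ^ 2 + ‖dy φ z‖ ^ 2) + 1) * (φ z i * φ z j))
      (B := fun i j z => 2 * φ z i * dx φ z j - 2 * dx φ z i * φ z j)
      (C := fun i j z => 2 * φ z i * dy φ z j - 2 * dy φ z i * φ z j) ?_ ?_ ?_ ?_
    · intro i j
      refine ((((((c2.mul (hs.dx.comp i)).mul (hs.dx.comp j)).add
        ((c2.mul (hs.dy.comp i)).mul (hs.dy.comp j))).add
        ((c2.mul (hs.comp i)).mul ((hs.dx.dx.comp j).add (hs.dy.dy.comp j)))).sub ?_).add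
        ((((SmoothPeriodic.const (4 : ℝ)).mul he).add (SmoothPeriodic.const 1)).mul
          ((hs.comp i).mul (hs.comp j))))
      split_ifs
      · exact he
      · exact SmoothPeriodic.const 0
    · intro i j
      exact ((c2.mul (hs.comp i)).mul (hs.dx.comp j)).sub
        ((c2.mul (hs.dx.comp i)).mul (hs.comp j))
    · intro i j
      exact ((c2.mul (hs.comp i)).mul (hs.dy.comp j)).sub
        ((c2.mul (hs.dy.comp i)).mul (hs.comp j))
    · intro i ζ hζ
      have h1 := hweak _ (hζ.smul (SmoothPeriodic.const (EuclideanSpace.single i (1 : ℝ))))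
      simp only [inner_formOp_single hs hζ] at h1
      rw [integral_neg, neg_eq_zero] at h1
      exact h1
  choose G hG hYG using hreg
  set V : ℂ → R3 := fun z => ∑ i, G i z • EuclideanSpace.single i (1 : ℝ) with hVdef
  have hV : SmoothPeriodic b V := SmoothPeriodic.sum fun i _ =>
    (hG i).smul (SmoothPeriodic.const _)
  have hVi : ∀ z i, V z i = G i z := by
    intro z i
    fin_cases i <;> simp [hVdef, Fin.sum_univ_three]
  have hYV : Y =ᵐ[area b] V := by
    filter_upwards [hYG 0, hYG 1, hYG 2] with z h0 h1 h2
    ext i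
    rw [hVi]
    fin_cases i
    · exact h0
    · exact h1
    · exact h2
  have hinner : ∀ S : ℂ → R3, ∫ z, inner ℝ (Y z) (S z) ∂(area b)
      = ∫ z, inner ℝ (V z) (S z) ∂(area b) := by
    intro S
    refine integral_congr_ae ?_
    filter_upwards [hYV] with z hz
    rw [hz]
  -- the normal component of `V` is itself an admissible test function
  have hVn : ∀ z, inner ℝ (φ z) (V z) = 0 := by
    refine (hs.inner hV).eq_zero_of_integral_sq ?_
    rw [← hnormal _ (hs.inner hV), hinner]
    refine integral_congr_ae (Eventually.of_forall fun z => ?_)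
    beta_reduce
    rw [inner_smul_right, real_inner_comm (φ z) (V z), sq]
  have hJ : SmoothPeriodic b (jacobi φ V) := by
    have hi : SmoothPeriodic b (fun z => 2 * (inner ℝ (dx φ z) (dx V z)
        + inner ℝ (dy φ z) (dy V z))) :=
      (SmoothPeriodic.const (2 : ℝ)).mul ((hs.dx.inner hV.dx).add (hs.dy.inner hV.dy))
    exact ((hV.dx.dx.neg.sub hV.dy.dy).sub (he.smul hV)).sub (hi.smul hs)
  -- on tangent fields the equation of the form is the Jacobi equation, tested against all fields
  have hweakJ : ∀ η : ℂ → R3, SmoothPeriodic b η →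
      ∫ z, inner ℝ (η z) (jacobi φ V z) ∂(area b) = 0 := by
    intro η hη
    have h1 := hweak η hη
    rw [hinner, ← bilin_eq_integral_formOp hs hη (HasWeakGradient.of_smooth hV), bilin] at h1
    have h2 := (integralZero_inner hV.dx (HasWeakGradient.of_smooth hη).wdx).add
      (integralZero_inner hV.dy (HasWeakGradient.of_smooth hη).wdy)
    have h3 : ∀ z, inner ℝ (η z) (jacobi φ V z)
        = bilinDensity (φ z) (dx φ z) (dy φ z) (V z) (dx V z) (dy V z) (η z) (dx η z) (dy η z)
        - (inner ℝ (dx η z) (dx V z) + inner ℝ (η z) (fderiv ℝ (dx V) z 1)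
          + (inner ℝ (dy η z) (dy V z) + inner ℝ (η z) (fderiv ℝ (dy V) z Complex.I))) := by
      intro z
      have e1 : fderiv ℝ (dx V) z 1 = dx (dx V) z := rfl
      have e2 : fderiv ℝ (dy V) z Complex.I = dy (dy V) z := rfl
      simp only [jacobi, bilinDensity, hVn, inner_sub_right, inner_neg_right, inner_smul_right, e1,
        e2]
      rw [real_inner_comm (dx η z) (dx V z), real_inner_comm (dy η z) (dy V z),
        real_inner_comm (η z) (V z), real_inner_comm (η z) (φ z)]
      ring
    simp only [h3]
    rw [integral_sub (integrable_bilinDensity hs (HasWeakGradient.of_smooth hV)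
      (HasWeakGradient.of_smooth hη)) h2.1, h2.2, h1, sub_zero]
  refine ⟨V, ⟨hV.periodic, hV.contDiff, hVn, fun z => ?_⟩, hYV⟩
  have h1 := hweakJ _ hJ
  simp only [real_inner_self_eq_norm_sq] at h1
  have hn : ∀ i, ∫ z, jacobi φ V z i ^ 2 ∂(area b) = 0 := by
    intro i
    refine le_antisymm ?_ (integral_nonneg fun z => sq_nonneg _)
    rw [← h1]
    refine integral_mono ((hJ.comp i).pow 2).integrable hJ.norm_sq.integrable fun z => ?_
    beta_reduce
    exact sq_apply_le_norm_sq _ i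
  ext i
  exact (hJ.comp i).eq_zero_of_integral_sq (hn i) z

end WeakSolutions

/-! ### Coercivity, locally uniformly in the parameter -/

section LocalCoercivity

variable {b : Module.Basis (Fin 2) ℝ ℂ} {φ Y X W : ℂ → R3}

/-- The square of the `H¹` norm of a field `Y` with derivatives `X` and `W`. -/
def energy (b : Module.Basis (Fin 2) ℝ ℂ) (Y X W : ℂ → R3) : ℝ :=
  ∫ z, ‖Y z‖ ^ 2 ∂(area b) + ∫ z, ‖X z‖ ^ 2 ∂(area b) + ∫ z, ‖W z‖ ^ 2 ∂(area b)

theorem integral_sq_apply_le {S : ℂ → R3} (hS : ∀ i, MemLp (fun z => S z i) 2 (area b))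
    (i : Fin 3) : ∫ z, S z i ^ 2 ∂(area b) ≤ ∫ z, ‖S z‖ ^ 2 ∂(area b) :=
  integral_mono (hS i).integrable_sq (HasWeakGradient.integrable_norm_sq hS) fun _ =>
    sq_apply_le_norm_sq _ i

theorem energy_smul (t : ℝ) :
    energy b (fun z => t • Y z) (fun z => t • X z) (fun z => t • W z)
      = t ^ 2 * energy b Y X W := by
  simp only [energy, norm_smul, mul_pow, Real.norm_eq_abs, sq_abs, integral_const_mul]
  ring

theorem le_formDensity {p a c : R3} (hp : ‖p‖ = 1) (Y X W : R3) :
    (‖X‖ ^ 2 + ‖W‖ ^ 2) / 2 - 9 * (‖a‖ ^ 2 + ‖c‖ ^ 2) * ‖Y‖ ^ 2 ≤ formDensity p a c Y X W := by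
  have hN : |inner ℝ p Y| ≤ ‖Y‖ := by simpa [hp] using abs_real_inner_le_norm p Y
  have key : ∀ u v : R3, 4 * inner ℝ u v * inner ℝ p Y ≤ ‖v‖ ^ 2 / 2 + 8 * ‖u‖ ^ 2 * ‖Y‖ ^ 2 := by
    intro u v
    have h1 : |inner ℝ u v * inner ℝ p Y| ≤ ‖u‖ * ‖v‖ * ‖Y‖ := by
      rw [abs_mul]
      exact mul_le_mul (abs_real_inner_le_norm u v) hN (abs_nonneg _) (by positivity)
    nlinarith [le_abs_self (inner ℝ u v * inner ℝ p Y), sq_nonneg (‖v‖ - 4 * (‖u‖ * ‖Y‖))]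
  have h1 := key a X
  have h2 := key c W
  have h3 : 0 ≤ (4 * (‖a‖ ^ 2 + ‖c‖ ^ 2) + 1) * inner ℝ p Y ^ 2 := by positivity
  unfold formDensity
  linarith

/-- Gårding's inequality. -/
theorem energy_le (hφ : IsHolomorphicMap b φ) (h : HasWeakGradient b Y X W) {E : ℝ}
    (hE : ∀ z, ‖dx φ z‖ ^ 2 + ‖dy φ z‖ ^ 2 ≤ E) :
    energy b Y X W ≤ (1 + 18 * E) * ∫ z, ‖Y z‖ ^ 2 ∂(area b) + 2 * form b φ Y X W := by
  have iY := HasWeakGradient.integrable_norm_sq fun i => (h.wdx i).memLp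
  have iX := HasWeakGradient.integrable_norm_sq fun i => (h.wdx i).memLp_deriv
  have iW := HasWeakGradient.integrable_norm_sq fun i => (h.wdy i).memLp_deriv
  have iXW : Integrable (fun z => (‖X z‖ ^ 2 + ‖W z‖ ^ 2) / 2) (area b) := (iX.add iW).div_const 2
  have h1 : ∫ z, ((‖X z‖ ^ 2 + ‖W z‖ ^ 2) / 2 - 9 * E * ‖Y z‖ ^ 2) ∂(area b) ≤ form b φ Y X W := by
    refine integral_mono (iXW.sub (iY.const_mul _))
      (HasWeakGradient.integrable_formDensity hφ.smooth h) fun z => ?_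
    refine le_trans ?_ (le_formDensity (hφ.norm_eq z) _ _ _)
    beta_reduce
    gcongr
    exact hE z
  rw [integral_sub iXW (iY.const_mul _), integral_const_mul, integral_div, integral_add iX iW] at h1
  unfold energy
  linarith

theorem integral_mul_sq_le {f g : ℂ → ℝ} (hf : MemLp f 2 (area b)) (hg : MemLp g 2 (area b)) :
    (∫ z, f z * g z ∂(area b)) ^ 2
      ≤ (∫ z, f z ^ 2 ∂(area b)) * ∫ z, g z ^ 2 ∂(area b) := by
  have h := real_inner_mul_inner_self_le hf.toLp hg.toLp
  simpa only [inner_toLp, sq] using h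

theorem form_eq_integral_formOp {η : ℂ → R3} (hφ : SmoothPeriodic b φ) (hη : SmoothPeriodic b η) :
    form b φ η (dx η) (dy η) = ∫ z, inner ℝ (η z) (formOp φ η z) ∂(area b) := by
  rw [← bilin_eq_integral_formOp hφ hη (HasWeakGradient.of_smooth hη), form, bilin]
  congr 1
  funext z
  simp only [formDensity, bilinDensity, real_inner_self_eq_norm_sq]
  ring

theorem SmoothFamily.formOp {E : Type*} [NormedAddCommGroup E] [NormedSpace ℝ E] {U : Set E}
    (hU : IsOpen U) {ψ : E → ℂ → R3} (hψ : SmoothFamily b U ψ) {η : ℂ → R3}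
    (hη : SmoothPeriodic b η) : SmoothFamily b U (fun q => formOp (ψ q) η) := by
  have c : ∀ r : ℝ, SmoothFamily b U (fun _ _ => r) := fun r =>
    SmoothFamily.const (SmoothPeriodic.const r)
  have hη' : SmoothFamily b U (fun _ => η) := SmoothFamily.const hη
  have hx : SmoothFamily b U (fun q => dx (ψ q)) := hψ.fderiv_right hU 1
  have hy : SmoothFamily b U (fun q => dy (ψ q)) := hψ.fderiv_right hU Complex.I
  have hηx : SmoothFamily b U (fun _ => dx η) := SmoothFamily.const hη.dx
  have hηy : SmoothFamily b U (fun _ => dy η) := SmoothFamily.const hη.dy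
  have he := hx.norm_sq.add hy.norm_sq
  have hf : ∀ v, SmoothFamily b U (fun q => flux (ψ q) η v) := fun v =>
    (SmoothFamily.const (hη.fderiv v)).sub
      (((c 2).mul (hψ.inner hη')).smul (hψ.fderiv_right hU v))
  exact (((((hf 1).fderiv_right hU 1).add ((hf Complex.I).fderiv_right hU Complex.I)).neg.sub
    (he.smul hη')).sub (((c 2).mul ((hx.inner hηx).add (hy.inner hηy))).smul hψ)).add
    (((((c 4).mul he).add (c 1)).mul (hψ.inner hη')).smul hψ)

/-- A limit in `L²` of fields along which the forms of a convergent sequence of holomorphic maps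
tend to zero is a Jacobi field of the limit map. -/
theorem exists_kerJacobi_of_tendsto {E ι : Type*} [NormedAddCommGroup E] [NormedSpace ℝ E]
    {U : Set E} (hU : IsOpen U) {ψ : E → ℂ → R3} (hψ : SmoothFamily b U ψ)
    (hhol : ∀ q ∈ U, IsHolomorphicMap b (ψ q)) {l : Filter ι} [l.NeBot] {q : ι → E} {q₀ : E}
    (hq : ∀ j, q j ∈ U) (hq₀ : q₀ ∈ U) (hlim : Tendsto q l (𝓝 q₀)) {Y X W : ι → ℂ → R3}
    (h : ∀ j, HasWeakGradient b (Y j) (X j) (W j))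
    (hform : Tendsto (fun j => form b (ψ (q j)) (Y j) (X j) (W j)) l (𝓝 0)) {Z : ℂ → R3}
    (hZ : ∀ i, L2Tendsto b l (fun j z => Y j z i) (fun z => Z z i)) :
    ∃ V ∈ kerJacobi b (ψ q₀), Z =ᵐ[area b] V := by
  have hfam : ∀ {S : E → ℂ → R3}, SmoothFamily b U S → ∀ i,
      L2Tendsto b l (fun j z => S (q j) z i) (fun z => S q₀ z i) := fun hS i =>
    L2Tendsto.of_family hU (hS.comp i) hq hq₀ hlim
  refine exists_kerJacobi_of_weak (hhol q₀ hq₀) (fun i => (hZ i).memLp_lim) ?_ ?_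
  · intro η hη
    have h1 := L2Tendsto.tendsto_integral_inner hZ (hfam (SmoothFamily.formOp hU hψ hη))
    have h2 := L2Tendsto.tendsto_integral_inner (l := l) (V := fun _ => η)
      (fun i => L2Tendsto.const ((hη.comp i).memLp 2)) (hfam (SmoothFamily.formOp hU hψ hη))
    -- the pairing with `η` is controlled by the Cauchy-Schwarz inequality for the form
    have h3 := hform.mul h2
    rw [zero_mul] at h3
    refine pow_eq_zero_iff (two_ne_zero) |>.1 (le_antisymm ?_ (sq_nonneg _))
    refine le_of_tendsto_of_tendsto' (h1.pow 2) h3 fun j => ?_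
    have hs := (hhol _ (hq j)).smooth
    rw [← bilin_eq_integral_formOp hs hη (h j), ← form_eq_integral_formOp hs hη]
    exact bilin_sq_le (hhol _ (hq j)) (h j) (HasWeakGradient.of_smooth hη)
  · intro ζ hζ
    have h1 := L2Tendsto.tendsto_integral_inner hZ (hfam ((SmoothFamily.const hζ).smul hψ))
    -- the normal component is controlled by the positivity of the form
    have h3 := hform.const_mul (∫ z, ζ z ^ 2 ∂(area b))
    rw [mul_zero] at h3
    refine pow_eq_zero_iff (two_ne_zero) |>.1 (le_antisymm ?_ (sq_nonneg _))
    refine le_of_tendsto_of_tendsto' (h1.pow 2) h3 fun j => ?_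
    have hs := (hhol _ (hq j)).smooth
    have hN := HasWeakGradient.memLp_inner hs fun i => ((h j).wdx i).memLp
    calc (∫ z, inner ℝ (Y j z) (ζ z • ψ (q j) z) ∂(area b)) ^ 2
        = (∫ z, ζ z * inner ℝ (ψ (q j) z) (Y j z) ∂(area b)) ^ 2 := by
          simp only [inner_smul_right, real_inner_comm (ψ (q j) _)]
      _ ≤ (∫ z, ζ z ^ 2 ∂(area b)) * ∫ z, inner ℝ (ψ (q j) z) (Y j z) ^ 2 ∂(area b) :=
          integral_mul_sq_le (hζ.memLp 2) hN
      _ ≤ _ := mul_le_mul_of_nonneg_left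
          (HasWeakGradient.integral_inner_sq_le (hhol _ (hq j)) (h j))
          (integral_nonneg fun z => sq_nonneg _)

variable {n : ℕ} {U : Set (EuclideanSpace ℝ (Fin (4 * n)))}
  {ψ : EuclideanSpace ℝ (Fin (4 * n)) → ℂ → R3}

theorem IsLocalParam.smoothFamily (hψ : IsLocalParam b n U ψ) : SmoothFamily b U ψ :=
  ⟨hψ.smooth, fun q hq => (hψ.mem_moduliSpace q hq).1⟩

theorem IsLocalParam.isHolomorphicMap (hψ : IsLocalParam b n U ψ) :
    ∀ q ∈ U, IsHolomorphicMap b (ψ q) := fun q hq =>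
  isHolomorphicMap_of_mem (hψ.mem_moduliSpace q hq)

theorem IsLocalParam.smoothFamily_paramDeriv (hψ : IsLocalParam b n U ψ) (μ : Fin (4 * n)) :
    SmoothFamily b U (fun q => paramDeriv ψ q μ) :=
  hψ.smoothFamily.fderiv_left hψ.isOpen _

/-- A Jacobi field orthogonal to the coordinate derivatives vanishes. -/
theorem IsLocalParam.integral_norm_sq_eq_zero (hψ : IsLocalParam b n U ψ)
    {q : EuclideanSpace ℝ (Fin (4 * n))} (hq : q ∈ U) {V : ℂ → R3} (hV : V ∈ kerJacobi b (ψ q))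
    (horth : ∀ μ, ∫ z, inner ℝ (V z) (paramDeriv ψ q μ z) ∂(area b) = 0) :
    ∫ z, ‖V z‖ ^ 2 ∂(area b) = 0 := by
  have hVs : SmoothPeriodic b V := ⟨hV.1, hV.2.1⟩
  have hspan : V ∈ Submodule.span ℝ (Set.range (paramDeriv ψ q)) := by
    rw [← SetLike.mem_coe, hψ.span_eq q hq]
    exact hV
  have key : SmoothPeriodic b V ∧ ∫ z, inner ℝ (V z) (V z) ∂(area b) = 0 := by
    refine Submodule.span_induction
      (p := fun S _ => SmoothPeriodic b S ∧ ∫ z, inner ℝ (V z) (S z) ∂(area b) = 0)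
      ?_ ?_ ?_ ?_ hspan
    · rintro _ ⟨μ, rfl⟩
      exact ⟨(hψ.smoothFamily_paramDeriv μ).smoothPeriodic hq, horth μ⟩
    · exact ⟨SmoothPeriodic.const 0, by simp⟩
    · rintro S T _ _ ⟨hS, hS0⟩ ⟨hT, hT0⟩
      refine ⟨hS.add hT, ?_⟩
      simp only [Pi.add_apply, inner_add_right]
      rw [integral_add (hVs.inner hS).integrable (hVs.inner hT).integrable, hS0, hT0, add_zero]
    · rintro t S _ ⟨hS, hS0⟩
      refine ⟨(SmoothPeriodic.const t).smul hS, ?_⟩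
      simp only [Pi.smul_apply, inner_smul_right, integral_const_mul, hS0, mul_zero]
  simpa only [real_inner_self_eq_norm_sq] using key.2

theorem exists_bound_gradient (hψ : IsLocalParam b n U ψ)
    {q₀ : EuclideanSpace ℝ (Fin (4 * n))} (hq₀ : q₀ ∈ U) :
    ∃ E, 0 ≤ E ∧ ∀ᶠ q in 𝓝 q₀, ∀ z, ‖dx (ψ q) z‖ ^ 2 + ‖dy (ψ q) z‖ ^ 2 ≤ E := by
  have hx : SmoothFamily b U (fun q => dx (ψ q)) := hψ.smoothFamily.fderiv_right hψ.isOpen 1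
  have hy : SmoothFamily b U (fun q => dy (ψ q)) := hψ.smoothFamily.fderiv_right hψ.isOpen Complex.I
  obtain ⟨E, hE0, hE⟩ := (hx.norm_sq.add hy.norm_sq).eventually_bound hψ.isOpen hq₀
  refine ⟨E, hE0, ?_⟩
  filter_upwards [hE] with q hq z
  exact (le_abs_self _).trans (hq z)

/-- Coercivity of the form on the fields orthogonal to the Jacobi fields, locally uniformly in the
parameter. -/
theorem exists_local_coercive (hψ : IsLocalParam b n U ψ)
    {q₀ : EuclideanSpace ℝ (Fin (4 * n))} (hq₀ : q₀ ∈ U) :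
    ∃ c : ℝ, 0 < c ∧ ∀ᶠ q in 𝓝 q₀, ∀ Y X W : ℂ → R3, HasWeakGradient b Y X W →
      (∀ μ, ∫ z, inner ℝ (Y z) (paramDeriv ψ q μ z) ∂(area b) = 0) →
      c * energy b Y X W ≤ form b (ψ q) Y X W := by
  obtain ⟨E, hE0, hE⟩ := exists_bound_gradient hψ hq₀
  by_contra hcon
  have hseq : ∀ m : ℕ, ∃ (q : EuclideanSpace ℝ (Fin (4 * n))) (Y X W : ℂ → R3),
      q ∈ U ∧ dist q q₀ < 1 / ((m : ℝ) + 1) ∧ (∀ z, ‖dx (ψ q) z‖ ^ 2 + ‖dy (ψ q) z‖ ^ 2 ≤ E) ∧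
      HasWeakGradient b Y X W ∧
      (∀ μ, ∫ z, inner ℝ (Y z) (paramDeriv ψ q μ z) ∂(area b) = 0) ∧
      energy b Y X W = 1 ∧ form b (ψ q) Y X W ≤ 1 / ((m : ℝ) + 1) := by
    intro m
    have hm : 0 < 1 / ((m : ℝ) + 1) := Nat.one_div_pos_of_nat
    have h1 : ∃ᶠ q in 𝓝 q₀, ¬∀ Y X W : ℂ → R3, HasWeakGradient b Y X W →
        (∀ μ, ∫ z, inner ℝ (Y z) (paramDeriv ψ q μ z) ∂(area b) = 0) →
        1 / ((m : ℝ) + 1) * energy b Y X W ≤ form b (ψ q) Y X W := fun h =>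
      hcon ⟨_, hm, h.mono fun q hq => not_not.1 hq⟩
    obtain ⟨q, hq, ⟨hqU, hqd⟩, hqE⟩ := (h1.and_eventually
      (((hψ.isOpen.eventually_mem hq₀).and (Metric.eventually_nhds_iff_ball.2
        ⟨_, hm, fun y hy => Metric.mem_ball.1 hy⟩)).and hE)).exists
    push Not at hq
    obtain ⟨Y, X, W, hY, horth, hlt⟩ := hq
    have hhol := hψ.isHolomorphicMap q hqU
    have hS : 0 < energy b Y X W := by
      have h2 := (form_nonneg hhol hY).trans_lt hlt
      exact (pos_iff_pos_of_mul_pos h2).1 hm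
    set t := (Real.sqrt (energy b Y X W))⁻¹ with ht
    have ht2 : t ^ 2 * energy b Y X W = 1 := by
      rw [ht, inv_pow, Real.sq_sqrt hS.le, inv_mul_cancel₀ hS.ne']
    refine ⟨q, _, _, _, hqU, hqd, hqE, hY.const_smul t, fun μ => ?_, ?_, ?_⟩
    · simp only [real_inner_smul_left, integral_const_mul, horth μ, mul_zero]
    · rw [energy_smul, ht2]
    · rw [form_smul]
      have := mul_le_mul_of_nonneg_left hlt.le (sq_nonneg t)
      rwa [mul_left_comm, ht2, mul_one] at this
  choose q Y X W hqU hqd hqE hY horth henergy hform using hseq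
  -- convergence along an ultrafilter replaces the passage to subsequences
  set l : Ultrafilter ℕ := hyperfilter ℕ with hl
  have hinv : Tendsto (fun m : ℕ => 1 / ((m : ℝ) + 1)) l (𝓝 0) :=
    tendsto_one_div_add_atTop_nhds_zero_nat.mono_left (by
      rw [← Nat.cofinite_eq_atTop]; exact hyperfilter_le_cofinite)
  have hlim : Tendsto q l (𝓝 q₀) := by
    rw [tendsto_iff_dist_tendsto_zero]
    exact squeeze_zero (fun _ => dist_nonneg) (fun m => (hqd m).le) hinv
  have hform0 : Tendsto (fun m => form b (ψ (q m)) (Y m) (X m) (W m)) l (𝓝 0) :=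
    squeeze_zero (fun m => form_nonneg (hψ.isHolomorphicMap _ (hqU m)) (hY m)) hform hinv
  have hcomp : ∀ i, ∃ g : ℂ → ℝ, MemLp g 2 (area b) ∧
      Tendsto (fun m => ∫ z, (Y m z i - g z) ^ 2 ∂(area b)) l (𝓝 0) := by
    intro i
    refine exists_tendsto_of_bounded_weakDeriv l (C := 1) (fun m => (hY m).wdx i)
      (fun m => (hY m).wdy i) fun m => ?_
    rw [← henergy m, energy]
    exact add_le_add (add_le_add (integral_sq_apply_le (fun i => ((hY m).wdx i).memLp) i)
      (integral_sq_apply_le (fun i => ((hY m).wdx i).memLp_deriv) i)) (integral_sq_apply_le (fun i => ((hY m).wdy i).memLp_deriv) i)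
  choose g hg hYg using hcomp
  set Z : ℂ → R3 := fun z => WithLp.toLp 2 fun i => g i z with hZdef
  have hZ : ∀ i, L2Tendsto b (l : Filter ℕ) (fun m z => Y m z i) (fun z => Z z i) := fun i =>
    ⟨fun m => ((hY m).wdx i).memLp, hg i, hYg i⟩
  obtain ⟨V, hV, hZV⟩ := exists_kerJacobi_of_tendsto hψ.isOpen hψ.smoothFamily hψ.isHolomorphicMap
    hqU hq₀ hlim hY hform0 hZ
  -- the limit is a Jacobi field orthogonal to all Jacobi fields
  have hZ0 : ∫ z, inner ℝ (Z z) (Z z) ∂(area b) = 0 := by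
    have h1 : ∫ z, ‖V z‖ ^ 2 ∂(area b) = 0 := by
      refine hψ.integral_norm_sq_eq_zero hq₀ hV fun μ => ?_
      have h2 := L2Tendsto.tendsto_integral_inner hZ fun i =>
        L2Tendsto.of_family hψ.isOpen ((hψ.smoothFamily_paramDeriv μ).comp i) hqU hq₀ hlim
      simp only [horth] at h2
      rw [tendsto_nhds_unique tendsto_const_nhds h2]
      refine integral_congr_ae ?_
      filter_upwards [hZV] with z hz
      rw [hz]
    rw [← h1]
    refine integral_congr_ae ?_
    filter_upwards [hZV] with z hz
    rw [hz, real_inner_self_eq_norm_sq]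
  have hY0 := L2Tendsto.tendsto_integral_inner hZ hZ
  rw [hZ0] at hY0
  simp only [real_inner_self_eq_norm_sq] at hY0
  -- in Gårding's inequality the left side is one and the right side tends to zero
  have hfin := (hY0.const_mul (1 + 18 * E)).add (hform0.const_mul 2)
  rw [mul_zero, mul_zero, add_zero] at hfin
  have : (1 : ℝ) ≤ 0 := ge_of_tendsto' hfin fun m =>
    (henergy m).ge.trans (energy_le (hψ.isHolomorphicMap _ (hqU m)) (hY m) (hqE m))
  linarith

end LocalCoercivity

/-! ### Near coercivity of `Q₁` -/

section SobolevFields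

variable {b : Module.Basis (Fin 2) ℝ ℂ} {φ Y : ℂ → R3}

theorem MemH.memLp {k : ℕ} (h : MemH b k Y) : MemLp Y 2 (area b) := by
  cases k with
  | zero => exact h.2
  | succ k => exact h.2.1

theorem memLp_comp {f : ℂ → R3} (hf : MemLp f 2 (area b)) (i : Fin 3) :
    MemLp (fun z => f z i) 2 (area b) :=
  (EuclideanSpace.proj i : R3 →L[ℝ] ℝ).comp_memLp' hf

theorem hasWeakDeriv_weakDeriv {v : ℂ} {f : ℂ → R3} (hf : MemLp f 2 (area b))
    (h : ∃ g, IsWeakDeriv b v f g) (i : Fin 3) :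
    HasWeakDeriv b v (fun z => f z i) (fun z => weakDeriv b v f z i) := by
  have hw : IsWeakDeriv b v f (weakDeriv b v f) := by
    rw [weakDeriv, dif_pos h]
    exact h.choose_spec
  refine ⟨memLp_comp hf i, memLp_comp hw.2.1 i, fun η hη => ?_⟩
  have hint : ∀ {a : ℂ → ℝ} {g : ℂ → R3}, SmoothPeriodic b a → MemLp g 2 (area b) →
      Integrable (fun z => a z • g z) (area b) ∧
        (∫ z, a z • g z ∂(area b)) i = ∫ z, a z * g z i ∂(area b) := by
    intro a g ha hg
    have h1 : Integrable (fun z => a z • g z) (area b) := by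
      rw [← memLp_one_iff_integrable]
      exact hg.smul (ha.memLp 2)
    exact ⟨h1, ((EuclideanSpace.proj i : R3 →L[ℝ] ℝ).integral_comp_comm h1).symm⟩
  have h1 := congrArg (fun u : R3 => u i) (hw.2.2 η hη.contDiff hη.periodic)
  simp only [PiLp.neg_apply] at h1
  rwa [(hint (hη.fderiv v) hf).2, (hint hη hw.2.1).2] at h1

theorem MemH.hasWeakGradient (h : MemH b 2 Y) :
    HasWeakGradient b Y (weakDeriv b 1 Y) (weakDeriv b Complex.I Y) where
  wdx := hasWeakDeriv_weakDeriv h.2.1 h.2.2.1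
  wdy := hasWeakDeriv_weakDeriv h.2.1 h.2.2.2.1
  wdxy i := ⟨_, hasWeakDeriv_weakDeriv h.2.2.2.2.1.2.1 h.2.2.2.2.1.2.2.2.1 i⟩
  wdyx i := ⟨_, hasWeakDeriv_weakDeriv h.2.2.2.2.2.2.1 h.2.2.2.2.2.2.2.1 i⟩

theorem sobNormSq_one : sobNormSq b 1 Y = energy b Y (weakDeriv b 1 Y) (weakDeriv b Complex.I Y) :=
  rfl

theorem sobNormSq_nonneg (k : ℕ) (f : ℂ → R3) : 0 ≤ sobNormSq b k f := by
  induction k generalizing f with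
  | zero => exact integral_nonneg fun z => sq_nonneg _
  | succ k ih =>
    exact add_nonneg (add_nonneg (integral_nonneg fun z => sq_nonneg _) (ih _)) (ih _)

theorem integral_norm_sq_le_sobNormSq (k : ℕ) (f : ℂ → R3) :
    ∫ z, ‖f z‖ ^ 2 ∂(area b) ≤ sobNormSq b k f := by
  cases k with
  | zero => exact le_rfl
  | succ k =>
    have h1 := sobNormSq_nonneg (b := b) k (weakDeriv b 1 f)
    have h2 := sobNormSq_nonneg (b := b) k (weakDeriv b Complex.I f)
    simp only [sobNormSq]
    linarith

theorem sobNormSq_one_le_two : sobNormSq b 1 Y ≤ sobNormSq b 2 Y :=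
  add_le_add (add_le_add le_rfl (integral_norm_sq_le_sobNormSq 1 _))
    (integral_norm_sq_le_sobNormSq 1 _)

theorem sobNorm_sq (k : ℕ) (f : ℂ → R3) : sobNorm b k f ^ 2 = sobNormSq b k f :=
  Real.sq_sqrt (sobNormSq_nonneg k f)

variable (b) in
/-- The Sobolev embedding of `H²` into the bounded functions. -/
theorem exists_norm_le_sobNorm : ∃ K : ℝ, 0 < K ∧ ∀ Y : ℂ → R3, MemH b 2 Y →
    ∀ᵐ z ∂(area b), ‖Y z‖ ≤ K * sobNorm b 2 Y := by
  obtain ⟨M, hM, h⟩ := exists_sq_le_of_weakDeriv (b := b)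
  refine ⟨Real.sqrt (3 * M), by positivity, fun Y hY => ?_⟩
  have hx : MemH b 1 (weakDeriv b 1 Y) := hY.2.2.2.2.1
  have hy : MemH b 1 (weakDeriv b Complex.I Y) := hY.2.2.2.2.2
  have hxx := hasWeakDeriv_weakDeriv hx.2.1 hx.2.2.1
  have hyy := hasWeakDeriv_weakDeriv hy.2.1 hy.2.2.2.1
  have hg := hY.hasWeakGradient
  have hcomp : ∀ i, ∀ᵐ z ∂(area b), Y z i ^ 2 ≤ M * sobNormSq b 2 Y := by
    intro i
    filter_upwards [h _ _ _ _ _ (hg.wdx i) (hg.wdy i) (hxx i) (hyy i)] with z hz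
    refine hz.trans (mul_le_mul_of_nonneg_left ?_ hM.le)
    have h0 := integral_sq_apply_le (fun i => (hg.wdx i).memLp) i
    have h1 := integral_sq_apply_le (fun i => (hxx i).memLp_deriv) i
    have h2 := integral_sq_apply_le (fun i => (hyy i).memLp_deriv) i
    have n1 := integral_norm_sq_le_sobNormSq (b := b) 0 (weakDeriv b 1 Y)
    have n2 := integral_norm_sq_le_sobNormSq (b := b) 0 (weakDeriv b Complex.I Y)
    have n3 := sobNormSq_nonneg (b := b) 0 (weakDeriv b Complex.I (weakDeriv b 1 Y))
    have n4 := sobNormSq_nonneg (b := b) 0 (weakDeriv b 1 (weakDeriv b Complex.I Y))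
    have n5 := sobNormSq_nonneg (b := b) 0 (weakDeriv b 1 Y)
    have n6 := sobNormSq_nonneg (b := b) 0 (weakDeriv b Complex.I Y)
    simp only [sobNormSq] at n3 n4 n5 n6 ⊢
    linarith
  filter_upwards [hcomp 0, hcomp 1, hcomp 2] with z h0 h1 h2
  rw [sobNorm, ← Real.sqrt_mul (by positivity)]
  refine Real.le_sqrt_of_sq_le ?_
  rw [norm_sq_eq_sum]
  linarith

/-- `Q₁` differs from the positive form by the weighted square of the normal component. -/
theorem Q1_eq (hφ : SmoothPeriodic b φ) (hY : MemH b 2 Y) :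
    Q1 b φ Y = form b φ Y (weakDeriv b 1 Y) (weakDeriv b Complex.I Y)
      - ∫ z, (4 * (‖dx φ z‖ ^ 2 + ‖dy φ z‖ ^ 2) + 1) * inner ℝ (φ z) (Y z) ^ 2 ∂(area b) := by
  have hg := hY.hasWeakGradient
  have hN := HasWeakGradient.memLp_inner hφ fun i => (hg.wdx i).memLp
  have hint : Integrable (fun z => (4 * (‖dx φ z‖ ^ 2 + ‖dy φ z‖ ^ 2) + 1)
      * inner ℝ (φ z) (Y z) ^ 2) (area b) := by
    refine (memLp_mul_integrable ((((SmoothPeriodic.const (4 : ℝ)).mul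
      (hφ.dx.norm_sq.add hφ.dy.norm_sq)).add (SmoothPeriodic.const 1)).mul_memLp hN) hN).congr
      (Eventually.of_forall fun z => ?_)
    beta_reduce
    ring
  rw [form, ← integral_sub (HasWeakGradient.integrable_formDensity hφ hg) hint, Q1]
  congr 1
  funext z
  rw [formDensity]
  ring

/-- On fields which satisfy the pointwise constraint, the square of the normal component is of order
`ε²`. -/
theorem integral_weighted_inner_sq_le (hφ : IsHolomorphicMap b φ) {E K ε : ℝ} (hE0 : 0 ≤ E)
    (hE : ∀ z, ‖dx φ z‖ ^ 2 + ‖dy φ z‖ ^ 2 ≤ E) (hK0 : 0 < K)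
    (hK : ∀ᵐ z ∂(area b), ‖Y z‖ ≤ K * sobNorm b 2 Y) (hY : MemH b 2 Y)
    (hc : PointwiseConstraint b ε φ Y) :
    ∫ z, (4 * (‖dx φ z‖ ^ 2 + ‖dy φ z‖ ^ 2) + 1) * inner ℝ (φ z) (Y z) ^ 2 ∂(area b)
      ≤ ε ^ 2 * ((4 * E + 1) * K / 2) * sobNorm b 1 Y * sobNorm b 2 Y ^ 2 := by
  have hA : 0 ≤ sobNorm b 1 Y := Real.sqrt_nonneg _
  have hAB : sobNorm b 1 Y ≤ sobNorm b 2 Y := Real.sqrt_le_sqrt sobNormSq_one_le_two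
  have hB : 0 ≤ sobNorm b 2 Y := hA.trans hAB
  have hD : 0 ≤ ε ^ 2 * ((4 * E + 1) * K / 2) := by positivity
  have iY := HasWeakGradient.integrable_norm_sq (b := b) fun i => memLp_comp hY.memLp i
  calc ∫ z, (4 * (‖dx φ z‖ ^ 2 + ‖dy φ z‖ ^ 2) + 1) * inner ℝ (φ z) (Y z) ^ 2 ∂(area b)
      ≤ ∫ z, ε ^ 2 * ((4 * E + 1) * K / 2) * sobNorm b 2 Y * ‖Y z‖ ^ 2 ∂(area b) := by
        refine integral_mono_of_nonneg (Eventually.of_forall fun z => ?_) (iY.const_mul _) ?_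
        · simp only [Pi.zero_apply]
          positivity
        filter_upwards [hK, hc] with z hz hcz
        have h1 : |inner ℝ (φ z) (Y z)| ≤ ‖Y z‖ := by
          simpa [hφ.norm_eq z] using abs_real_inner_le_norm (φ z) (Y z)
        have h2 : |inner ℝ (φ z) (Y z)| = ε ^ 2 / 2 * ‖Y z‖ ^ 2 := by
          rw [hcz, show -(1 / 2) * ε ^ 2 * ‖Y z‖ ^ 2 = -(ε ^ 2 / 2 * ‖Y z‖ ^ 2) by ring, abs_neg,
            abs_of_nonneg (by positivity)]
        calc (4 * (‖dx φ z‖ ^ 2 + ‖dy φ z‖ ^ 2) + 1) * inner ℝ (φ z) (Y z) ^ 2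
            ≤ (4 * E + 1) * (ε ^ 2 / 2 * ‖Y z‖ ^ 2 * (K * sobNorm b 2 Y)) := by
              rw [show inner ℝ (φ z) (Y z) ^ 2 = ε ^ 2 / 2 * ‖Y z‖ ^ 2 * |inner ℝ (φ z) (Y z)| by
                rw [← h2, ← sq, sq_abs]]
              gcongr
              · exact hE z
              · exact h1.trans hz
          _ = _ := by ring
    _ = ε ^ 2 * ((4 * E + 1) * K / 2) * (sobNorm b 2 Y * ∫ z, ‖Y z‖ ^ 2 ∂(area b)) := by
        rw [integral_const_mul]
        ring
    _ ≤ ε ^ 2 * ((4 * E + 1) * K / 2) * (sobNorm b 2 Y * (sobNorm b 1 Y * sobNorm b 2 Y)) := by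
        refine mul_le_mul_of_nonneg_left (mul_le_mul_of_nonneg_left ?_ hB) hD
        refine (integral_norm_sq_le_sobNormSq 1 Y).trans ?_
        rw [← sobNorm_sq, sq]
        exact mul_le_mul_of_nonneg_left hAB hA
    _ = _ := by ring

end SobolevFields

section NearCoercivity

variable {b : Module.Basis (Fin 2) ℝ ℂ} {n : ℕ} {U : Set (EuclideanSpace ℝ (Fin (4 * n)))}
  {ψ : EuclideanSpace ℝ (Fin (4 * n)) → ℂ → R3}

/-- The pairs of positive constants for which the near coercivity inequality holds at the map `φ`. -/
def coercivityConstants (b : Module.Basis (Fin 2) ℝ ℂ) (φ : ℂ → R3) : Set (ℝ × ℝ) :=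
  {k | 0 < k.1 ∧ 0 < k.2 ∧ ∀ ε : ℝ, 0 < ε → ∀ Y : ℂ → R3, MemH b 2 Y →
    PointwiseConstraint b ε φ Y → OrthKerJacobi b φ Y →
    k.1 * sobNorm b 1 Y ^ 2 - ε ^ 2 * k.2 * sobNorm b 1 Y * sobNorm b 2 Y ^ 2 ≤ Q1 b φ Y}

theorem convex_coercivityConstants (φ : ℂ → R3) : Convex ℝ (coercivityConstants b φ) := by
  rintro ⟨c, d⟩ ⟨hc, hd, h⟩ ⟨c', d'⟩ ⟨hc', hd', h'⟩ s t hs ht hst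
  have hpos : ∀ {x y : ℝ}, 0 < x → 0 < y → 0 < s • x + t • y := fun hx hy =>
    convex_Ioi (0 : ℝ) hx hy hs ht hst
  refine ⟨hpos hc hc', hpos hd hd', fun ε hε Y hY hcon horth => ?_⟩
  have h1 := mul_le_mul_of_nonneg_left (h ε hε Y hY hcon horth) hs
  have h2 := mul_le_mul_of_nonneg_left (h' ε hε Y hY hcon horth) ht
  have h3 : Q1 b φ Y = s * Q1 b φ Y + t * Q1 b φ Y := by rw [← add_mul, hst, one_mul]
  simp only [Prod.smul_mk, Prod.mk_add_mk, smul_eq_mul]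
  rw [h3]
  linarith

theorem exists_local_coercivityConstants (hψ : IsLocalParam b n U ψ)
    {q₀ : EuclideanSpace ℝ (Fin (4 * n))} (hq₀ : q₀ ∈ U) :
    ∃ k : ℝ × ℝ, ∀ᶠ q in 𝓝 q₀, k ∈ coercivityConstants b (ψ q) := by
  obtain ⟨c, hc0, hc⟩ := exists_local_coercive hψ hq₀
  obtain ⟨E, hE0, hE⟩ := exists_bound_gradient hψ hq₀
  obtain ⟨K, hK0, hK⟩ := exists_norm_le_sobNorm b
  refine ⟨(c, (4 * E + 1) * K / 2), ?_⟩
  filter_upwards [hc, hE, hψ.isOpen.eventually_mem hq₀] with q hcq hEq hq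
  refine ⟨hc0, by positivity, fun ε _ Y hY hcon horth => ?_⟩
  have hhol := hψ.isHolomorphicMap q hq
  have h1 := hcq _ _ _ hY.hasWeakGradient fun μ => horth _ (by
    rw [← hψ.span_eq q hq]
    exact Submodule.subset_span ⟨μ, rfl⟩)
  have h2 := integral_weighted_inner_sq_le hhol hE0 hEq hK0 (hK Y hY) hY hcon
  rw [Q1_eq hhol.smooth hY, sobNorm_sq 1, sobNormSq_one]
  exact sub_le_sub h1 h2

end NearCoercivity

end

end TorusLump

theorem theorem6p1 (b : Module.Basis (Fin 2) ℝ ℂ) (n : ℕ) (hn : 2 ≤ n)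
    (U : Set (EuclideanSpace ℝ (Fin (4 * n))))
    (ψ : EuclideanSpace ℝ (Fin (4 * n)) → ℂ → TorusLump.R3)
    (hψ : TorusLump.IsLocalParam b n U ψ) :
    ∃ c c' : EuclideanSpace ℝ (Fin (4 * n)) → ℝ,
      ContinuousOn c U ∧ ContinuousOn c' U ∧ (∀ q ∈ U, 0 < c q ∧ 0 < c' q) ∧
      ∀ q ∈ U, ∀ ε : ℝ, 0 < ε → ∀ Y : ℂ → TorusLump.R3,
        TorusLump.MemH b 2 Y →
        TorusLump.PointwiseConstraint b ε (ψ q) Y →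
        TorusLump.OrthKerJacobi b (ψ q) Y →
        c q * TorusLump.sobNorm b 1 Y ^ 2
            - ε ^ 2 * c' q * TorusLump.sobNorm b 1 Y * TorusLump.sobNorm b 2 Y ^ 2
          ≤ TorusLump.Q1 b (ψ q) Y := by
  classical
  obtain ⟨g, hg⟩ := exists_continuous_forall_mem_convex_of_local_const
    (t := fun q : U => TorusLump.coercivityConstants b (ψ q))
    (fun q => TorusLump.convex_coercivityConstants (ψ q)) fun q => by
      obtain ⟨k, hk⟩ := TorusLump.exists_local_coercivityConstants hψ q.2
      exact ⟨k, continuous_subtype_val.continuousAt.eventually hk⟩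
  -- `g` is only defined on `U`; the values off `U` are irrelevant
  set G : EuclideanSpace ℝ (Fin (4 * n)) → ℝ × ℝ :=
    fun q => if h : q ∈ U then g ⟨q, h⟩ else 0 with hG
  have hGg : ∀ q : U, G q = g q := fun q => by simp [hG]
  have hGc : ContinuousOn G U := by
    rw [continuousOn_iff_continuous_domRestrict]
    exact g.continuous.congr fun q => (hGg q).symm
  have hGm : ∀ q ∈ U, G q ∈ TorusLump.coercivityConstants b (ψ q) := fun q hq => by
    rw [hGg ⟨q, hq⟩]
    exact hg ⟨q, hq⟩
  exact ⟨fun q => (G q).1, fun q => (G q).2, hGc.fst, hGc.snd,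
    fun q hq => ⟨(hGm q hq).1, (hGm q hq).2.1⟩, fun q hq => (hGm q hq).2.2⟩
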